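/- **Setting.** Let $\bar R\to R\to S$ be surjective homomorphisms of commutative coherent rings with finitely generated kernels. Put $I=\operatorname{Ker}(\bar R\to S)$ and $J=\operatorname{Ker}(\bar R\to R)$, and assume $IJ=0$; thus $J$ is an $S$-module, and it is finitely presented over $S$. For a commutative coherent ring $A$, an $A$-linear abelian category $\mathcal A$, an object $X$ of $\mathcal A$ and a finitely presented $A$-module $M$, let $\mathrm{Hom}_A(M,X)\in\mathcal A$ be the object representing $Z\mapsto \mathrm{Hom}_A(M,\mathcal A(Z,X))$. The object $X$ is *coflat* (over $A$) if $\mathrm{Hom}_A(-,X)$ is exact on finitely presented $A$-modules, and $\mathsf{Cof}(\mathcal A)$ is the full subcategory of coflat objects. The category $\mathcal A$ is *flat* (over $A$) if injective objects are coflat, provided $\mathcal A$ has enough injectives; in general, if this holds for the ind-completion of (a small model of) $\mathcal A$. For a surjection $A\to B$ of commutative coherent rings with finitely generated kernel, a *deformation* of a $B$-linear abelian category $\mathcal B$ along $A\to B$ is an $A$-linear functor $\mathcal B\to\mathcal A$ into an $A$-linear abelian category that induces an equivalence from $\mathcal B$ to the category of objects $X$ of $\mathcal A$ equipped with an $A$-algebra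 map $B\to\mathcal A(X,X)$; it is *flat* if $\mathcal A$ is flat over $A$. Such a functor is exact and fully faithful, and has a right adjoint $\mathrm{Hom}_A(B,-)$. Let $\mathcal C_0$ be an $S$-linear abelian category that is flat over $S$, let $\mathcal C_0\to\mathcal C$ be a flat deformation along $R\to S$, and let $\mathcal C\to\bar{\mathcal C}$ be a flat deformation along $\bar R\to R$. Let $C\in\mathsf{Cof}(\mathcal C)$. A *lift* of $C$ is a pair $(\bar C,c)$ of an object $\bar C\in\mathsf{Cof}(\bar{\mathcal C})$ and an isomorphism $c:C\cong\mathrm{Hom}_{\bar R}(R,\bar C)$; an isomorphism of lifts is an isomorphism of the objects $\bar C$ that is compatible with the maps $c$. Put $Y=\mathrm{Hom}_R(S,C)\in\mathcal C_0$, which is $R\mathrm{Hom}_R(S,C)$, and write $\mathrm{Hom}_R(J,C)=\mathrm{Hom}_S(J,Y)$ and $R\mathrm{Hom}_R(J,C)=R\mathrm{Hom}_S(J,Y)$; the latter is the complex $\mathrm{Hom}_S(P_\bullet,Y)$, for any resolution $P_\bullet\to J$ by finitely presented projective $S$-modules. Let $$\mathbf C=R\mathrm{Hom}_{\mathcal C_0}\bigl(R\mathrm{Hom}_R(J,C),\,R\mathrm{Hom}_R(S,C)\bigr)=R\mathrm{Hom}_{\mathcal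 C_0}\bigl(\mathrm{Hom}_S(P_\bullet,Y),\,Y\bigr).$$ The map $\mathrm{Hom}_S(J,Y)\to\mathrm{Hom}_S(P_\bullet,Y)$, the exact functor $\mathcal C_0\to\mathcal C$ and the inclusion $Y\to C$ induce maps $\Psi^n:H^n\mathbf C\to\mathrm{Ext}^n_{\mathcal C}(\mathrm{Hom}_R(J,C),C)$. **Theorem.** 1. There is an obstruction $o(C)\in H^2\mathbf C$ such that $C$ has a lift if and only if $o(C)=0$. Here $\Psi^2(o(C))$ is the Yoneda class of the exact sequence $$0\to C\to\mathrm{Hom}_{\bar R}(R,E)\to\mathrm{Hom}_{\bar R}(R,Q)\to\mathrm{Hom}_R(J,C)\to0$$ in $\mathcal C$ obtained from a short exact sequence $0\to C\to E\to Q\to0$ in $\bar{\mathcal C}$, the last map being the one that describes the multiplication by $J$ on the part of $E$ lying over $\mathrm{Hom}_{\bar R}(R,Q)$. There are short exact sequences $0\to C\to E\to Q\to 0$ for which this sequence is exact, and the class does not depend on the choice of such a sequence. 2. If $o(C)=0$, the set of isomorphism classes of lifts of $C$ is affine over $H^1\mathbf C$, that is, it is non-empty and $H^1\mathbf C$ acts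 on it simply transitively. Here $\xi\in H^1\mathbf C$ takes the class of $\bar C$ to the class of $\bar C'$ if and only if the classes of the extensions $$0\to C\to\bar C\to\mathrm{Hom}_R(J,C)\to0,\qquad 0\to C\to\bar C'\to\mathrm{Hom}_R(J,C)\to0$$ given by the two lifts differ by the image of $\xi$: $[\bar C']=[\bar C]+\Psi^1(\xi)$ in $\mathrm{Ext}^1_{\bar{\mathcal C}}(\mathrm{Hom}_R(J,C),C)$. -/

import Mathlib

open CategoryTheory Limits
universe u w w₁ w₂ w₃ v₁ v₂ v₃ u₁ u₂ u₃

namespace CoflatLift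

/-- A commutative ring is coherent if its finitely generated ideals are finitely presented. -/
class IsCoherentRing (R : Type u) [CommRing R] : Prop where
  finitePresentation_of_fg (I : Ideal R) : I.FG → Module.FinitePresentation R I

section HomObject

variable (R : Type u) [CommRing R] {C : Type u₁} [Category.{v₁} C] [Abelian C] [Linear R C]

/-- `H`, together with the linear family of maps `ev`, represents the functor
`T ↦ Hom_R(M, Hom_C(T, X))`. -/
def IsHomObj {M : Type w} [AddCommGroup M] [Module R M] {X H : C} (ev : M →ₗ[R] (H ⟶ X)) : Prop :=
  ∀ (T : C) (f : M →ₗ[R] (T ⟶ X)), ∃! g : T ⟶ H, ∀ m, g ≫ ev m = f m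

theorem exists_isHomObj (M : Type w) [AddCommGroup M] [Module R M] [Module.FinitePresentation R M]
    (X : C) : ∃ (H : C) (ev : M →ₗ[R] (H ⟶ X)), IsHomObj R ev := by
  obtain ⟨n, m, f, g, hf, hfg⟩ := Module.FinitePresentation.exists_fin' R M
  let P : C := ∏ᶜ fun _ : Fin n => X
  let lc {T : C} (h : T ⟶ P) : (Fin n → R) →ₗ[R] (T ⟶ X) :=
    Fintype.linearCombination R (fun a => h ≫ Pi.π _ a)
  have lc_comp {T T' : C} (h : T ⟶ P) (t : T' ⟶ T) (v) : lc (t ≫ h) v = t ≫ lc h v := by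
    simp [lc, Fintype.linearCombination_apply, Preadditive.comp_sum, Linear.comp_smul]
  let q : P ⟶ ∏ᶜ fun _ : Fin m => X := Pi.lift fun b => lc (𝟙 P) (g (Pi.single b 1))
  have hq {T : C} (h : T ⟶ P) (b) : h ≫ q ≫ Pi.π _ b = lc h (g (Pi.single b 1)) := by
    simp only [q, limit.lift_π, Fan.mk_π_app]
    rw [← lc_comp, Category.comp_id]
  have hker : LinearMap.ker f ≤ LinearMap.ker (lc (kernel.ι q)) := by
    intro v hv
    obtain ⟨y, rfl⟩ := (hfg v).1 hv
    have : lc (kernel.ι q) ∘ₗ g = 0 := by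
      apply (Pi.basisFun R (Fin m)).ext
      intro b
      rw [Pi.basisFun_apply, LinearMap.comp_apply, ← hq, kernel.condition_assoc]
      simp
    exact LinearMap.congr_fun this y
  let ev : M →ₗ[R] (kernel q ⟶ X) :=
    (LinearMap.ker f).liftQ _ hker ∘ₗ (f.quotKerEquivOfSurjective hf).symm.toLinearMap
  have hev (v) : ev (f v) = lc (kernel.ι q) v := by
    have : (f.quotKerEquivOfSurjective hf).symm (f v) = Submodule.Quotient.mk v := by
      rw [LinearEquiv.symm_apply_eq]; rfl
    simp [ev, this]
  have hlc {T : C} (h : T ⟶ P) (a) : lc h (Pi.single a 1) = h ≫ Pi.π _ a := by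
    simp [lc, Fintype.linearCombination_apply_single]
  refine ⟨kernel q, ev, fun T φ => ?_⟩
  let h : T ⟶ P := Pi.lift fun a => φ (f (Pi.single a 1))
  have hh : lc h = φ ∘ₗ f := by
    apply (Pi.basisFun R (Fin n)).ext
    intro a
    rw [Pi.basisFun_apply, hlc]
    simp [h]
  have h0 : h ≫ q = 0 := by
    apply Limits.Pi.hom_ext
    intro b
    rw [Category.assoc, hq, hh, LinearMap.comp_apply, (hfg _).2 ⟨_, rfl⟩]
    simp
  refine ⟨kernel.lift q h h0, fun m => ?_, fun g' hg' => ?_⟩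
  · obtain ⟨v, rfl⟩ := hf m
    rw [hev, ← lc_comp, kernel.lift_ι, hh]; rfl
  · rw [← cancel_mono (kernel.ι q), kernel.lift_ι]
    apply Limits.Pi.hom_ext
    intro a
    rw [Category.assoc, ← hlc (kernel.ι q), ← hev, hg']
    simp [h]

variable (M : Type w) [AddCommGroup M] [Module R M] [Module.FinitePresentation R M] (X : C)

/-- The object `Hom_R(M, X)` of `C`, for a finitely presented module `M`. -/
noncomputable def homObj : C := (exists_isHomObj R M X).choose

/-- The evaluation maps `Hom_R(M, X) ⟶ X`. -/
noncomputable def homEv : M →ₗ[R] (homObj R M X ⟶ X) := (exists_isHomObj R M X).choose_spec.choose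

theorem isHomObj_homEv : IsHomObj R (homEv R M X) :=
  (exists_isHomObj R M X).choose_spec.choose_spec

variable {M X}

/-- The map `T ⟶ Hom_R(M, X)` corresponding to a linear map `M → Hom_C(T, X)`. -/
noncomputable def homLift {T : C} (f : M →ₗ[R] (T ⟶ X)) : T ⟶ homObj R M X :=
  (isHomObj_homEv R M X T f).choose

@[simp]
theorem homLift_ev {T : C} (f : M →ₗ[R] (T ⟶ X)) (m : M) :
    homLift R f ≫ homEv R M X m = f m :=
  (isHomObj_homEv R M X T f).choose_spec.1 m

theorem homObj_ext {T : C} {g h : T ⟶ homObj R M X}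
    (w : ∀ m, g ≫ homEv R M X m = h ≫ homEv R M X m) : g = h := by
  refine (isHomObj_homEv R M X T (Linear.leftComp R X g ∘ₗ homEv R M X)).unique ?_ ?_
  · intro m; rfl
  · intro m; exact (w m).symm

variable {N : Type w₁} [AddCommGroup N] [Module R N] [Module.FinitePresentation R N]
  {L : Type w₂} [AddCommGroup L] [Module R L] [Module.FinitePresentation R L]

variable (X) in
/-- The map `Hom_R(N, X) ⟶ Hom_R(M, X)` induced by a linear map `M → N`. -/
noncomputable def homMap (f : M →ₗ[R] N) : homObj R N X ⟶ homObj R M X :=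
  homLift R (homEv R N X ∘ₗ f)

@[simp]
theorem homMap_ev (f : M →ₗ[R] N) (m : M) :
    homMap R X f ≫ homEv R M X m = homEv R N X (f m) := by
  simp [homMap]

theorem homMap_comp (f : M →ₗ[R] N) (g : N →ₗ[R] L) :
    homMap R X g ≫ homMap R X f = homMap R X (g ∘ₗ f) :=
  homObj_ext R fun m => by simp

theorem homMap_zero : homMap R X (0 : M →ₗ[R] N) = 0 :=
  homObj_ext R fun m => by simp

end HomObject

section Flatness

variable (R : Type u) [CommRing R] (C : Type u₁) [Category.{v₁} C] [Abelian C] [Linear R C]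

variable {C} in
/-- An object `X` is `R`-coflat if the functor `Hom_R(-, X)` sends short exact sequences
`0 → M → N → L → 0` of finitely presented `R`-modules to short exact sequences in `C`. -/
def IsCoflat (X : C) : Prop :=
  ∀ (M N L : Type u) [AddCommGroup M] [AddCommGroup N] [AddCommGroup L]
    [Module R M] [Module R N] [Module R L]
    [Module.FinitePresentation R M] [Module.FinitePresentation R N] [Module.FinitePresentation R L]
    (f : M →ₗ[R] N) (g : N →ₗ[R] L) (h : Function.Exact f g),
    Function.Injective f → Function.Surjective g →
    (ShortComplex.mk (homMap R X g) (homMap R X f)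
      (by rw [homMap_comp, h.linearMap_comp_eq_zero, homMap_zero])).ShortExact

variable {C} in
/-- The property of objects defining the full subcategory of coflat objects. -/
def coflat : ObjectProperty C := fun X => IsCoflat R X

/-- The small model `AsSmall C` of an `R`-linear category is `R`-linear. -/
noncomputable instance asSmallLinear : Linear R (AsSmall.{w} C) where
  homModule X Y :=
    { smul r f := ⟨r • f.down⟩
      one_smul f := ULift.ext _ _ (one_smul R f.down)
      mul_smul r s f := ULift.ext _ _ (mul_smul r s f.down)
      smul_zero r := ULift.ext _ _ <| by
        change r • AsSmall.down.map (0 : X ⟶ Y) = AsSmall.down.map (0 : X ⟶ Y)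
        rw [Functor.map_zero, smul_zero]
      smul_add r f g := ULift.ext _ _ <| by
        change r • AsSmall.down.map (f + g) = AsSmall.down.map (_ + _)
        rw [Functor.map_add, smul_add, Functor.map_add]
        rfl
      add_smul r s f := ULift.ext _ _ <| by
        change (r + s) • AsSmall.down.map f = AsSmall.down.map (_ + _)
        rw [Functor.map_add, add_smul]
        rfl
      zero_smul f := ULift.ext _ _ <| by
        change (0 : R) • AsSmall.down.map f = AsSmall.down.map (0 : X ⟶ Y)
        rw [Functor.map_zero, zero_smul] }
  smul_comp _ _ _ r f g := ULift.ext _ _ (Linear.smul_comp _ _ _ r f.down g.down)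
  comp_smul _ _ _ f r g := ULift.ext _ _ (Linear.comp_smul _ _ _ f.down r g.down)

end Flatness

section Ind

variable {R : Type u} [CommRing R] {D : Type w} [SmallCategory D] [Abelian D] [Linear R D]

/-- The action of `r` on a presheaf on an `R`-linear category. -/
def presheafAct (r : R) (P : Dᵒᵖ ⥤ Type w) : P ⟶ P where
  app X := P.map (r • 𝟙 X.unop).op
  naturality X Y f := by
    rw [← P.map_comp, ← P.map_comp]
    congr 1
    apply Quiver.Hom.unop_inj
    simp

/-- The action of `r` on an ind-object: the unique endomorphism that extends the multiplication
by `r` on the objects of `D`. -/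
noncomputable def indAct (r : R) (X : Ind D) : X ⟶ X :=
  (Ind.inclusion D).preimage (presheafAct r _)

theorem indAct_comm (r : R) {X Y : Ind D} (f : X ⟶ Y) : indAct r X ≫ f = f ≫ indAct r Y := by
  apply (Ind.inclusion D).map_injective
  ext T : 2
  simp [indAct, presheafAct]

theorem indAct_yoneda (r : R) (X : D) :
    indAct r (Ind.yoneda.obj X) = Ind.yoneda.map (r • 𝟙 X) := by
  apply (Ind.inclusion D).map_injective
  have h1 := Ind.yonedaCompInclusion.hom.naturality (r • 𝟙 X)
  rw [← cancel_mono (Ind.yonedaCompInclusion.hom.app X)]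
  refine Eq.trans ?_ h1.symm
  ext T : 2
  simp [indAct, presheafAct]

theorem ind_hom_ext {X Y : Ind D} {f g : X ⟶ Y}
    (h : ∀ (T : D) (x : Ind.yoneda.obj T ⟶ X), x ≫ f = x ≫ g) : f = g := by
  refine Ind.isSeparating_range_yoneda _ _ fun T hT x => ?_
  obtain ⟨T⟩ := hT
  exact h T x

instance : (Ind.yoneda : D ⥤ Ind D).Additive :=
  Functor.additive_of_preserves_binary_products _

theorem comp_indAct (r : R) {T : D} {X : Ind D} (x : Ind.yoneda.obj T ⟶ X) :
    x ≫ indAct r X = Ind.yoneda.map (r • 𝟙 T) ≫ x := by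
  rw [← indAct_comm, indAct_yoneda]

/-- The category of ind-objects of an `R`-linear category is `R`-linear. -/
noncomputable instance indLinear : Linear R (Ind D) where
  homModule X Y :=
    { smul r f := indAct r X ≫ f
      one_smul f := ind_hom_ext fun T x => by
        change x ≫ indAct 1 X ≫ f = _
        rw [← Category.assoc, comp_indAct]; simp
      mul_smul r s f := ind_hom_ext fun T x => by
        change x ≫ indAct (r * s) X ≫ f = x ≫ indAct r X ≫ indAct s X ≫ f
        rw [reassoc_of% (comp_indAct (r * s) x), reassoc_of% (comp_indAct r x),
          reassoc_of% (comp_indAct s x), ← Functor.map_comp_assoc]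
        simp [mul_smul, smul_comm r s]
      smul_zero r := comp_zero
      smul_add r f g := Preadditive.comp_add _ _ _ _ _ _
      add_smul r s f := ind_hom_ext fun T x => by
        change x ≫ indAct (r + s) X ≫ f = x ≫ (indAct r X ≫ f + indAct s X ≫ f)
        rw [Preadditive.comp_add]
        simp only [← Category.assoc, comp_indAct]
        simp [add_smul, Functor.map_add, Preadditive.add_comp]
      zero_smul f := ind_hom_ext fun T x => by
        change x ≫ indAct 0 X ≫ f = x ≫ 0
        rw [← Category.assoc, comp_indAct]; simp }
  smul_comp X Y Z r f g := Category.assoc _ _ _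
  comp_smul X Y Z f r g := by
    change f ≫ indAct r Y ≫ g = indAct r X ≫ f ≫ g
    rw [← Category.assoc, ← indAct_comm, Category.assoc]

end Ind

/-- Flatness of an `R`-linear abelian category: if the category has enough injectives, then its
injectives have to be coflat; in general, the injectives of the category of ind-objects (of a small
model of the category) have to be coflat. -/
def IsFlat (R : Type u) [CommRing R] (C : Type u₁) [Category.{v₁} C] [Abelian C] [Linear R C] :
    Prop :=
  (EnoughInjectives C ∧ ∀ E : C, Injective E → IsCoflat R E) ∨
    ∀ E : Ind (AsSmall.{v₁} C), Injective E → IsCoflat R E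


section Deformation

variable {R : Type u} {S : Type u} [CommRing R] [CommRing S]

/-- An `S`-object of an `R`-linear category: an object with an `S`-structure that extends the
`R`-structure along `θ : R → S`. -/
structure SObject (θ : R →+* S) (C : Type u₁) [Category.{v₁} C] [Preadditive C] [Linear R C] where
  /-- the underlying object -/
  obj : C
  /-- the `S`-structure -/
  str : S →+* End obj
  compat (r : R) : str (θ r) = r • 𝟙 obj

variable {θ : R →+* S} {C₀ : Type u₁} [Category.{v₁} C₀] [Abelian C₀] [Linear S C₀]
  {C : Type u₂} [Category.{v₂} C] [Abelian C] [Linear R C]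

/-- Morphisms of `S`-objects are the morphisms that commute with the `S`-structures. -/
instance : Category.{v₂} (SObject θ C) where
  Hom X Y := { f : X.obj ⟶ Y.obj // ∀ s : S, X.str s ≫ f = f ≫ Y.str s }
  id X := ⟨𝟙 X.obj, fun s => by simp⟩
  comp f g := ⟨f.1 ≫ g.1, fun s => by rw [← Category.assoc, f.2, Category.assoc, g.2, Category.assoc]⟩

variable (θ) in
/-- A functor from an `S`-linear category to an `R`-linear category is `R`-linear. -/
structure IsLinearAlong (G : C₀ ⥤ C) : Prop where
  additive : G.Additive
  map_smul (r : R) {X Y : C₀} (f : X ⟶ Y) : G.map (θ r • f) = r • G.map f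

/-- An `R`-linear functor from an `S`-linear category takes its values in `S`-objects. -/
def IsLinearAlong.toSObject {G : C₀ ⥤ C} (h : IsLinearAlong θ G) : C₀ ⥤ SObject θ C where
  obj X :=
    { obj := G.obj X
      str :=
        { toFun s := G.map (s • 𝟙 X)
          map_one' := by simp
          map_zero' := by have := h.additive; simp
          map_add' s t := by have := h.additive; simp [add_smul, G.map_add]
          map_mul' s t := by
            change _ = G.map _ ≫ G.map _
            rw [← G.map_comp]; simp [mul_smul] }
      compat r := by
        change G.map (θ r • 𝟙 X) = _
        rw [h.map_smul, G.map_id] }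
  map f := ⟨G.map f, fun s => by
    change G.map _ ≫ G.map _ = G.map _ ≫ G.map _
    rw [← G.map_comp, ← G.map_comp, Linear.smul_comp, Linear.comp_smul, Category.comp_id,
      Category.id_comp]⟩
  map_id X := Subtype.ext (G.map_id X)
  map_comp f g := Subtype.ext (G.map_comp f g)

variable (θ) in
/-- A deformation along `θ : R → S` of an `S`-linear abelian category `C₀`: an `R`-linear functor
`G : C₀ ⥤ C` inducing an equivalence of `C₀` with the category of `S`-objects of `C`. -/
structure IsDeformation (G : C₀ ⥤ C) : Prop where
  linear : IsLinearAlong θ G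
  isEquivalence : linear.toSObject.IsEquivalence

variable (θ) in
/-- A deformation is flat if the deformed category is flat. -/
structure IsFlatDeformation (G : C₀ ⥤ C) : Prop extends IsDeformation θ G where
  flat : IsFlat R C

namespace IsDeformation

variable {G : C₀ ⥤ C}

theorem faithful (h : IsDeformation θ G) : G.Faithful where
  map_injective {X Y f g} w := by
    have := h.isEquivalence
    exact h.linear.toSObject.map_injective (Subtype.ext w)

theorem full (h : IsDeformation θ G) (hθ : Function.Surjective θ) : G.Full where
  map_surjective {X Y} f := by
    have := h.isEquivalence
    have hf : ∀ s : S, G.map (s • 𝟙 X) ≫ f = f ≫ G.map (s • 𝟙 Y) := by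
      intro s
      obtain ⟨r, rfl⟩ := hθ s
      simp [h.linear.map_smul]
    obtain ⟨g, hg⟩ := h.linear.toSObject.map_surjective
      (X := X) (Y := Y) ⟨f, hf⟩
    exact ⟨g, congrArg Subtype.val hg⟩

/-- The image consists of the objects that are annihilated by the kernel of `θ`. -/
theorem exists_iso (h : IsDeformation θ G) (hθ : Function.Surjective θ) (Y : C)
    (hY : ∀ r, θ r = 0 → r • 𝟙 Y = 0) : ∃ X : C₀, Nonempty (G.obj X ≅ Y) := by
  have := h.isEquivalence
  have key {r r' : R} (hr : θ r = θ r') : r • 𝟙 Y = r' • 𝟙 Y := by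
    rw [← sub_eq_zero, ← sub_smul]
    exact hY _ (by rw [map_sub, hr, sub_self])
  let Z : SObject θ C :=
    { obj := Y
      str :=
        { toFun s := (Function.surjInv hθ s) • 𝟙 Y
          map_one' := by
            refine (key (r' := 1) ?_).trans (one_smul _ _)
            simp [Function.surjInv_eq]
          map_zero' := hY _ (Function.surjInv_eq hθ 0)
          map_add' s t := by
            rw [← add_smul]
            exact key (by simp [Function.surjInv_eq])
          map_mul' s t := by
            change _ = (_ • 𝟙 Y) ≫ (_ • 𝟙 Y)
            rw [Linear.smul_comp, Category.id_comp, smul_smul]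
            exact key (by simp [Function.surjInv_eq, mul_comm]) }
      compat r := key (Function.surjInv_eq hθ _) }
  refine ⟨h.linear.toSObject.objPreimage Z, ⟨?_⟩⟩
  let e := h.linear.toSObject.objObjPreimageIso Z
  exact
    { hom := e.hom.1
      inv := e.inv.1
      hom_inv_id := congrArg Subtype.val e.hom_inv_id
      inv_hom_id := congrArg Subtype.val e.inv_hom_id }

theorem smul_eq_zero (h : IsDeformation θ G) {r : R} (hr : θ r = 0) {X : C₀} {Y : C}
    (f : G.obj X ⟶ Y) : r • f = 0 := by
  have := h.linear.additive
  have h1 : r • 𝟙 (G.obj X) = 0 := by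
    rw [← G.map_id, ← h.linear.map_smul, hr, zero_smul, G.map_zero]
  rw [← Category.id_comp f, ← Linear.smul_comp, h1, zero_comp]

theorem isLeftAdjoint (h : IsDeformation θ G) (hθ : Function.Surjective θ)
    (hfg : (RingHom.ker θ).FG) : G.IsLeftAdjoint := by
  have := h.faithful
  have := h.full hθ
  have : Module.FinitePresentation R (R ⧸ RingHom.ker θ) :=
    Module.finitePresentation_of_surjective (RingHom.ker θ).mkQ (Submodule.mkQ_surjective _)
      (by rwa [Submodule.ker_mkQ])
  let H (Y : C) : C := homObj R (R ⧸ RingHom.ker θ) Y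
  have hH (Y : C) (r : R) (hr : θ r = 0) : r • 𝟙 (H Y) = 0 := by
    refine homObj_ext R fun m => ?_
    obtain ⟨m, rfl⟩ := Submodule.mkQ_surjective _ m
    rw [Linear.smul_comp, Category.id_comp, zero_comp, ← map_smul, ← map_smul,
      Submodule.mkQ_apply, (Submodule.Quotient.mk_eq_zero _).2, map_zero]
    exact Ideal.mul_mem_right m _ ((RingHom.mem_ker).2 hr)
  choose K hK using fun Y => h.exists_iso hθ (H Y) (hH Y)
  let i (Y : C) : G.obj (K Y) ≅ H Y := (hK Y).some
  let lin {X : C₀} {Y : C} (f : G.obj X ⟶ Y) : (R ⧸ RingHom.ker θ) →ₗ[R] (G.obj X ⟶ Y) :=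
    (RingHom.ker θ).liftQ (LinearMap.toSpanSingleton R _ f) fun r hr => by
      simpa using h.smul_eq_zero hr f
  let ev (Y : C) : H Y ⟶ Y := homEv R (R ⧸ RingHom.ker θ) Y (Submodule.Quotient.mk 1)
  have ev_mono (Y : C) : Mono (ev Y) := ⟨fun {Z} a b w => homObj_ext R fun m => by
    obtain ⟨m, rfl⟩ := Submodule.mkQ_surjective _ m
    have : (RingHom.ker θ).mkQ m = m • Submodule.Quotient.mk 1 := by
      rw [Submodule.mkQ_apply, ← Submodule.Quotient.mk_smul, smul_eq_mul, mul_one]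
    rw [this, map_smul, Linear.comp_smul, Linear.comp_smul]
    exact congrArg _ w⟩
  have lin_ev {X : C₀} {Y : C} (f : G.obj X ⟶ Y) : homLift R (lin f) ≫ ev Y = f := by
    rw [homLift_ev]
    change (1 : R) • f = f
    rw [one_smul]
  let t {X : C₀} {Y : C} (g : X ⟶ K Y) : G.obj X ⟶ Y := G.map g ≫ (i Y).hom ≫ ev Y
  have ht (X : C₀) (Y : C) : Function.Bijective (t : (X ⟶ K Y) → (G.obj X ⟶ Y)) := by
    refine ⟨fun a b w => G.map_injective ?_, fun f =>
      ⟨G.preimage (homLift R (lin f) ≫ (i Y).inv), ?_⟩⟩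
    · have := ev_mono Y
      simpa only [t, ← Category.assoc, cancel_mono] using w
    · simp only [t, G.map_preimage, Category.assoc, Iso.inv_hom_id_assoc, lin_ev]
  refine (Adjunction.adjunctionOfEquivRight
    (fun X Y => (Equiv.ofBijective t (ht X Y)).symm) ?_).isLeftAdjoint
  intro X' X Y f g
  rw [Equiv.symm_apply_eq]
  obtain ⟨g, rfl⟩ := (Equiv.ofBijective t (ht X Y)).surjective g
  rw [Equiv.symm_apply_apply]
  simp [t]

theorem preservesFiniteColimits (h : IsDeformation θ G) (hθ : Function.Surjective θ)
    (hfg : (RingHom.ker θ).FG) : PreservesFiniteColimits G := by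
  have := h.isLeftAdjoint hθ hfg
  have := (Adjunction.ofIsLeftAdjoint G).leftAdjoint_preservesColimits (C := C₀)
  infer_instance

theorem map_mono (h : IsDeformation θ G) (hθ : Function.Surjective θ) {X Y : C₀} (f : X ⟶ Y)
    [Mono f] : Mono (G.map f) := by
  have := h.linear.additive
  have := h.full hθ
  have := h.faithful
  refine Preadditive.mono_of_kernel_zero (f := G.map f) ?_
  obtain ⟨K, ⟨e⟩⟩ := h.exists_iso hθ (kernel (G.map f)) fun r hr => by
    rw [← cancel_mono (kernel.ι (G.map f)), Linear.smul_comp, Category.id_comp, zero_comp,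
      ← Category.comp_id (kernel.ι (G.map f)), ← Linear.comp_smul, h.smul_eq_zero hr, comp_zero]
  have h0 : G.preimage (e.hom ≫ kernel.ι (G.map f)) = 0 := by
    rw [← cancel_mono f, zero_comp]
    apply G.map_injective
    simp
  have h1 := congrArg (fun x => e.inv ≫ G.map x) h0
  simpa using h1

theorem preservesFiniteLimits (h : IsDeformation θ G) (hθ : Function.Surjective θ)
    (hfg : (RingHom.ker θ).FG) : PreservesFiniteLimits G := by
  have := h.linear.additive
  have hc := h.preservesFiniteColimits hθ hfg
  have hc' : ∀ T : ShortComplex C₀, T.ShortExact → (T.map G).Exact ∧ Epi (G.map T.g) :=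
    ((Functor.preservesFiniteColimits_tfae G).out 3 0).1 hc
  refine ((Functor.preservesFiniteLimits_tfae G).out 0 3).1 fun T hT => ?_
  have := hT.mono_f
  exact ⟨(hc' T hT).1, h.map_mono hθ T.f⟩

end IsDeformation

end Deformation

section Lift

/-- A lift of `X` along `F`: an object whose image under `F` is identified with `X`. -/
structure Lift {𝒟 : Type u₁} [Category.{v₁} 𝒟] {𝒞 : Type u₂} [Category.{v₂} 𝒞] (F : 𝒟 ⥤ 𝒞)
    (X : 𝒞) where
  /-- the lifted object -/
  obj : 𝒟
  /-- the identification of its image -/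
  iso : X ≅ F.obj obj

variable {𝒟 : Type u₁} [Category.{v₁} 𝒟] {𝒞 : Type u₂} [Category.{v₂} 𝒞] {F : 𝒟 ⥤ 𝒞} {X : 𝒞}

/-- The groupoid of lifts of `X`: morphisms are the isomorphisms lifting the identity of `X`. -/
instance : Groupoid (Lift F X) where
  Hom L L' := { f : L.obj ≅ L'.obj // L.iso.hom ≫ F.map f.hom = L'.iso.hom }
  id L := ⟨Iso.refl _, by simp⟩
  comp f g := ⟨f.1 ≪≫ g.1, by
    rw [Iso.trans_hom, F.map_comp, ← Category.assoc, f.2, g.2]⟩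
  inv f := ⟨f.1.symm, by
    have h := f.2
    generalize f.1 = g at h
    rw [← h]
    simp [← F.map_comp]⟩
  inv_comp f := Subtype.ext (by simp)
  comp_inv f := Subtype.ext (by simp)

/-- The skeleton of a category: the isomorphism classes of its objects. -/
def Sk (𝒟 : Type u₁) [Category.{v₁} 𝒟] : Type u₁ := Quotient (isIsomorphicSetoid 𝒟)

/-- The isomorphism class of an object. -/
def Sk.mk {𝒟 : Type u₁} [Category.{v₁} 𝒟] (X : 𝒟) : Sk 𝒟 :=
  Quotient.mk (isIsomorphicSetoid 𝒟) X

end Lift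

/-- Surjective maps of commutative rings `Rbar → R → S` with finitely generated kernels, such that
`I J = 0`, where `I` is the kernel of `Rbar → S` and `J` is the kernel of `Rbar → R`. -/
structure RingTower (Rbar R S : Type u) [CommRing Rbar] [CommRing R] [CommRing S] where
  /-- the map `Rbar → R` -/
  φ : Rbar →+* R
  /-- the map `R → S` -/
  ψ : R →+* S
  φ_surjective : Function.Surjective φ
  ψ_surjective : Function.Surjective ψ
  φ_fg : (RingHom.ker φ).FG
  ψ_fg : (RingHom.ker ψ).FG
  mul_eq_bot : RingHom.ker (ψ.comp φ) * RingHom.ker φ = ⊥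

namespace RingTower

variable {Rbar R S : Type u} [CommRing Rbar] [CommRing R] [CommRing S] (T : RingTower Rbar R S)

/-- The kernel `J` of `Rbar → R`. -/
def J : Type u := RingHom.ker T.φ

/-- The inclusion of `J`. -/
def J.val {T : RingTower Rbar R S} (a : T.J) : Rbar := Subtype.val a

instance : AddCommGroup T.J := inferInstanceAs (AddCommGroup (RingHom.ker T.φ))

instance : Module Rbar T.J := inferInstanceAs (Module Rbar (RingHom.ker T.φ))

theorem comp_surjective : Function.Surjective (T.ψ.comp T.φ) :=
  T.ψ_surjective.comp T.φ_surjective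

noncomputable instance : SMul S T.J where
  smul s a := Function.surjInv T.comp_surjective s • a

theorem smul_def (r : Rbar) (a : T.J) : T.ψ.comp T.φ r • a = r • a := by
  apply Subtype.ext
  change Function.surjInv T.comp_surjective _ * a.val = r * a.val
  rw [← sub_eq_zero, ← sub_mul, ← Ideal.mem_bot, ← T.mul_eq_bot]
  refine Ideal.mul_mem_mul ?_ a.2
  rw [RingHom.mem_ker, map_sub, Function.surjInv_eq T.comp_surjective, sub_self]

/-- The `S`-module structure on `J`, which exists since `I J = 0`. -/
noncomputable instance : Module S T.J :=
  Function.Surjective.moduleLeft (T.ψ.comp T.φ) T.comp_surjective T.smul_def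

instance [IsCoherentRing Rbar] : Module.FinitePresentation S T.J := by
  have h : Module.FinitePresentation Rbar T.J :=
    IsCoherentRing.finitePresentation_of_fg _ T.φ_fg
  let _ : Algebra Rbar S := (T.ψ.comp T.φ).toAlgebra
  have : IsScalarTower Rbar S T.J := ⟨fun r s a => by
    rw [Algebra.smul_def, mul_smul]
    exact T.smul_def r _⟩
  have hs : Function.Surjective (algebraMap Rbar S) := T.comp_surjective
  refine FinitePresentation.of_isBaseChange (R := Rbar) (A := S) (LinearMap.id (M := T.J)) ?_
  refine IsBaseChange.of_lift_unique _ fun Q _ _ _ _ g => ?_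
  exact ⟨g.extendScalarsOfSurjective hs, rfl, fun g' hg' => LinearMap.ext fun a =>
    LinearMap.congr_fun hg' a⟩

end RingTower

section RHom

variable {S : Type u} [CommRing S] {C : Type u₁} [Category.{v₁} C] [Abelian C] [Linear S C]

/-- The cochain complex `Hom_S(P_•, X)`. -/
noncomputable def homComplex (P : ChainComplex (ModuleCat.{u} S) ℕ)
    [∀ n, Module.FinitePresentation S (P.X n)] (X : C) : CochainComplex C ℕ :=
  CochainComplex.of (fun n => homObj S (P.X n) X) (fun n => homMap S X (P.d (n + 1) n).hom)
    fun n => by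
      rw [homMap_comp, ← ModuleCat.hom_comp, P.d_comp_d, ModuleCat.hom_zero, homMap_zero]

variable {M : Type u} [AddCommGroup M] [Module S M] [Module.FinitePresentation S M]
  (P : ProjectiveResolution (ModuleCat.of S M)) [∀ n, Module.FinitePresentation S (P.complex.X n)]
  (X : C) [HasDerivedCategory.{w} C]

/-- `RHom_S(M, X)`, computed by a resolution of `M` by finitely presented projective modules. -/
noncomputable def RHom : DerivedCategory C :=
  DerivedCategory.Q.obj ((homComplex P.complex X).extend ComplexShape.embeddingUpNat)

/-- The cohomology group `Hⁿ RHom_C(RHom_S(M, X), X)`. -/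
abbrev HRHom (n : ℕ) : Type w :=
  RHom P X ⟶ ((DerivedCategory.singleFunctor C 0).obj X)⟦(n : ℤ)⟧

/-- The augmentation `P₀ → M` of the resolution. -/
noncomputable def augmentation : P.complex.X 0 →ₗ[S] M := (P.π.f 0).hom

theorem augmentation_comp_d : augmentation P ∘ₗ (P.complex.d 1 0).hom = 0 := by
  have h : P.complex.d 1 0 ≫ P.π.f 0 = 0 := by
    rw [← P.π.comm 1 0]
    exact (congrArg _ (HomologicalComplex.single_obj_d _ _ _ _ _)).trans comp_zero
  exact congrArg ModuleCat.Hom.hom h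

/-- The map `Hom_S(M, X) ⟶ Hom_S(P₀, X)` induced by the augmentation. -/
noncomputable def coaugmentation : homObj S M X ⟶ (homComplex P.complex X).X 0 :=
  homMap S X (augmentation P)

theorem coaugmentation_comp_d : coaugmentation P X ≫ (homComplex P.complex X).d 0 1 = 0 := by
  have h : (homComplex P.complex X).d 0 1 = homMap S X (P.complex.d 1 0).hom :=
    CochainComplex.of_d (fun n => homObj S (P.complex.X n) X)
      (fun n => homMap S X (P.complex.d (n + 1) n).hom) 0
  rw [h]
  exact (homMap_comp S (X := X) (P.complex.d 1 0).hom (augmentation P)).trans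
    (by rw [augmentation_comp_d]; exact homMap_zero S)

/-- The canonical morphism `Hom_S(M, X) ⟶ RHom_S(M, X)`. -/
noncomputable def toRHom :
    (DerivedCategory.singleFunctor C 0).obj (homObj S M X) ⟶ RHom P X :=
  (DerivedCategory.singleFunctorIsoCompQ C 0).hom.app _ ≫ DerivedCategory.Q.map
    (HomologicalComplex.mkHomFromSingle
      (coaugmentation P X ≫ ((homComplex P.complex X).extendXIso ComplexShape.embeddingUpNat
        (i := 0) (i' := 0) rfl).inv)
      (by
        rintro k rfl
        rw [(homComplex P.complex X).extend_d_eq ComplexShape.embeddingUpNat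
          (i := 0) (j := 1) (i' := 0) (j' := 0 + 1) rfl rfl, Category.assoc,
          Iso.inv_hom_id_assoc, ← Category.assoc, coaugmentation_comp_d, zero_comp]))

/-- The comparison map `Hⁿ RHom_C(RHom_S(M, X), X) → Extⁿ_C(Hom_S(M, X), X)`. -/
noncomputable def HRHom.toExt [HasExt.{w₁} C] {n : ℕ} (ξ : HRHom P X n) :
    Abelian.Ext.{w₁} (homObj S M X) X n :=
  Abelian.Ext.homEquiv.symm (toRHom P X ≫ ξ)

end RHom

/-- Flat deformations `C₀ ⥤ C ⥤ Cbar` of abelian categories along `Rbar → R → S`. -/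
structure DeformationTower {Rbar R S : Type u} [CommRing Rbar] [CommRing R] [CommRing S]
    (T : RingTower Rbar R S)
    (C₀ : Type u₁) [Category.{v₁} C₀] [Abelian C₀] [Linear S C₀]
    (C : Type u₂) [Category.{v₂} C] [Abelian C] [Linear R C]
    (Cbar : Type u₃) [Category.{v₃} Cbar] [Abelian Cbar] [Linear Rbar Cbar] where
  /-- the functor `C₀ ⥤ C` -/
  G₀ : C₀ ⥤ C
  /-- the functor `C ⥤ Cbar` -/
  G : C ⥤ Cbar
  flat₀ : IsFlat S C₀
  isFlatDeformation₀ : IsFlatDeformation T.ψ G₀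
  isFlatDeformation : IsFlatDeformation T.φ G

namespace DeformationTower

variable {Rbar R S : Type u} [CommRing Rbar] [CommRing R] [CommRing S] {T : RingTower Rbar R S}
  {C₀ : Type u₁} [Category.{v₁} C₀] [Abelian C₀] [Linear S C₀]
  {C : Type u₂} [Category.{v₂} C] [Abelian C] [Linear R C]
  {Cbar : Type u₃} [Category.{v₃} Cbar] [Abelian Cbar] [Linear Rbar Cbar]
  (𝒟 : DeformationTower T C₀ C Cbar)

instance : 𝒟.G₀.IsLeftAdjoint :=
  𝒟.isFlatDeformation₀.isLeftAdjoint T.ψ_surjective T.ψ_fg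

instance : 𝒟.G.IsLeftAdjoint :=
  𝒟.isFlatDeformation.isLeftAdjoint T.φ_surjective T.φ_fg

instance : 𝒟.G₀.Additive := 𝒟.isFlatDeformation₀.linear.additive

instance : 𝒟.G.Additive := 𝒟.isFlatDeformation.linear.additive

instance : PreservesFiniteLimits 𝒟.G₀ :=
  𝒟.isFlatDeformation₀.preservesFiniteLimits T.ψ_surjective T.ψ_fg

instance : PreservesFiniteColimits 𝒟.G₀ :=
  𝒟.isFlatDeformation₀.preservesFiniteColimits T.ψ_surjective T.ψ_fg

instance : PreservesFiniteLimits 𝒟.G :=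
  𝒟.isFlatDeformation.preservesFiniteLimits T.φ_surjective T.φ_fg

instance : PreservesFiniteColimits 𝒟.G :=
  𝒟.isFlatDeformation.preservesFiniteColimits T.φ_surjective T.φ_fg

/-- The functor `Hom_R(S, -)`, right adjoint to `C₀ ⥤ C`. -/
noncomputable def F₀ : C ⥤ C₀ := 𝒟.G₀.rightAdjoint

/-- The functor `Hom_Rbar(R, -)`, right adjoint to `C ⥤ Cbar`. -/
noncomputable def F : Cbar ⥤ C := 𝒟.G.rightAdjoint

/-- The adjunction between `C₀ ⥤ C` and `Hom_R(S, -)`. -/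
noncomputable def adj₀ : 𝒟.G₀ ⊣ 𝒟.F₀ := Adjunction.ofIsLeftAdjoint _

/-- The adjunction between `C ⥤ Cbar` and `Hom_Rbar(R, -)`. -/
noncomputable def adj : 𝒟.G ⊣ 𝒟.F := Adjunction.ofIsLeftAdjoint _

variable (X : C)

/-- The groupoid of coflat lifts of `X` along `Hom_Rbar(R, -)`. Coflat objects form full
subcategories, so for a coflat object `X` it does not matter whether the codomain of the functor
is restricted to the coflat objects of `C`. -/
abbrev CoflatLifts : Type (max u₃ v₂) :=
  Lift ((coflat Rbar : ObjectProperty Cbar).ι ⋙ 𝒟.F) X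

variable [IsCoherentRing Rbar]

/-- The object `Hom_S(J, Hom_R(S, X)) = Hom_R(J, X)` of `C₀`. -/
noncomputable def homJ : C₀ := homObj S T.J (𝒟.F₀.obj X)

/-- The evaluation `Hom_R(J, X) ⟶ X` at an element of `J`. -/
noncomputable def evJ (a : T.J) : 𝒟.G₀.obj (𝒟.homJ X) ⟶ X :=
  𝒟.G₀.map (homEv S T.J (𝒟.F₀.obj X) a) ≫ 𝒟.adj₀.counit.app X

section Classes

variable [HasExt.{w} C] [HasExt.{w₁} Cbar]

variable {X} in
/-- `e` is the extension class of the lift `L`, i.e. of the exact sequence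
`0 ⟶ X ⟶ L ⟶ Hom_R(J, X) ⟶ 0` in `Cbar`. The first map is adjoint to the identification of `X`
with `Hom_Rbar(R, L)`, and the second one describes the action of `J` on `L`. -/
def IsLiftClass (L : 𝒟.CoflatLifts X)
    (e : Abelian.Ext.{w₁} (𝒟.G.obj (𝒟.G₀.obj (𝒟.homJ X))) (𝒟.G.obj X) 1) : Prop :=
  ∃ (i : 𝒟.G.obj X ⟶ L.obj.obj) (p : L.obj.obj ⟶ 𝒟.G.obj (𝒟.G₀.obj (𝒟.homJ X)))
    (w : i ≫ p = 0) (h : (ShortComplex.mk i p w).ShortExact),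
    𝒟.adj.homEquiv _ _ i = L.iso.hom ∧
    (∀ a : T.J, p ≫ 𝒟.G.map (𝒟.evJ X a) ≫ i = a.val • 𝟙 L.obj.obj) ∧
    h.extClass = e

/-- An exact sequence `0 ⟶ X ⟶ E ⟶ Q ⟶ 0` in `Cbar` for which the induced sequence
`0 ⟶ X ⟶ Hom_Rbar(R, E) ⟶ Hom_Rbar(R, Q) ⟶ Hom_R(J, X) ⟶ 0` in `C` is exact, together with
a factorization of the latter into two short exact sequences. The connecting map `δ` describes the
multiplication by `J` on the part of `E` that lies over `Hom_Rbar(R, Q)`. -/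
structure Resolving where
  /-- the middle term -/
  E : Cbar
  /-- the quotient -/
  Q : Cbar
  /-- the inclusion of `X` -/
  k : 𝒟.G.obj X ⟶ E
  /-- the projection -/
  π : E ⟶ Q
  zero : k ≫ π = 0
  shortExact : (ShortComplex.mk k π zero).ShortExact
  /-- the connecting map -/
  δ : 𝒟.F.obj Q ⟶ 𝒟.G₀.obj (𝒟.homJ X)
  δ_spec {Z : Cbar} (t : Z ⟶ E) (y : Z ⟶ 𝒟.G.obj (𝒟.F.obj Q))
    (hty : t ≫ π = y ≫ 𝒟.adj.counit.app Q) (a : T.J) :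
    y ≫ 𝒟.G.map (δ ≫ 𝒟.evJ X a) ≫ k = a.val • t
  /-- the image of `Hom_Rbar(R, E) ⟶ Hom_Rbar(R, Q)` -/
  I : C
  /-- the projection to the image -/
  q : 𝒟.F.obj E ⟶ I
  /-- the inclusion of the image -/
  m : I ⟶ 𝒟.F.obj Q
  fac : q ≫ m = 𝒟.F.map π
  zero₁ : 𝒟.adj.homEquiv _ _ k ≫ q = 0
  shortExact₁ : (ShortComplex.mk (𝒟.adj.homEquiv _ _ k) q zero₁).ShortExact
  zero₂ : m ≫ δ = 0
  shortExact₂ : (ShortComplex.mk m δ zero₂).ShortExact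

/-- `e` is the Yoneda class in `Ext²_C(Hom_R(J, X), X)` of an exact sequence
`0 ⟶ X ⟶ Hom_Rbar(R, E) ⟶ Hom_Rbar(R, Q) ⟶ Hom_R(J, X) ⟶ 0`. -/
def IsObstructionClass (e : Abelian.Ext.{w} (𝒟.G₀.obj (𝒟.homJ X)) X 2) : Prop :=
  ∃ D : 𝒟.Resolving X, D.shortExact₂.extClass.comp D.shortExact₁.extClass rfl = e

variable [HasDerivedCategory.{w₂} C₀] [HasExt.{w₃} C₀]
  (P : ProjectiveResolution (ModuleCat.of S T.J)) [∀ n, Module.FinitePresentation S (P.complex.X n)]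

/-- The cohomology group `Hⁿ RHom_{C₀}(RHom_S(J, Y), Y)` for `Y = Hom_R(S, X)`. -/
abbrev H (n : ℕ) : Type w₂ := HRHom P (𝒟.F₀.obj X) n

variable {X P} in
/-- The map `Hⁿ RHom_{C₀}(RHom_S(J, Y), Y) → Extⁿ_C(Hom_R(J, X), X)`, for `Y = Hom_R(S, X)`. -/
noncomputable def toExt {n : ℕ} (ξ : 𝒟.H X P n) :
    Abelian.Ext.{w} (𝒟.G₀.obj (𝒟.homJ X)) X n :=
  ((HRHom.toExt P (𝒟.F₀.obj X) ξ : Abelian.Ext.{w₃} (𝒟.homJ X) (𝒟.F₀.obj X) n).mapExactFunctor 𝒟.G₀).comp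
    (Abelian.Ext.mk₀ (𝒟.adj₀.counit.app X)) (add_zero n)

end Classes

end DeformationTower

end CoflatLift

open CoflatLift

/-! Lifts are extensions with a prescribed action of `J`. Applying `Hom(-, L)` to `0 → J → Rbar → R
→ 0` for a coflat lift `L` gives an exact sequence `0 → X → L → Hom(J, L) → 0`. Since `J ⊆ I`, `J² =
0`, so `Hom(J, L)` is `Hom_R(J, X)`, and each `a` in `J` acts on `L` through evaluation at `a`
(`exists_shortExact`). Conversely, every extension of `Hom_R(J, X)` by `X` with this action is a
lift: `isIso_homEquiv` recovers `X`, and `isCoflat_of_shortExact` applies a local criterion for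
coflatness over a square-zero extension. Hence isomorphism classes of lifts are the classes in
`Ext¹` of `Cbar` satisfying `IsEvClass`.

The action attached to an extension class is natural and additive (`IsAction`). An extension of
objects of `C` with zero action lies in `C`, so the classes with zero action form the image of the
injection from `Ext¹` of `C`. The lifts, if there are any, therefore form a coset of this image.

For the obstruction, flatness of `Cbar` embeds `X` into some `E`, with quotient `Q`, such that
evaluation at elements of `J` is locally multiplication on `E`; this makes the connecting map `δ`
epi. Pulling `E` back to `F Q` gives a class `ε` with action `δ ≫ ev`. It descends along `δ` after
subtraction of a class from `C` as soon as its restriction to the kernel of `δ`, which is the class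
of `0 → X → F E → I → 0`, extends to `F Q` in `C`. The Yoneda product is what stands in the way of
this extension. The descended class defines a lift (`Resolving.exists_isEvClass`). Conversely, a
lift is itself the middle term of a resolving sequence whose first half splits, and any two
resolving sequences map to a third, so the product does not depend on the choice.

It remains to see that `Ψ¹` and `Ψ²` are bijective. Coflatness of `Y` reduces `RHom_S(J, Y)` to
`Hom_S(J, Y)`. The passage from `C₀` to `C` is dimension shifting along the adjunction, once classes
over `G₀ Z` are killed by epimorphisms coming from `C₀`: in degree 1 by coflatness of `X`, in degree
2 with flatness of `C` as well.

Flatness is used throughout in the form `HasExtensions`, which speaks of objects of the category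
itself even if injectives exist only among ind-objects. -/

namespace CoflatLift

open Abelian

set_option linter.unusedSectionVars false

/-! ### Finitely generated submodules over coherent rings -/

section Coherent

variable {R : Type u} [CommRing R] [IsCoherentRing R]

/-- Project to the first coordinate. The image is a finitely generated ideal, hence finitely
presented by coherence; so the kernel is finitely generated, and it embeds into a free module of
smaller rank. An extension of finitely presented modules is finitely presented. -/
theorem finitePresentation_of_fg_fin : ∀ (n : ℕ) (N : Submodule R (Fin n → R)), N.FG →
    Module.FinitePresentation R N := by
  intro n
  induction n with
  | zero =>
    intro N hN
    have : Subsingleton N := inferInstance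
    exact Module.finitePresentation_of_projective R N
  | succ n ih =>
    intro N hN
    have : Module.Finite R N := Module.Finite.iff_fg.2 hN
    let p : N →ₗ[R] R := (LinearMap.proj 0).comp N.subtype
    have hI : Module.FinitePresentation R (LinearMap.range p) :=
      IsCoherentRing.finitePresentation_of_fg _
        ((Submodule.fg_top _).1 ((Module.Finite.fg_top (R := R) (M := LinearMap.range p))))
    have hk : (LinearMap.ker p.rangeRestrict).FG :=
      Module.FinitePresentation.fg_ker p.rangeRestrict p.surjective_rangeRestrict
    rw [LinearMap.ker_rangeRestrict] at hk
    let tail : (Fin (n + 1) → R) →ₗ[R] (Fin n → R) := LinearMap.funLeft R R Fin.succ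
    let j : LinearMap.ker p →ₗ[R] (Fin n → R) :=
      tail.comp (N.subtype.comp (LinearMap.ker p).subtype)
    have hj : Function.Injective j := by
      intro a b hab
      apply Subtype.ext
      apply Subtype.ext
      funext k
      refine Fin.cases ?_ (fun k => congrFun hab k) k
      exact (LinearMap.mem_ker.1 a.2).trans (LinearMap.mem_ker.1 b.2).symm
    have : Module.Finite R (LinearMap.ker p) := Module.Finite.iff_fg.2 hk
    have h1 : Module.FinitePresentation R (LinearMap.range j) :=
      ih _ ((Submodule.fg_top _).1 (Module.Finite.fg_top (R := R) (M := LinearMap.range j)))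
    have h2 : Module.FinitePresentation R (LinearMap.ker p) :=
      (LinearEquiv.finitePresentation_iff (M := LinearMap.ker p) (N := LinearMap.range j)
        (LinearEquiv.ofInjective j hj)).2 h1
    have h3 : Module.FinitePresentation R (LinearMap.ker p.rangeRestrict) := by
      rwa [LinearMap.ker_rangeRestrict]
    exact Module.finitePresentation_of_ker p.rangeRestrict p.surjective_rangeRestrict

theorem finitePresentation_of_fg {M : Type w} [AddCommGroup M] [Module R M]
    [Module.FinitePresentation R M] (N : Submodule R M) (hN : N.FG) :
    Module.FinitePresentation R N := by
  obtain ⟨n, K, e, hK⟩ := Module.FinitePresentation.exists_fin R M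
  obtain ⟨f, hf⟩ : ∃ f : (Fin n → R) →ₗ[R] M, Function.Surjective f :=
    ⟨e.symm.toLinearMap ∘ₗ K.mkQ, e.symm.surjective.comp K.mkQ_surjective⟩
  have hker : (LinearMap.ker f).FG := Module.FinitePresentation.fg_ker f hf
  have hN' : (N.comap f).FG := by
    refine Submodule.fg_of_fg_map_of_fg_inf_ker f ?_ ?_
    · rwa [Submodule.map_comap_eq_of_surjective hf]
    · rwa [inf_eq_right.2 (LinearMap.ker_le_comap f)]
  have h1 := finitePresentation_of_fg_fin n _ hN'
  let g : N.comap f →ₗ[R] N := f.restrict fun x hx => hx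
  have hg : Function.Surjective g := fun ⟨y, hy⟩ => by
    obtain ⟨x, rfl⟩ := hf y
    exact ⟨⟨x, hy⟩, rfl⟩
  refine Module.finitePresentation_of_surjective g hg ?_
  have hle : LinearMap.ker f ≤ N.comap f := LinearMap.ker_le_comap f
  have h2 : LinearMap.ker g = (LinearMap.ker f).submoduleOf (N.comap f) := by
    ext x
    exact Subtype.ext_iff
  rw [h2]
  have : Module.Finite R (LinearMap.ker f) := Module.Finite.iff_fg.2 hker
  exact Module.Finite.iff_fg.1 (Module.Finite.equiv (Submodule.submoduleOfEquivOfLe hle).symm)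

instance finitePresentation_range {M : Type w} [AddCommGroup M] [Module R M] [Module.Finite R M]
    {N : Type w₁} [AddCommGroup N] [Module R N] [Module.FinitePresentation R N]
    (f : M →ₗ[R] N) : Module.FinitePresentation R (LinearMap.range f) :=
  finitePresentation_of_fg _ (by
    rw [LinearMap.range_eq_map]
    exact Submodule.FG.map f Module.Finite.fg_top)

end Coherent

/-! ### Coflatness as local extension of linear families -/

section Coflat

variable {R : Type u} [CommRing R] {C : Type u₁} [Category.{v₁} C] [Abelian C] [Linear R C]

/-- Coflatness allows one to extend linear families of morphisms locally. -/
theorem IsCoflat.exists_extension {X : C} (h : IsCoflat R X) {M N : Type u}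
    [AddCommGroup M] [AddCommGroup N] [Module R M] [Module R N]
    [Module.FinitePresentation R M] [Module.FinitePresentation R N]
    (i : M →ₗ[R] N) (hi : Function.Injective i) {T : C} (f : M →ₗ[R] (T ⟶ X)) :
    ∃ (T' : C) (e : T' ⟶ T) (_ : Epi e) (g : N →ₗ[R] (T' ⟶ X)), ∀ m, g (i m) = e ≫ f m := by
  have : Module.FinitePresentation R (N ⧸ LinearMap.range i) :=
    Module.finitePresentation_of_surjective (LinearMap.range i).mkQ (Submodule.mkQ_surjective _)
      (by
        rw [Submodule.ker_mkQ, LinearMap.range_eq_map]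
        exact Submodule.FG.map i Module.Finite.fg_top)
  have he := h M N _ i (LinearMap.range i).mkQ
    (by rw [LinearMap.exact_iff, Submodule.ker_mkQ]) hi (Submodule.mkQ_surjective _)
  have := he.epi_g
  dsimp at this
  obtain ⟨T', e, he, x, hx⟩ :=
    surjective_up_to_refinements_of_epi (homMap R X i) (homLift R f)
  refine ⟨T', e, he, Linear.leftComp R X x ∘ₗ homEv R N X, fun m => ?_⟩
  have := congrArg (fun z => z ≫ homEv R M X m) hx
  simpa using this.symm

/-- Left exactness of `Hom_R(-, X)` is formal; only the epimorphism at the right end needs the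
hypothesis, applied to the universal family on a generalized element of `Hom_R(M, X)`. -/
theorem isCoflat_of_exists_extension {X : C}
    (H : ∀ (M N : Type u) [AddCommGroup M] [AddCommGroup N] [Module R M] [Module R N]
      [Module.FinitePresentation R M] [Module.FinitePresentation R N]
      (i : M →ₗ[R] N) (_ : Function.Injective i) (T : C) (f : M →ₗ[R] (T ⟶ X)),
      ∃ (T' : C) (e : T' ⟶ T) (_ : Epi e) (g : N →ₗ[R] (T' ⟶ X)), ∀ m, g (i m) = e ≫ f m) :
    IsCoflat R X := by
  intro M N L _ _ _ _ _ _ _ _ _ f g hfg hf hg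
  have hm : Mono (homMap R X g) := ⟨fun {T} a b hab => homObj_ext R fun l => by
    obtain ⟨n, rfl⟩ := hg l
    have := congrArg (fun z => z ≫ homEv R N X n) hab
    simpa using this⟩
  have he : Epi (homMap R X f) := by
    rw [epi_iff_surjective_up_to_refinements]
    intro T y
    obtain ⟨T', e, he, k, hk⟩ := H M N f hf T (Linear.leftComp R X y ∘ₗ homEv R M X)
    refine ⟨T', e, he, homLift R k, homObj_ext R fun m => ?_⟩
    simp [hk]
  refine ⟨?_⟩
  rw [ShortComplex.exact_iff_exact_up_to_refinements]
  intro T x hx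
  dsimp at x hx
  have h0 (m) : x ≫ homEv R N X (f m) = 0 := by
    have := congrArg (fun z => z ≫ homEv R M X m) hx
    simpa using this
  let k : L →ₗ[R] (T ⟶ X) :=
    (LinearMap.ker g).liftQ (Linear.leftComp R X x ∘ₗ homEv R N X) (fun n hn => by
      obtain ⟨m, rfl⟩ := (hfg n).1 hn
      exact h0 m) ∘ₗ (g.quotKerEquivOfSurjective hg).symm.toLinearMap
  have hk (n) : k (g n) = x ≫ homEv R N X n := by
    have : (g.quotKerEquivOfSurjective hg).symm (g n) = Submodule.Quotient.mk n := by
      rw [LinearEquiv.symm_apply_eq]; rfl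
    simp [k, this]
  refine ⟨T, 𝟙 T, inferInstance, homLift R k, homObj_ext R fun n => ?_⟩
  simp [hk]

theorem exists_iso_isCoflat {X X' : C} (e : X ≅ X') (h : IsCoflat R X) : IsCoflat R X' := by
  refine isCoflat_of_exists_extension fun M N _ _ _ _ _ _ i hi T f => ?_
  obtain ⟨T', p, hp, g, hg⟩ := h.exists_extension i hi (Linear.rightComp R T e.inv ∘ₗ f)
  exact ⟨T', p, hp, Linear.rightComp R T' e.hom ∘ₗ g, fun m => by simp [hg]⟩

/-- The functor `Hom_R(-, X)` is exact in the middle, for a coflat object `X`. -/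
theorem IsCoflat.exists_factor [IsCoherentRing R] {X : C} (h : IsCoflat R X) {M N L : Type u}
    [AddCommGroup M] [AddCommGroup N] [AddCommGroup L] [Module R M] [Module R N] [Module R L]
    [Module.FinitePresentation R M] [Module.FinitePresentation R N]
    [Module.FinitePresentation R L] (f : M →ₗ[R] N) (g : N →ₗ[R] L) (hfg : Function.Exact f g)
    {T : C} (x : N →ₗ[R] (T ⟶ X)) (hx : ∀ m, x (f m) = 0) :
    ∃ (T' : C) (e : T' ⟶ T) (_ : Epi e) (y : L →ₗ[R] (T' ⟶ X)), ∀ n, y (g n) = e ≫ x n := by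
  let x' : LinearMap.range g →ₗ[R] (T ⟶ X) :=
    (LinearMap.ker g).liftQ x (fun n hn => by
      obtain ⟨m, rfl⟩ := (hfg n).1 hn
      exact hx m) ∘ₗ g.quotKerEquivRange.symm.toLinearMap
  have hx' (n) : x' ⟨g n, n, rfl⟩ = x n := by
    have : g.quotKerEquivRange.symm ⟨g n, n, rfl⟩ = Submodule.Quotient.mk n := by
      rw [LinearEquiv.symm_apply_eq]; rfl
    simp [x', this]
  obtain ⟨T', e, he, y, hy⟩ :=
    h.exists_extension (LinearMap.range g).subtype (Submodule.subtype_injective _) x'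
  exact ⟨T', e, he, y, fun n => by rw [← hx' n, ← hy]; rfl⟩

end Coflat

/-! ### Objects annihilated by the kernel, and the right adjoint -/

namespace IsDeformation

variable {R S : Type u} [CommRing R] [CommRing S] {θ : R →+* S}
  {C₀ : Type u₁} [Category.{v₁} C₀] [Abelian C₀] [Linear S C₀]
  {C : Type u₂} [Category.{v₂} C] [Abelian C] [Linear R C] {G : C₀ ⥤ C}

/-- The largest quotient of `W` that is annihilated by the kernel of `θ`. -/
theorem exists_quotient (h : IsDeformation θ G) (hθ : Function.Surjective θ)
    (hfg : (RingHom.ker θ).FG) (W : C) :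
    ∃ (Z : C₀) (q : W ⟶ G.obj Z) (_ : Epi q), ∀ {X : C} (f : W ⟶ X),
      (∀ r, θ r = 0 → r • f = 0) → ∃ g : G.obj Z ⟶ X, q ≫ g = f := by
  obtain ⟨s, hs⟩ := hfg
  let d : (∐ fun _ : s => W) ⟶ W := Sigma.desc fun r => (r : R) • 𝟙 W
  have hd (r : R) (hr : r ∈ s) : r • cokernel.π d = 0 := by
    have := Sigma.ι (fun _ : s => W) ⟨r, hr⟩ ≫= cokernel.condition d
    rwa [Limits.Sigma.ι_desc_assoc, Linear.smul_comp, Category.id_comp, comp_zero] at this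
  have hker (r : R) (hr : r ∈ RingHom.ker θ) : r • cokernel.π d = 0 := by
    rw [← hs] at hr
    induction hr using Submodule.span_induction with
    | mem r hr => exact hd r hr
    | zero => simp
    | add a b _ _ ha hb => rw [add_smul, ha, hb, add_zero]
    | smul a b _ hb => rw [smul_eq_mul, mul_smul, hb, smul_zero]
  obtain ⟨Z, ⟨e⟩⟩ := h.exists_iso hθ (cokernel d) fun r hr => by
    rw [← cancel_epi (cokernel.π d), Linear.comp_smul, Category.comp_id, hker r hr, comp_zero]
  refine ⟨Z, cokernel.π d ≫ e.inv, inferInstance, fun f hf => ?_⟩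
  have h0 : d ≫ f = 0 := by
    apply Sigma.hom_ext
    intro r
    have : (r : R) ∈ RingHom.ker θ := by
      rw [← hs]
      exact Submodule.subset_span r.2
    simpa [d] using hf r this
  exact ⟨e.hom ≫ cokernel.desc d f h0, by simp⟩

variable {F : C ⥤ C₀}

/-- The kernel of the counit is a subobject of an object of `C₀`, hence annihilated by `ker θ` and
itself in the image of `G`. Its inclusion is then a morphism of `C₀` whose transpose vanishes. -/
theorem mono_counit (h : IsDeformation θ G) (hθ : Function.Surjective θ) (adj : G ⊣ F) (X : C) :
    Mono (adj.counit.app X) := by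
  have := h.linear.additive
  have := h.full hθ
  refine Preadditive.mono_of_kernel_zero ?_
  obtain ⟨K, ⟨e⟩⟩ := h.exists_iso hθ (kernel (adj.counit.app X)) fun r hr => by
    rw [← cancel_mono (kernel.ι _), Linear.smul_comp, Category.id_comp, zero_comp,
      ← Category.comp_id (kernel.ι _), ← Linear.comp_smul, h.smul_eq_zero hr, comp_zero]
  have h0 : G.preimage (e.hom ≫ kernel.ι (adj.counit.app X)) = 0 := by
    apply (adj.homEquiv _ _).symm.injective
    simp [Adjunction.homEquiv_counit]
  have h1 := congrArg (fun x => e.inv ≫ G.map x) h0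
  simpa using h1

theorem exists_factor_counit (h : IsDeformation θ G) (hθ : Function.Surjective θ)
    (hfg : (RingHom.ker θ).FG) (adj : G ⊣ F) {W X : C} (f : W ⟶ X)
    (hf : ∀ r, θ r = 0 → r • f = 0) :
    ∃ g : W ⟶ G.obj (F.obj X), g ≫ adj.counit.app X = f := by
  obtain ⟨Z, q, _, hq⟩ := h.exists_quotient hθ hfg W
  obtain ⟨g, rfl⟩ := hq f hf
  exact ⟨q ≫ G.map (adj.homEquiv _ _ g), by simp [Adjunction.homEquiv_unit]⟩

/-- A family of morphisms that factors through `q : W ⟶ G.obj Z` is the transpose of a linear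
family of morphisms in the original category. -/
theorem exists_linear_family (h : IsDeformation θ G) (hθ : Function.Surjective θ) (adj : G ⊣ F)
    {N : Type w} [AddCommGroup N] [Module S N] {W X : C} {Z : C₀} (q : W ⟶ G.obj Z) [Epi q]
    (x : N → (W ⟶ X)) (hadd : ∀ a b, x (a + b) = x a + x b)
    (hsmul : ∀ (r : R) a, x (θ r • a) = r • x a) (hq : ∀ n, ∃ g, q ≫ g = x n) :
    ∃ y : N →ₗ[S] (Z ⟶ F.obj X), ∀ n, q ≫ G.map (y n) ≫ adj.counit.app X = x n := by
  have := h.linear.additive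
  choose g hg using hq
  have hy (n) : q ≫ G.map (adj.homEquiv _ _ (g n)) ≫ adj.counit.app X = x n := by
    rw [← hg n]
    simp [Adjunction.homEquiv_unit]
  have key {a b : Z ⟶ F.obj X}
      (hab : q ≫ G.map a ≫ adj.counit.app X = q ≫ G.map b ≫ adj.counit.app X) : a = b := by
    rw [cancel_epi] at hab
    apply (adj.homEquiv _ _).symm.injective
    simpa [Adjunction.homEquiv_counit] using hab
  refine ⟨
    { toFun n := adj.homEquiv _ _ (g n)
      map_add' a b := key (by simp only [hy, hadd, G.map_add, Preadditive.add_comp,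
        Preadditive.comp_add])
      map_smul' s a := key (by
        obtain ⟨r, rfl⟩ := hθ s
        simp only [hy, hsmul, h.linear.map_smul, Linear.smul_comp, Linear.comp_smul,
          RingHom.id_apply]) }, hy⟩

/-- A family over `S` is a family over `R` after transposition, so it extends over some cover `W`.
Both the extended family and the cover are killed by `ker θ`, and hence descend to the largest
quotient of `W` lying in `C₀`. -/
theorem isCoflat_rightAdjoint (h : IsDeformation θ G) (hθ : Function.Surjective θ)
    (hfg : (RingHom.ker θ).FG) (adj : G ⊣ F) {X : C} (hX : IsCoflat R X) :
    IsCoflat S (F.obj X) := by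
  have := h.linear.additive
  have := h.full hθ
  have := h.faithful
  refine isCoflat_of_exists_extension fun M N _ _ _ _ _ _ i hi T f => ?_
  let _ : Algebra R S := θ.toAlgebra
  let _ : Module R M := Module.compHom M θ
  let _ : Module R N := Module.compHom N θ
  have : IsScalarTower R S M := ⟨fun r s m => mul_smul (θ r) s m⟩
  have : IsScalarTower R S N := ⟨fun r s m => mul_smul (θ r) s m⟩
  have : Module.FinitePresentation R S :=
    Module.finitePresentation_of_surjective (Algebra.linearMap R S) hθ hfg
  have : Module.FinitePresentation R M := .trans R M S
  have : Module.FinitePresentation R N := .trans R N S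
  obtain ⟨W, e, _, g, hg⟩ := hX.exists_extension (T := G.obj T) (i.restrictScalars R) hi
    { toFun m := G.map (f m) ≫ adj.counit.app X
      map_add' a b := by simp
      map_smul' r a := by
        change G.map (f (θ r • a)) ≫ _ = _
        simp [h.linear.map_smul] }
  obtain ⟨Z, q, _, hq⟩ := h.exists_quotient hθ hfg W
  obtain ⟨y, hy⟩ := h.exists_linear_family hθ adj q g (fun a b => map_add g a b)
    (fun r a => map_smul g r a) (fun n => hq _ fun r hr => by
      rw [← map_smul]
      change g (θ r • n) = 0
      rw [hr, zero_smul, map_zero])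
  obtain ⟨e', rfl⟩ := hq e fun r hr => by
    rw [← Category.comp_id e, ← Linear.comp_smul, h.smul_eq_zero hr, comp_zero]
  have : Epi e' := epi_of_epi q e'
  have : Epi (G.map (G.preimage e')) := by rwa [G.map_preimage]
  refine ⟨Z, G.preimage e', G.epi_of_epi_map this, y, fun m => ?_⟩
  apply (adj.homEquiv _ _).symm.injective
  rw [← cancel_epi q]
  have h1 := hg m
  have h2 := hy (i m)
  simp only [LinearMap.coe_restrictScalars, LinearMap.coe_mk, AddHom.coe_mk] at h1
  simp [Adjunction.homEquiv_counit, h2, h1]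

end IsDeformation

/-! ### The universal property of `Hom_R(J, X)` in `Cbar` -/

namespace DeformationTower

variable {Rbar R S : Type u} [CommRing Rbar] [CommRing R] [CommRing S] {T : RingTower Rbar R S}
  {C₀ : Type u₁} [Category.{v₁} C₀] [Abelian C₀] [Linear S C₀]
  {C : Type u₂} [Category.{v₂} C] [Abelian C] [Linear R C]
  {Cbar : Type u₃} [Category.{v₃} Cbar] [Abelian Cbar] [Linear Rbar Cbar]
  (𝒟 : DeformationTower T C₀ C Cbar)

instance : 𝒟.G.Full := 𝒟.isFlatDeformation.full T.φ_surjective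
instance : 𝒟.G.Faithful := 𝒟.isFlatDeformation.faithful
instance : 𝒟.G₀.Full := 𝒟.isFlatDeformation₀.full T.ψ_surjective
instance : 𝒟.G₀.Faithful := 𝒟.isFlatDeformation₀.faithful

instance (X : Cbar) : Mono (𝒟.adj.counit.app X) :=
  𝒟.isFlatDeformation.mono_counit T.φ_surjective _ X

instance (X : C) : Mono (𝒟.adj₀.counit.app X) :=
  𝒟.isFlatDeformation₀.mono_counit T.ψ_surjective _ X

theorem map_smul_eq {Z X : C} (r : Rbar) (f : Z ⟶ X) :
    𝒟.G.map (T.φ r • f) = r • 𝒟.G.map f :=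
  𝒟.isFlatDeformation.linear.map_smul r f

theorem map₀_smul_eq {Z X : C₀} (r : R) (f : Z ⟶ X) :
    𝒟.G₀.map (T.ψ r • f) = r • 𝒟.G₀.map f :=
  𝒟.isFlatDeformation₀.linear.map_smul r f

theorem J_smul (a : T.J) {Z : C} {X : Cbar} (f : 𝒟.G.obj Z ⟶ X) : a.val • f = 0 :=
  𝒟.isFlatDeformation.smul_eq_zero a.2 f

theorem J_smul' (a : T.J) {Z : C} {X : Cbar} (f : X ⟶ 𝒟.G.obj Z) : a.val • f = 0 := by
  rw [← Category.comp_id f, ← Linear.comp_smul, 𝒟.J_smul, comp_zero]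

theorem exists_factor_counit {W X : Cbar} (f : W ⟶ X) (hf : ∀ a : T.J, a.val • f = 0) :
    ∃ g : W ⟶ 𝒟.G.obj (𝒟.F.obj X), g ≫ 𝒟.adj.counit.app X = f :=
  𝒟.isFlatDeformation.exists_factor_counit T.φ_surjective T.φ_fg 𝒟.adj f fun r hr => hf ⟨r, hr⟩

/-- The largest quotient of `W` in the image of `C₀`. -/
theorem exists_quotient (W : Cbar) :
    ∃ (Z : C₀) (q : W ⟶ 𝒟.G.obj (𝒟.G₀.obj Z)) (_ : Epi q), ∀ {X : Cbar} (f : W ⟶ X),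
      (∀ r, T.ψ (T.φ r) = 0 → r • f = 0) → ∃ g : 𝒟.G.obj (𝒟.G₀.obj Z) ⟶ X, q ≫ g = f := by
  obtain ⟨Z₁, q₁, _, hq₁⟩ :=
    𝒟.isFlatDeformation.exists_quotient T.φ_surjective T.φ_fg W
  obtain ⟨Z₀, q₀, _, hq₀⟩ :=
    𝒟.isFlatDeformation₀.exists_quotient T.ψ_surjective T.ψ_fg Z₁
  refine ⟨Z₀, q₁ ≫ 𝒟.G.map q₀, inferInstance, fun {X} f hf => ?_⟩
  obtain ⟨f₁, rfl⟩ := hq₁ f fun r hr => hf r (by rw [hr, map_zero])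
  obtain ⟨f₀, hf₀⟩ := hq₀ (𝒟.adj.homEquiv _ _ f₁) fun r hr => by
    obtain ⟨r, rfl⟩ := T.φ_surjective r
    apply (𝒟.adj.homEquiv _ _).symm.injective
    rw [← cancel_epi q₁]
    have := hf r hr
    simpa [Adjunction.homEquiv_counit, map_smul_eq, Adjunction.homEquiv_unit] using this
  refine ⟨𝒟.G.map f₀ ≫ 𝒟.adj.counit.app X, ?_⟩
  rw [Category.assoc, ← 𝒟.G.map_comp_assoc, hf₀]
  simp [Adjunction.homEquiv_unit]

theorem I_smul {r : Rbar} (hr : T.ψ (T.φ r) = 0) {Z : C₀} {W : Cbar}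
    (f : W ⟶ 𝒟.G.obj (𝒟.G₀.obj Z)) : r • f = 0 := by
  have h1 : T.φ r • 𝟙 (𝒟.G₀.obj Z) = 0 := 𝒟.isFlatDeformation₀.smul_eq_zero hr _
  have h2 : r • 𝟙 (𝒟.G.obj (𝒟.G₀.obj Z)) = 0 := by
    rw [← 𝒟.G.map_id, ← 𝒟.map_smul_eq, h1, 𝒟.G.map_zero]
  rw [← Category.comp_id f, ← Linear.comp_smul, h2, comp_zero]

variable [IsCoherentRing Rbar] {X : C}

variable (X) in
/-- The evaluation `Hom_S(J, Hom_R(S, X)) ⟶ Hom_R(S, X)` at an element of `J`. -/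
noncomputable def evY : T.J →ₗ[S] (𝒟.homJ X ⟶ 𝒟.F₀.obj X) := homEv S T.J (𝒟.F₀.obj X)

theorem evJ_eq (a : T.J) :
    𝒟.evJ X a = 𝒟.G₀.map (𝒟.evY X a) ≫ 𝒟.adj₀.counit.app X := rfl

theorem evY_ext {Z : C₀} {f g : Z ⟶ 𝒟.homJ X} (h : ∀ a, f ≫ 𝒟.evY X a = g ≫ 𝒟.evY X a) :
    f = g :=
  homObj_ext S h

theorem exists_lift_evY {Z : C₀} (y : T.J →ₗ[S] (Z ⟶ 𝒟.F₀.obj X)) :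
    ∃ f : Z ⟶ 𝒟.homJ X, ∀ a, f ≫ 𝒟.evY X a = y a :=
  ⟨homLift S y, homLift_ev S y⟩

theorem evJ_add (a b : T.J) : 𝒟.evJ X (a + b) = 𝒟.evJ X a + 𝒟.evJ X b := by
  simp [evJ_eq]

theorem evJ_smul (r : Rbar) (a : T.J) : 𝒟.evJ X (r • a) = T.φ r • 𝒟.evJ X a := by
  rw [← T.smul_def]
  simp [evJ_eq, map₀_smul_eq]

/-- The evaluation maps are jointly monic. -/
theorem evJ_ext {W : Cbar} {p p' : W ⟶ 𝒟.G.obj (𝒟.G₀.obj (𝒟.homJ X))}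
    (h : ∀ a : T.J, p ≫ 𝒟.G.map (𝒟.evJ X a) = p' ≫ 𝒟.G.map (𝒟.evJ X a)) : p = p' := by
  rw [← sub_eq_zero]
  obtain ⟨Z, q, _, hq⟩ := 𝒟.exists_quotient W
  obtain ⟨d, hd⟩ := hq (p - p') fun r hr => 𝒟.I_smul hr _
  have h0 : 𝒟.G₀.preimage (𝒟.G.preimage d) = 0 := by
    refine 𝒟.evY_ext fun a => ?_
    rw [zero_comp]
    apply 𝒟.G₀.map_injective
    rw [← cancel_mono (𝒟.adj₀.counit.app X)]
    apply 𝒟.G.map_injective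
    rw [← cancel_epi q]
    have h1 : (p - p') ≫ 𝒟.G.map (𝒟.evJ X a) = 0 := by rw [Preadditive.sub_comp, h, sub_self]
    rw [← hd] at h1
    simpa [evJ_eq] using h1
  have h1 : d = 0 := by
    rw [← 𝒟.G.map_preimage d, ← 𝒟.G₀.map_preimage (𝒟.G.preimage d), h0]
    simp
  rw [← hd, h1, comp_zero]

/-- `Hom_R(J, X)` represents families of morphisms to `X` that are linear in `J`. -/
theorem exists_lift_evJ {W : Cbar} (x : T.J → (W ⟶ 𝒟.G.obj X))
    (hadd : ∀ a b, x (a + b) = x a + x b) (hsmul : ∀ (r : Rbar) a, x (r • a) = r • x a) :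
    ∃ p : W ⟶ 𝒟.G.obj (𝒟.G₀.obj (𝒟.homJ X)), ∀ a, p ≫ 𝒟.G.map (𝒟.evJ X a) = x a := by
  obtain ⟨Z, q, _, hq⟩ := 𝒟.exists_quotient W
  have h1 (a : T.J) : ∃ g : 𝒟.G₀.obj Z ⟶ X, q ≫ 𝒟.G.map g = x a := by
    -- Since `I J = 0`, each member of the family is killed by `I`. The family thus factors through
    -- the largest quotient of `W` in `C₀`, where the definition of `Hom_S(J, Y)` applies.
    obtain ⟨g, hg⟩ := hq (x a) fun r hr => by
      have h0 : r • a = 0 := by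
        rw [← T.smul_def]
        change T.ψ (T.φ r) • a = 0
        rw [hr, zero_smul]
      have hx0 : x 0 = 0 := by simpa using hadd 0 0
      rw [← hsmul, h0, hx0]
    exact ⟨𝒟.G.preimage g, by simpa using hg⟩
  choose g hg using h1
  obtain ⟨y, hy⟩ := 𝒟.isFlatDeformation₀.exists_linear_family T.ψ_surjective 𝒟.adj₀
    (𝟙 (𝒟.G₀.obj Z)) g
    (fun a b => 𝒟.G.map_injective (by rw [← cancel_epi q]; simp [hg, hadd]))
    (fun r a => 𝒟.G.map_injective (by
      obtain ⟨r, rfl⟩ := T.φ_surjective r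
      rw [← cancel_epi q, hg, 𝒟.map_smul_eq, Linear.comp_smul, hg, ← hsmul, ← T.smul_def]
      rfl)) fun a => ⟨g a, by simp⟩
  obtain ⟨f, hf⟩ := 𝒟.exists_lift_evY y
  refine ⟨q ≫ 𝒟.G.map (𝒟.G₀.map f), fun a => ?_⟩
  rw [← hg, ← hy, Category.assoc, ← 𝒟.G.map_comp, evJ_eq, ← 𝒟.G₀.map_comp_assoc, hf,
    Category.id_comp]

/-- In an extension of objects of `C`, the action of `J` is given by a morphism to
`Hom_R(J, X)`. -/
theorem exists_action {Z : C} {E : Cbar} {i : 𝒟.G.obj X ⟶ E} {p : E ⟶ 𝒟.G.obj Z} {z : i ≫ p = 0}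
    (h : (ShortComplex.mk i p z).ShortExact) :
    ∃ y : Z ⟶ 𝒟.G₀.obj (𝒟.homJ X), ∀ a : T.J,
      p ≫ 𝒟.G.map (y ≫ 𝒟.evJ X a) ≫ i = a.val • 𝟙 E := by
  have := h.mono_f
  have := h.epi_g
  dsimp at *
  have h1 (a : T.J) : ∃ g : 𝒟.G.obj Z ⟶ 𝒟.G.obj X, p ≫ g ≫ i = a.val • 𝟙 E := by
    obtain ⟨t, ht⟩ : ∃ t : 𝒟.G.obj Z ⟶ E, p ≫ t = a.val • 𝟙 E :=
      ⟨h.gIsCokernel.desc (CokernelCofork.ofπ (a.val • 𝟙 E)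
        (by dsimp; rw [Linear.comp_smul, 𝒟.J_smul])),
        h.gIsCokernel.fac _ WalkingParallelPair.one⟩
    obtain ⟨g, rfl⟩ : ∃ g : 𝒟.G.obj Z ⟶ 𝒟.G.obj X, g ≫ i = t := by
      have ht0 : t ≫ p = 0 := by
        rw [← cancel_epi p, ← Category.assoc, ht, Linear.smul_comp, 𝒟.J_smul', comp_zero]
      exact ⟨h.fIsKernel.lift (KernelFork.ofι t ht0), h.fIsKernel.fac _ WalkingParallelPair.zero⟩
    exact ⟨g, ht⟩
  choose g hg using h1
  have key {g g' : 𝒟.G.obj Z ⟶ 𝒟.G.obj X} (hgg : p ≫ g ≫ i = p ≫ g' ≫ i) : g = g' := by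
    rwa [cancel_epi, cancel_mono] at hgg
  obtain ⟨y, hy⟩ := 𝒟.exists_lift_evJ g
    (fun a b => key (by
      simp only [hg, Preadditive.add_comp, Preadditive.comp_add, ← add_smul]
      rfl))
    (fun r a => key (by
      simp only [hg, Linear.smul_comp, Linear.comp_smul, smul_smul]
      rfl))
  refine ⟨𝒟.G.preimage y, fun a => ?_⟩
  rw [𝒟.G.map_comp, 𝒟.G.map_preimage, hy, hg]

end DeformationTower

/-! ### Flatness as extension of families after enlarging the target -/

section Efface

variable {R : Type u} [CommRing R] {C : Type u₁} [Category.{v₁} C] [Abelian C] [Linear R C]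

/-- Families of morphisms to `X` that are linear in a submodule `M` of a finitely presented module
`N` extend to `N` locally on the source, after embedding `X` into a larger object. -/
def HasExtensions (R : Type u) [CommRing R] (C : Type u₁) [Category.{v₁} C] [Abelian C]
    [Linear R C] : Prop :=
  ∀ {M N : Type u} [AddCommGroup M] [AddCommGroup N] [Module R M] [Module R N]
    [Module.FinitePresentation R M] [Module.FinitePresentation R N]
    (i : M →ₗ[R] N) (_ : Function.Injective i) {Z X : C} (f : M →ₗ[R] (Z ⟶ X)),
    ∃ (E : C) (k : X ⟶ E) (_ : Mono k) (Z' : C) (e : Z' ⟶ Z) (_ : Epi e) (g : N →ₗ[R] (Z' ⟶ E)),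
      ∀ m, g (i m) = e ≫ f m ≫ k

theorem exists_finite_sum (Z : C) (J : Type w) [Fintype J] [DecidableEq J] :
    ∃ (B : C) (ι : J → (Z ⟶ B)) (π : J → (B ⟶ Z)),
      ∀ j j', ι j ≫ π j' = if j = j' then 𝟙 Z else 0 := by
  have := HasFiniteBiproducts.of_hasFiniteProducts (C := C)
  refine ⟨⨁ fun _ : J => Z, biproduct.ι _, biproduct.π _, fun j j' => ?_⟩
  rw [biproduct.ι_π]
  rfl

/-- The coflat object lives in `D`, so it cannot serve as the target in `C`. It is replaced by the
pushout of `X` and `N ⊗ Z'` along `M ⊗ Z'`, a cokernel between finite sums in `C`. The extension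
found in `D` is only used to show that `X` still embeds into this pushout. -/
theorem hasExtensions_of_embedding {D : Type u₂} [Category.{v₂} D] [Abelian D] [Linear R D]
    (Y : C ⥤ D) [Y.Faithful] [Y.Additive] [PreservesFiniteColimits Y]
    (hlin : ∀ (r : R) {A B : C} (f : A ⟶ B), Y.map (r • f) = r • Y.map f)
    (hcover : ∀ {Z : C} {W : D} (p : W ⟶ Y.obj Z) [Epi p],
      ∃ (Z' : C) (e : Z' ⟶ Z) (_ : Epi e) (t : Y.obj Z' ⟶ W), t ≫ p = Y.map e)
    (hY : ∀ X : C, ∃ (E : D) (u : Y.obj X ⟶ E), Mono u ∧ IsCoflat R E) :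
    HasExtensions R C := by
  intro M N _ _ _ _ _ _ i hi Z X f
  obtain ⟨E, u, hu, hE⟩ := hY X
  obtain ⟨W, p, hp, g₁, hg₁⟩ := hE.exists_extension i hi (T := Y.obj Z)
    { toFun m := Y.map (f m) ≫ u
      map_add' a b := by simp
      map_smul' r a := by simp [hlin] }
  obtain ⟨Z', e, he, t, ht⟩ := hcover p
  let g : N →ₗ[R] (Y.obj Z' ⟶ E) := Linear.leftComp R E t ∘ₗ g₁
  have hg (m) : g (i m) = Y.map (e ≫ f m) ≫ u := by
    simp [g, hg₁, reassoc_of% ht]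
  obtain ⟨n, l, π, -, hπ, -⟩ := Module.FinitePresentation.exists_fin' R N
  obtain ⟨B, ιB, πB, hB⟩ := exists_finite_sum Z' (Fin n)
  let lc : (Fin n → R) →ₗ[R] (Z' ⟶ X ⊞ B) :=
    Fintype.linearCombination R fun j => ιB j ≫ biprod.inr
  let A : ((Fin n → R) × M) →ₗ[R] (Z' ⟶ X ⊞ B) :=
    lc.coprod (-(Linear.leftComp R _ e ∘ₗ Linear.rightComp R _ biprod.inl ∘ₗ f))
  let x : Y.obj (X ⊞ B) ⟶ E := Y.map biprod.fst ≫ u +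
    ∑ j, Y.map (biprod.snd ≫ πB j) ≫ g (π (Pi.single j 1))
  have hlc (v) : Y.map (lc v) ≫ x = g (π v) := by
    have h1 (j j' : Fin n) : Y.map (ιB j) ≫ Y.map (πB j') = if j = j' then 𝟙 _ else 0 := by
      rw [← Y.map_comp, hB]
      split_ifs <;> simp
    have h2 : (⟨⟨fun v => Y.map (lc v) ≫ x, by simp⟩, by simp [hlin]⟩ :
        (Fin n → R) →ₗ[R] (Y.obj Z' ⟶ E)) = g ∘ₗ π := by
      apply (Pi.basisFun R (Fin n)).ext
      intro j
      simp only [Pi.basisFun_apply, LinearMap.coe_mk, AddHom.coe_mk, LinearMap.comp_apply, lc,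
        Fintype.linearCombination_apply_single, one_smul, x, Preadditive.comp_add,
        Preadditive.comp_sum, ← Y.map_comp_assoc, Category.assoc, biprod.inr_fst,
        biprod.inr_snd_assoc,
        comp_zero, Y.map_zero, zero_comp, zero_add]
      simp [Y.map_comp, Category.assoc, reassoc_of% h1, ite_comp]
    exact LinearMap.congr_fun h2 v
  have hinl : Y.map biprod.inl ≫ x = u := by
    simp only [x, Preadditive.comp_add, Preadditive.comp_sum, ← Y.map_comp_assoc, biprod.inl_fst,
      biprod.inl_snd_assoc, zero_comp, Y.map_zero, Finset.sum_const_zero, add_zero, Y.map_id,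
      Category.id_comp]
  -- The kernel consists of the pairs `(v, m)` with `π v = i m`: the relations among the generators
  -- of `N`, together with the gluing relations along `M`. It is finitely generated, so finitely
  -- many copies of `Z'` suffice to impose them.
  let D' : ((Fin n → R) × M) →ₗ[R] N := π.coprod (-i)
  have hD' : Function.Surjective D' := fun y => by
    obtain ⟨v, rfl⟩ := hπ y
    exact ⟨(v, 0), by simp [D']⟩
  obtain ⟨s, hs⟩ := Module.FinitePresentation.fg_ker D' hD'
  have hA (v) (hv : v ∈ LinearMap.ker D') : Y.map (A v) ≫ x = 0 := by
    have h1 : Y.map (A v) ≫ x = g (D' v) := by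
      simp only [A, D', LinearMap.coprod_apply, LinearMap.neg_apply, Y.map_add, Y.map_neg,
        Preadditive.add_comp, Preadditive.neg_comp, hlc, map_add, map_neg, hg, LinearMap.comp_apply,
        Linear.leftComp_apply, Linear.rightComp_apply, Y.map_comp, Category.assoc, hinl]
    rw [h1, LinearMap.mem_ker.1 hv, map_zero]
  classical
  obtain ⟨B', ιB', πB', hB'⟩ := exists_finite_sum Z' s
  let d : B' ⟶ X ⊞ B := ∑ r : s, πB' r ≫ A r
  have hd : Y.map d ≫ x = 0 := by
    simp only [d, Y.map_sum, Preadditive.sum_comp, Y.map_comp, Category.assoc]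
    refine Finset.sum_eq_zero fun r _ => ?_
    rw [hA _ (by rw [← hs]; exact Submodule.subset_span r.2), comp_zero]
  have hAd (v) (hv : v ∈ LinearMap.ker D') : A v ≫ cokernel.π d = 0 := by
    rw [← hs] at hv
    induction hv using Submodule.span_induction with
    | mem r hr =>
      have h1 : ιB' ⟨r, hr⟩ ≫ d = A r := by
        simp [d, Preadditive.comp_sum, reassoc_of% hB', ite_comp]
      rw [← h1, Category.assoc, cokernel.condition, comp_zero]
    | zero => simp
    | add a b _ _ ha hb => rw [map_add, Preadditive.add_comp, ha, hb, add_zero]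
    | smul a b _ hb => rw [map_smul, Linear.smul_comp, hb, smul_zero]
  obtain ⟨x', hx'⟩ : ∃ x' : Y.obj (cokernel d) ⟶ E, Y.map (cokernel.π d) ≫ x' = x :=
    ⟨(CokernelCofork.mapIsColimit _ (cokernelIsCokernel d) Y).desc (CokernelCofork.ofπ x hd),
      (CokernelCofork.mapIsColimit _ (cokernelIsCokernel d) Y).fac (CokernelCofork.ofπ x hd)
        WalkingParallelPair.one⟩
  -- The map `x` respects all relations and restricts to the monomorphism `u` on `X`, so nothing of
  -- `X` dies in the cokernel.
  have hk : Mono (Y.map (biprod.inl ≫ cokernel.π d : X ⟶ cokernel d)) := by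
    have : Mono (Y.map (biprod.inl ≫ cokernel.π d : X ⟶ cokernel d) ≫ x') := by
      rwa [Y.map_comp, Category.assoc, hx', hinl]
    exact mono_of_mono _ x'
  have hker : LinearMap.ker π ≤ LinearMap.ker (Linear.rightComp R Z' (cokernel.π d) ∘ₗ lc) :=
    fun v hv => by
      have := hAd (v, 0) (by simpa [D'] using hv)
      simpa [A] using this
  let G : N →ₗ[R] (Z' ⟶ cokernel d) :=
    (LinearMap.ker π).liftQ _ hker ∘ₗ (π.quotKerEquivOfSurjective hπ).symm.toLinearMap
  have hG (v) : G (π v) = lc v ≫ cokernel.π d := by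
    have : (π.quotKerEquivOfSurjective hπ).symm (π v) = Submodule.Quotient.mk v := by
      rw [LinearEquiv.symm_apply_eq]; rfl
    simp [G, this]
  refine ⟨cokernel d, biprod.inl ≫ cokernel.π d, Y.mono_of_mono_map hk, Z', e, he, G, fun m => ?_⟩
  obtain ⟨v, hv⟩ := hπ (i m)
  have h1 := hAd (v, m) (by simp [D', hv])
  simp only [A, LinearMap.coprod_apply, LinearMap.neg_apply, LinearMap.comp_apply,
    Linear.leftComp_apply, Linear.rightComp_apply, Preadditive.add_comp, Preadditive.neg_comp,
    Category.assoc, add_neg_eq_zero] at h1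
  rw [← hv, hG, h1]

end Efface

/-! ### Epimorphisms of ind-objects onto objects of the category -/

section IndCover

variable {D : Type w} [SmallCategory D] [Abelian D]

/-- An epimorphism of ind-objects with target in `D` is covered by an epimorphism of `D`. -/
theorem ind_exists_cover {Z : D} {W : Ind D} (p : W ⟶ Ind.yoneda.obj Z) [Epi p] :
    ∃ (Z' : D) (e : Z' ⟶ Z) (_ : Epi e) (t : Ind.yoneda.obj Z' ⟶ W), t ≫ p = Ind.yoneda.map e := by
  let I := W.presentation.I
  let F : I ⥤ D := W.presentation.F
  let c (i : I) : Ind.yoneda.obj (F.obj i) ⟶ W :=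
    colimit.ι (F ⋙ Ind.yoneda) i ≫ W.colimitPresentationCompYoneda.hom
  have hc {i j : I} (f : i ⟶ j) : Ind.yoneda.map (F.map f) ≫ c j = c i :=
    colimit.w_assoc (F ⋙ Ind.yoneda) f _
  have c_ext {V : Ind D} {a b : W ⟶ V} (h : ∀ i, c i ≫ a = c i ≫ b) : a = b := by
    rw [← cancel_epi W.colimitPresentationCompYoneda.hom]
    apply colimit.hom_ext
    intro i
    simpa [c] using h i
  let γ : F ⟶ (Functor.const I).obj Z :=
    { app i := Ind.yoneda.preimage (c i ≫ p)
      naturality i j f := Ind.yoneda.map_injective (by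
        simp [reassoc_of% (hc f)]) }
  have hγ (i) : Ind.yoneda.map (γ.app i) = c i ≫ p := Ind.yoneda.map_preimage _
  -- The levelwise cokernels measure how far each `F i ⟶ Z` is from being epi. As `p` is epi, the
  -- map from `Z` to their filtered colimit vanishes; compactness of `Z` makes it vanish at some
  -- stage `j`, and there `γ` is epi.
  let Q := cokernel γ
  let q : (Functor.const I).obj Z ⟶ Q := cokernel.π γ
  have hq {i j : I} (f : i ⟶ j) : q.app i ≫ Q.map f = q.app j := by
    simpa using (q.naturality f).symm
  have hγq (i) : γ.app i ≫ q.app i = 0 := by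
    rw [← NatTrans.comp_app, cokernel.condition]
    rfl
  have hepi (j : I) (hj : q.app j = 0) : Epi (γ.app j) :=
    ((ShortComplex.exact_cokernel γ).map ((evaluation I D).obj j)).epi_f hj
  let i₀ : I := IsFiltered.nonempty.some
  have hzero : Ind.yoneda.map (q.app i₀) ≫ colimit.ι (Q ⋙ Ind.yoneda) i₀ = 0 := by
    rw [← cancel_epi p, comp_zero]
    refine c_ext fun j => ?_
    have h1 : q.app i₀ ≫ Q.map (IsFiltered.leftToMax i₀ j) =
        q.app j ≫ Q.map (IsFiltered.rightToMax i₀ j) := by rw [hq, hq]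
    rw [← colimit.w (Q ⋙ Ind.yoneda) (IsFiltered.leftToMax i₀ j), comp_zero,
      reassoc_of% (hγ j).symm, Functor.comp_map, ← Ind.yoneda.map_comp_assoc (q.app i₀), h1,
      ← Ind.yoneda.map_comp_assoc, ← Category.assoc, hγq, zero_comp, Ind.yoneda.map_zero, zero_comp]
  let H : Ind D ⥤ Type w := Ind.inclusion D ⋙ (evaluation _ _).obj (Opposite.op Z)
  have hcol := isColimitOfPreserves H (colimit.isColimit (Q ⋙ Ind.yoneda))
  -- The element is the identity of `Z` under the Yoneda embedding. It turns an equality in a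
  -- filtered colimit of sets into an equality of morphisms at a finite stage.
  have hx : ∃ x : H.obj (Ind.yoneda.obj Z), ∀ {V : D} (a b : Z ⟶ V),
      H.map (Ind.yoneda.map a) x = H.map (Ind.yoneda.map b) x → a = b := by
    refine ⟨(Ind.yonedaCompInclusion.inv.app Z).app (Opposite.op Z) (𝟙 Z), fun {V} a b hab => ?_⟩
    have h1 (a : Z ⟶ V) : (Ind.yonedaCompInclusion.hom.app V).app (Opposite.op Z)
        (H.map (Ind.yoneda.map a)
          ((Ind.yonedaCompInclusion.inv.app Z).app (Opposite.op Z) (𝟙 Z))) = a := by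
      have h2 : Ind.yonedaCompInclusion.inv.app Z ≫ (Ind.inclusion D).map (Ind.yoneda.map a) ≫
          Ind.yonedaCompInclusion.hom.app V = yoneda.map a := by
        rw [← Functor.comp_map, Ind.yonedaCompInclusion.hom.naturality, Iso.inv_hom_id_app_assoc]
      have h3 := ConcreteCategory.congr_hom (NatTrans.congr_app h2 (Opposite.op Z)) (𝟙 Z)
      exact h3.trans (Category.id_comp a)
    rw [← h1 a, ← h1 b, hab]
  obtain ⟨x, hx⟩ := hx
  have h1 := (Types.FilteredColimit.isColimit_eq_iff' hcol
    (H.map (Ind.yoneda.map (q.app i₀)) x) (H.map (Ind.yoneda.map 0) x)).1 (by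
      have h2 : H.map (Ind.yoneda.map (q.app i₀)) ≫ H.map (colimit.ι (Q ⋙ Ind.yoneda) i₀) =
          H.map (Ind.yoneda.map 0) ≫ H.map (colimit.ι (Q ⋙ Ind.yoneda) i₀) := by
        rw [← H.map_comp, ← H.map_comp, hzero, Ind.yoneda.map_zero, zero_comp]
      exact ConcreteCategory.congr_hom h2 x)
  obtain ⟨j, f, hj⟩ := h1
  have hj' : q.app j = 0 := by
    rw [← hq f, ← zero_comp (f := Q.map f)]
    apply hx
    rw [Ind.yoneda.map_comp, Ind.yoneda.map_comp, H.map_comp, H.map_comp]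
    exact hj
  exact ⟨F.obj j, γ.app j, hepi j hj', c j, (hγ j).symm⟩

end IndCover

/-! ### From flatness to the extension property -/

section Flat

variable {R : Type u} [CommRing R] {C : Type u₁} [Category.{v₁} C] [Abelian C] [Linear R C]

theorem ind_yoneda_map_smul {D : Type w} [SmallCategory D] [Abelian D] [Linear R D] (r : R)
    {A B : D} (f : A ⟶ B) : Ind.yoneda.map (r • f) = r • Ind.yoneda.map f := by
  change _ = indAct r _ ≫ Ind.yoneda.map f
  rw [indAct_yoneda, ← Ind.yoneda.map_comp, Linear.smul_comp, Category.id_comp]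

theorem hasExtensions_asSmall (h : HasExtensions R (AsSmall.{w} C)) : HasExtensions R C := by
  intro M N _ _ _ _ _ _ i hi Z X f
  obtain ⟨E, k, hk, Z', e, he, g, hg⟩ := h i hi (Z := AsSmall.up.obj Z) (X := AsSmall.up.obj X)
    { toFun m := AsSmall.up.map (f m)
      map_add' a b := by rw [map_add, AsSmall.up.map_add]
      map_smul' r a := by
        rw [map_smul]
        rfl }
  refine ⟨AsSmall.down.obj E, AsSmall.down.map k,
    (AsSmall.equiv (C := C)).inverse.map_mono k, AsSmall.down.obj Z', AsSmall.down.map e,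
    (AsSmall.equiv (C := C)).inverse.map_epi e,
    { toFun n := AsSmall.down.map (g n)
      map_add' a b := by rw [map_add, AsSmall.down.map_add]
      map_smul' r a := by
        rw [map_smul]
        rfl }, fun m => ?_⟩
  exact congrArg AsSmall.down.map (hg m)

theorem IsFlat.hasExtensions (h : IsFlat R C) : HasExtensions R C := by
  rcases h with ⟨_, h⟩ | h
  · refine hasExtensions_of_embedding (𝟭 C) (fun r A B f => rfl) ?_ fun X =>
      ⟨Injective.under X, Injective.ι X, inferInstanceAs (Mono (Injective.ι X)), h _ inferInstance⟩
    intro Z W p _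
    exact ⟨W, p, inferInstance, 𝟙 _, by simp⟩
  · refine hasExtensions_asSmall.{_, v₁} ?_
    refine hasExtensions_of_embedding Ind.yoneda ind_yoneda_map_smul ind_exists_cover fun X =>
      ⟨Injective.under _, Injective.ι _, inferInstance, h _ inferInstance⟩

end Flat

/-! ### Yoneda extensions: effaceability, realization and comparison -/

section Ext

variable {C : Type u₁} [Category.{v₁} C] [Abelian C]

/-- The pullback of a short exact sequence. -/
theorem exists_pullback_shortExact {X E Z A : C} {i : X ⟶ E} {p : E ⟶ Z} {z : i ≫ p = 0}
    (h : (ShortComplex.mk i p z).ShortExact) (f : A ⟶ Z) :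
    ∃ (E' : C) (i' : X ⟶ E') (p' : E' ⟶ A) (t : E' ⟶ E) (z' : i' ≫ p' = 0)
      (_ : (ShortComplex.mk i' p' z').ShortExact), i' ≫ t = i ∧ p' ≫ f = t ≫ p ∧
        ∀ {W : C} (a : W ⟶ A) (b : W ⟶ E), a ≫ f = b ≫ p →
          ∃ c : W ⟶ E', c ≫ p' = a ∧ c ≫ t = b := by
  have := h.mono_f
  have := h.epi_g
  dsimp at *
  have hi : (0 : X ⟶ A) ≫ f = i ≫ p := by rw [z, zero_comp]
  have z' : pullback.lift (f := f) (g := p) 0 i hi ≫ pullback.fst f p = 0 :=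
    pullback.lift_fst _ _ _
  have hm : Mono (pullback.lift (f := f) (g := p) 0 i hi) := by
    have : Mono (pullback.lift (f := f) (g := p) 0 i hi ≫ pullback.snd f p) := by
      rwa [pullback.lift_snd]
    exact mono_of_mono _ (pullback.snd f p)
  refine ⟨pullback f p, pullback.lift 0 i hi, pullback.fst f p, pullback.snd f p, z',
    ⟨?_⟩, pullback.lift_snd _ _ _, pullback.condition,
    fun a b hab => ⟨pullback.lift a b hab, pullback.lift_fst _ _ _, pullback.lift_snd _ _ _⟩⟩
  refine ShortComplex.exact_of_f_is_kernel _ (KernelFork.IsLimit.ofι' _ z' fun {W} k hk => ?_)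
  have hk' : (k ≫ pullback.snd f p) ≫ p = 0 := by
    rw [Category.assoc, ← pullback.condition, reassoc_of% hk, zero_comp]
  refine ⟨h.exact.lift (k ≫ pullback.snd f p) hk', ?_⟩
  apply pullback.hom_ext
  · rw [Category.assoc, pullback.lift_fst, comp_zero, hk]
  · rw [Category.assoc, pullback.lift_snd]
    exact h.exact.lift_f _ hk'

/-- The pushout of a short exact sequence. -/
theorem exists_pushout_shortExact {X E Z B : C} {i : X ⟶ E} {p : E ⟶ Z} {z : i ≫ p = 0}
    (h : (ShortComplex.mk i p z).ShortExact) (f : X ⟶ B) :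
    ∃ (E' : C) (i' : B ⟶ E') (p' : E' ⟶ Z) (t : E ⟶ E') (z' : i' ≫ p' = 0)
      (_ : (ShortComplex.mk i' p' z').ShortExact), f ≫ i' = i ≫ t ∧ t ≫ p' = p := by
  have := h.mono_f
  have := h.epi_g
  dsimp at *
  have hp : f ≫ (0 : B ⟶ Z) = i ≫ p := by rw [z, comp_zero]
  have z' : pushout.inl f i ≫ pushout.desc (f := f) (g := i) 0 p hp = 0 :=
    pushout.inl_desc _ _ _
  have hm : Epi (pushout.desc (f := f) (g := i) 0 p hp) := by
    have : Epi (pushout.inr f i ≫ pushout.desc (f := f) (g := i) 0 p hp) := by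
      rwa [pushout.inr_desc]
    exact epi_of_epi (pushout.inr f i) _
  refine ⟨pushout f i, pushout.inl f i, pushout.desc 0 p hp, pushout.inr f i, z', ⟨?_⟩,
    pushout.condition, pushout.inr_desc _ _ _⟩
  refine ShortComplex.exact_of_g_is_cokernel _ (CokernelCofork.IsColimit.ofπ' _ z'
    fun {W} k hk => ?_)
  have hk' : i ≫ pushout.inr f i ≫ k = 0 := by
    rw [← pushout.condition_assoc, hk, comp_zero]
  refine ⟨h.exact.desc (pushout.inr f i ≫ k) hk', ?_⟩
  apply pushout.hom_ext
  · rw [pushout.inl_desc_assoc, zero_comp, hk]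
  · rw [pushout.inr_desc_assoc]
    exact h.exact.g_desc _ hk'

theorem shortExact_of_mono {X E : C} (k : X ⟶ E) [Mono k] :
    (ShortComplex.mk k (cokernel.π k) (cokernel.condition k)).ShortExact :=
  { exact := ShortComplex.exact_cokernel k }

theorem shortExact_of_epi {E Z : C} (p : E ⟶ Z) [Epi p] :
    (ShortComplex.mk (kernel.ι p) p (kernel.condition p)).ShortExact :=
  { exact := ShortComplex.exact_kernel p }

/-- A morphism in the derived category from an object to a complex in negative degrees is killed by
an epimorphism to the source. -/
theorem exists_epi_single_comp_eq_zero [HasDerivedCategory.{w} C] {A : C} {L : CochainComplex C ℤ}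
    [L.IsStrictlyLE (-1)]
    (f : DerivedCategory.Q.obj ((HomologicalComplex.single C (ComplexShape.up ℤ) 0).obj A) ⟶
      DerivedCategory.Q.obj L) :
    ∃ (A' : C) (p : A' ⟶ A) (_ : Epi p),
      DerivedCategory.Q.map ((HomologicalComplex.single C (ComplexShape.up ℤ) 0).map p) ≫ f =
        0 := by
  -- The morphism is a roof whose apex can be truncated to degrees at most 0. Quasi-isomorphy makes
  -- `X'⁰ ⟶ A` epi, and along it the morphism becomes a map of complexes from degree 0 into `L`,
  -- where `L⁰ = 0`.
  obtain ⟨X', _, s, hs, g, rfl⟩ := DerivedCategory.right_fac_of_isStrictlyLE f 0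
  have hd (k : ℤ) (hk : (ComplexShape.up ℤ).Rel 0 k) : 𝟙 (X'.X 0) ≫ X'.d 0 k = 0 := by
    have : 0 + 1 = k := hk
    exact (X'.isZero_of_isStrictlyLE 0 k (by lia)).eq_of_tgt _ _
  let φ := HomologicalComplex.mkHomFromSingle (𝟙 (X'.X 0)) hd
  have hφg : φ ≫ g = 0 := by
    apply HomologicalComplex.from_single_hom_ext
    exact (L.isZero_of_isStrictlyLE (-1) 0 (by lia)).eq_of_tgt _ _
  have hp : Epi (s.f 0) := by
    have hs' : QuasiIso s := (DerivedCategory.isIso_Q_map_iff_quasiIso C s).1 hs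
    have h0 : QuasiIsoAt s 0 := inferInstance
    rw [quasiIsoAt_iff, ShortComplex.quasiIso_iff_of_zeros'] at h0
    · exact h0.2
    · exact (X'.isZero_of_isStrictlyLE 0 _ (by simp)).eq_of_tgt _ _
    · exact HomologicalComplex.single_obj_d (ComplexShape.up ℤ) _ _ _ _
    · exact HomologicalComplex.single_obj_d (ComplexShape.up ℤ) _ _ _ _
  refine ⟨X'.X 0, s.f 0 ≫ (HomologicalComplex.singleObjXSelf (ComplexShape.up ℤ) 0 A).hom,
    epi_comp _ _, ?_⟩
  have hφs : (HomologicalComplex.single C (ComplexShape.up ℤ) 0).map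
      (s.f 0 ≫ (HomologicalComplex.singleObjXSelf (ComplexShape.up ℤ) 0 A).hom) = φ ≫ s := by
    apply HomologicalComplex.from_single_hom_ext
    rw [HomologicalComplex.comp_f, HomologicalComplex.mkHomFromSingle_f,
      HomologicalComplex.single_map_f_self, Category.comp_id, Category.assoc, Iso.hom_inv_id,
      Category.comp_id]
  rw [hφs, Functor.map_comp, Category.assoc, IsIso.hom_inv_id_assoc, ← Functor.map_comp, hφg,
    Functor.map_zero]

variable [HasExt.{w} C]

/-- Every extension class of positive degree is killed by an epimorphism to the source. -/
theorem exists_epi_comp_eq_zero {A X : C} {n : ℕ} (e : Ext A X (n + 1)) :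
    ∃ (A' : C) (p : A' ⟶ A) (_ : Epi p), (Ext.mk₀ p).comp e (zero_add _) = 0 := by
  let := HasDerivedCategory.standard C
  let K := (CochainComplex.singleFunctor C 0).obj X
  let i := (DerivedCategory.Q.commShiftIso ((n + 1 : ℕ) : ℤ)).app K
  have : (K⟦((n + 1 : ℕ) : ℤ)⟧).IsStrictlyLE (-1) := by
    have := K.isStrictlyLE_shift 0 ((n + 1 : ℕ) : ℤ) (-((n + 1 : ℕ) : ℤ)) (by lia)
    exact CochainComplex.isStrictlyLE_of_le _ (-((n + 1 : ℕ) : ℤ)) _ (by lia)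
  let f : DerivedCategory.Q.obj ((HomologicalComplex.single C (ComplexShape.up ℤ) 0).obj A) ⟶
    DerivedCategory.Q.obj (K⟦((n + 1 : ℕ) : ℤ)⟧) := e.hom ≫ i.inv
  obtain ⟨A', p, hp, h⟩ := exists_epi_single_comp_eq_zero f
  refine ⟨A', p, hp, Ext.ext ?_⟩
  rw [← Ext.singleFunctor_map_comp_hom, Ext.zero_hom]
  refine (cancel_mono i.inv).1 ?_
  exact (Category.assoc _ _ _).trans (h.trans zero_comp.symm)

/-- Every extension class of positive degree is killed by a monomorphism from the target. -/
theorem exists_mono_comp_eq_zero {A X : C} {n : ℕ} (e : Ext A X (n + 1)) :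
    ∃ (X' : C) (k : X ⟶ X') (_ : Mono k), e.comp (Ext.mk₀ k) (add_zero _) = 0 := by
  induction n generalizing A with
  | zero =>
    obtain ⟨A', p, hp, h⟩ := exists_epi_comp_eq_zero e
    obtain ⟨x, rfl⟩ := Ext.contravariant_sequence_exact₃ (shortExact_of_epi p) X e h (n₀ := 0) rfl
    obtain ⟨f, rfl⟩ := (Ext.mk₀_bijective _ _).2 x
    -- The class is the connecting class composed with `f`. In the pushout, `f ≫ i'` factors through
    -- `A'`, so it is killed by the connecting class.
    obtain ⟨E, i', p', t, z, h', h1, h2⟩ := exists_pushout_shortExact (shortExact_of_epi p) f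
    refine ⟨E, i', h'.mono_f, ?_⟩
    rw [Ext.comp_assoc_of_third_deg_zero, Ext.mk₀_comp_mk₀, h1, ← Ext.mk₀_comp_mk₀]
    exact (shortExact_of_epi p).extClass_comp_assoc (Ext.mk₀ t)
  | succ n ih =>
    obtain ⟨A', p, hp, h⟩ := exists_epi_comp_eq_zero e
    obtain ⟨x, rfl⟩ := Ext.contravariant_sequence_exact₃ (shortExact_of_epi p) X e h
      (n₀ := n + 1) (by lia)
    obtain ⟨X', k, hk, h'⟩ := ih x
    exact ⟨X', k, hk, by rw [Ext.comp_assoc_of_third_deg_zero, h', Ext.comp_zero]⟩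

theorem extClass_naturality {X E Z X' E' Z' : C} {i : X ⟶ E} {p : E ⟶ Z} {z : i ≫ p = 0}
    (h : (ShortComplex.mk i p z).ShortExact) {i' : X' ⟶ E'} {p' : E' ⟶ Z'} {z' : i' ≫ p' = 0}
    (h' : (ShortComplex.mk i' p' z').ShortExact) (a : X ⟶ X') (b : E ⟶ E') (c : Z ⟶ Z')
    (h₁ : a ≫ i' = i ≫ b) (h₂ : b ≫ p' = p ≫ c) :
    h.extClass.comp (Ext.mk₀ a) (add_zero 1) = (Ext.mk₀ c).comp h'.extClass (zero_add 1) :=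
  ShortComplex.ShortExact.extClass_naturality h h'
    { τ₁ := a, τ₂ := b, τ₃ := c, comm₁₂ := h₁, comm₂₃ := h₂ }

theorem extClass_pullback {X E Z E' Z' : C} {i : X ⟶ E} {p : E ⟶ Z} {z : i ≫ p = 0}
    (h : (ShortComplex.mk i p z).ShortExact) {i' : X ⟶ E'} {p' : E' ⟶ Z'} {z' : i' ≫ p' = 0}
    (h' : (ShortComplex.mk i' p' z').ShortExact) (b : E ⟶ E') (c : Z ⟶ Z')
    (h₁ : i ≫ b = i') (h₂ : b ≫ p' = p ≫ c) :
    h.extClass = (Ext.mk₀ c).comp h'.extClass (zero_add 1) := by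
  rw [← extClass_naturality h h' (𝟙 X) b c (by simp [h₁]) h₂, Ext.comp_mk₀_id]

theorem extClass_pushout {X E Z X' E' : C} {i : X ⟶ E} {p : E ⟶ Z} {z : i ≫ p = 0}
    (h : (ShortComplex.mk i p z).ShortExact) {i' : X' ⟶ E'} {p' : E' ⟶ Z} {z' : i' ≫ p' = 0}
    (h' : (ShortComplex.mk i' p' z').ShortExact) (a : X ⟶ X') (b : E ⟶ E')
    (h₁ : a ≫ i' = i ≫ b) (h₂ : b ≫ p' = p) :
    h'.extClass = h.extClass.comp (Ext.mk₀ a) (add_zero 1) := by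
  rw [extClass_naturality h h' a b (𝟙 Z) h₁ (by simp [h₂]), Ext.mk₀_id_comp]

/-- Every class in `Ext¹` is the class of a short exact sequence. -/
theorem exists_extClass_eq {A X : C} (e : Ext A X 1) :
    ∃ (E : C) (i : X ⟶ E) (p : E ⟶ A) (z : i ≫ p = 0) (h : (ShortComplex.mk i p z).ShortExact),
      h.extClass = e := by
  obtain ⟨A', p, hp, h⟩ := exists_epi_comp_eq_zero e
  obtain ⟨x, rfl⟩ := Ext.contravariant_sequence_exact₃ (shortExact_of_epi p) X e h (n₀ := 0) rfl
  obtain ⟨f, rfl⟩ := (Ext.mk₀_bijective _ _).2 x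
  obtain ⟨E, i', p', t, z, h', h1, h2⟩ := exists_pushout_shortExact (shortExact_of_epi p) f
  exact ⟨E, i', p', z, h', extClass_pushout _ h' f t h1 h2⟩

/-- Extensions with the same class are isomorphic. -/
theorem exists_iso_of_extClass_eq {X E E' Z : C} {i : X ⟶ E} {p : E ⟶ Z} {z : i ≫ p = 0}
    (h : (ShortComplex.mk i p z).ShortExact) {i' : X ⟶ E'} {p' : E' ⟶ Z} {z' : i' ≫ p' = 0}
    (h' : (ShortComplex.mk i' p' z').ShortExact) (he : h.extClass = h'.extClass) :
    ∃ b : E ≅ E', i ≫ b.hom = i' ∧ b.hom ≫ p' = p := by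
  obtain ⟨x, hx⟩ := Ext.contravariant_sequence_exact₁ h E' (Ext.mk₀ i') (n₁ := 1) rfl (by
    rw [he]
    exact h'.extClass_comp)
  obtain ⟨b, rfl⟩ := (Ext.mk₀_bijective _ _).2 x
  rw [Ext.mk₀_comp_mk₀] at hx
  have hb : i ≫ b = i' := (Ext.mk₀_bijective _ _).1 hx
  have ht0 : i ≫ b ≫ p' = 0 := by rw [reassoc_of% hb, z']
  have := h.epi_g
  obtain ⟨t, ht⟩ : ∃ t : Z ⟶ Z, p ≫ t = b ≫ p' := ⟨h.exact.desc _ ht0, h.exact.g_desc _ ht0⟩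
  have hn := extClass_pullback h h' b t hb ht.symm
  -- The map `b` extends `i'` but induces some `t` on `Z` instead of the identity. As `t - 𝟙 Z`
  -- kills the class, it lifts to some `s : Z ⟶ E'`, and subtracting `p ≫ s` from `b` corrects the
  -- quotient without disturbing the restriction to `X`.
  obtain ⟨y, hy⟩ := Ext.covariant_sequence_exact₃ Z h' (Ext.mk₀ (t - 𝟙 Z)) (n₁ := 1) rfl (by
    have : Ext.mk₀ (t - 𝟙 Z) = Ext.mk₀ t - Ext.mk₀ (𝟙 Z) := Ext.addEquiv₀.symm.map_sub _ _
    rw [this, sub_eq_add_neg, Ext.add_comp, Ext.neg_comp, ← hn, Ext.mk₀_id_comp, he,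
      add_neg_cancel])
  obtain ⟨s, rfl⟩ := (Ext.mk₀_bijective _ _).2 y
  rw [Ext.mk₀_comp_mk₀] at hy
  have hs : s ≫ p' = t - 𝟙 Z := (Ext.mk₀_bijective _ _).1 hy
  have h1 : i ≫ (b - p ≫ s) = i' := by
    rw [Preadditive.comp_sub, hb, reassoc_of% z, zero_comp, sub_zero]
  have h2 : (b - p ≫ s) ≫ p' = p := by
    rw [Preadditive.sub_comp, Category.assoc, hs, ← ht, Preadditive.comp_sub, Category.comp_id,
      sub_sub_cancel]
  let φ : ShortComplex.mk i p z ⟶ ShortComplex.mk i' p' z' :=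
    { τ₁ := 𝟙 X
      τ₂ := b - p ≫ s
      τ₃ := 𝟙 Z
      comm₁₂ := (Category.id_comp _).trans h1.symm
      comm₂₃ := h2.trans (Category.comp_id _).symm }
  have : IsIso φ.τ₁ := inferInstanceAs (IsIso (𝟙 X))
  have : IsIso φ.τ₃ := inferInstanceAs (IsIso (𝟙 Z))
  have : IsIso (b - p ≫ s) := ShortComplex.isIso₂_of_shortExact_of_isIso₁₃ φ h h'
  exact ⟨asIso (b - p ≫ s), h1, h2⟩

theorem exists_retraction_of_extClass_eq_zero {X E Z : C} {i : X ⟶ E} {p : E ⟶ Z} {z : i ≫ p = 0}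
    (h : (ShortComplex.mk i p z).ShortExact) (he : h.extClass = 0) : ∃ r : E ⟶ X, i ≫ r = 𝟙 X := by
  obtain ⟨x, hx⟩ := Ext.contravariant_sequence_exact₁ h X (Ext.mk₀ (𝟙 X)) (n₁ := 1) rfl (by
    rw [he, Ext.zero_comp])
  obtain ⟨r, rfl⟩ := (Ext.mk₀_bijective _ _).2 x
  rw [Ext.mk₀_comp_mk₀] at hx
  exact ⟨r, (Ext.mk₀_bijective _ _).1 hx⟩

theorem extClass_eq_zero_of_retraction {X E Z : C} {i : X ⟶ E} {p : E ⟶ Z} {z : i ≫ p = 0}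
    (h : (ShortComplex.mk i p z).ShortExact) (r : E ⟶ X) (hr : i ≫ r = 𝟙 X) : h.extClass = 0 := by
  have h1 := h.extClass_comp_assoc (Ext.mk₀ r) (h := add_zero 1)
  rwa [Ext.mk₀_comp_mk₀, hr, Ext.comp_mk₀_id] at h1

end Ext

/-! ### The morphism induced by a scalar on an extension -/

section Action

variable {A : Type u} [CommRing A] {C : Type u₁} [Category.{v₁} C] [Abelian C] [Linear A C]
  [HasExt.{w} C]

/-- Multiplication by `a` on an extension of class `e` is induced by `v`. -/
def IsAction (a : A) {X Z : C} (e : Ext.{w} Z X 1) (v : Z ⟶ X) : Prop :=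
  ∃ (E : C) (i : X ⟶ E) (p : E ⟶ Z) (z : i ≫ p = 0) (h : (ShortComplex.mk i p z).ShortExact),
    h.extClass = e ∧ p ≫ v ≫ i = a • 𝟙 E

variable {a : A} {X Z : C}

theorem IsAction.of_extClass_eq {e : Ext.{w} Z X 1} {v : Z ⟶ X} (hv : IsAction a e v) {E : C}
    {i : X ⟶ E} {p : E ⟶ Z} {z : i ≫ p = 0} (h : (ShortComplex.mk i p z).ShortExact)
    (he : h.extClass = e) : p ≫ v ≫ i = a • 𝟙 E := by
  obtain ⟨E', i', p', z', h', he', hv'⟩ := hv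
  obtain ⟨b, hb₁, hb₂⟩ := exists_iso_of_extClass_eq h h' (he.trans he'.symm)
  rw [← cancel_mono b.hom, Category.assoc, Category.assoc, hb₁, ← hb₂, Category.assoc, hv']
  simp

theorem IsAction.unique {e : Ext.{w} Z X 1} {v v' : Z ⟶ X} (hv : IsAction a e v)
    (hv' : IsAction a e v') : v = v' := by
  obtain ⟨E, i, p, z, h, he, hi⟩ := hv
  have := h.mono_f
  have := h.epi_g
  dsimp at *
  rwa [← hv'.of_extClass_eq h he, cancel_epi, cancel_mono] at hi

/-- Multiplication by `a` on the middle term vanishes on the subobject and after projection to the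
quotient, so it factors as quotient, then `v`, then subobject. -/
theorem exists_isAction (hX : a • 𝟙 X = 0) (hZ : a • 𝟙 Z = 0) (e : Ext.{w} Z X 1) :
    ∃ v, IsAction a e v := by
  obtain ⟨E, i, p, z, h, he⟩ := exists_extClass_eq e
  have := h.mono_f
  have := h.epi_g
  dsimp at *
  have h0 : i ≫ (a • 𝟙 E) = 0 := by
    rw [Linear.comp_smul, Category.comp_id, ← Category.id_comp i, ← Linear.smul_comp, hX, zero_comp]
  obtain ⟨t, ht⟩ : ∃ t : Z ⟶ E, p ≫ t = a • 𝟙 E := ⟨h.exact.desc _ h0, h.exact.g_desc _ h0⟩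
  have h1 : t ≫ p = 0 := by
    rw [← cancel_epi p, reassoc_of% ht, Linear.smul_comp, Category.id_comp, ← Category.comp_id p,
      ← Linear.comp_smul, hZ, comp_zero, comp_zero]
  exact ⟨h.exact.lift t h1, E, i, p, z, h, he, by
    rw [← ht]
    exact congrArg _ (h.exact.lift_f t h1)⟩

theorem IsAction.precomp (hX : a • 𝟙 X = 0) {e : Ext.{w} Z X 1} {v : Z ⟶ X} (hv : IsAction a e v)
    {Z' : C} (hZ' : a • 𝟙 Z' = 0) (f : Z' ⟶ Z) :
    IsAction a ((Ext.mk₀ f).comp e (zero_add 1)) (f ≫ v) := by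
  obtain ⟨v', hv'⟩ := exists_isAction hX hZ' ((Ext.mk₀ f).comp e (zero_add 1))
  obtain ⟨E, i, p, z, h, rfl, hi⟩ := hv
  obtain ⟨E', i', p', t, z', h', h1, h2, -⟩ := exists_pullback_shortExact h f
  have h3 := hv'.of_extClass_eq h' (extClass_pullback h' h t f h1 h2.symm)
  have := h.mono_f
  have := h'.epi_g
  dsimp at *
  suffices v' = f ≫ v by rwa [← this]
  rw [← cancel_epi p', ← cancel_mono i, ← h1, Category.assoc, reassoc_of% h3, h1]
  simp [reassoc_of% h2, hi]

theorem IsAction.postcomp (hZ : a • 𝟙 Z = 0) {e : Ext.{w} Z X 1} {v : Z ⟶ X} (hv : IsAction a e v)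
    {X' : C} (hX' : a • 𝟙 X' = 0) (f : X ⟶ X') :
    IsAction a (e.comp (Ext.mk₀ f) (add_zero 1)) (v ≫ f) := by
  obtain ⟨v', hv'⟩ := exists_isAction hX' hZ (e.comp (Ext.mk₀ f) (add_zero 1))
  obtain ⟨E, i, p, z, h, rfl, hi⟩ := hv
  obtain ⟨E', i', p', t, z', h', h1, h2⟩ := exists_pushout_shortExact h f
  have h3 := hv'.of_extClass_eq h' (extClass_pushout h h' f t h1 h2)
  have := h'.mono_f
  have := h.epi_g
  dsimp at *
  suffices v' = v ≫ f by rwa [← this]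
  rw [← cancel_epi p, ← cancel_mono i', ← h2]
  simp only [Category.assoc, h3, h1]
  rw [reassoc_of% h2, reassoc_of% hi]
  simp

/-- The sum is the pushforward of the pair `(e, e')`, a class with values in `X ⊞ X`, along the
codiagonal. Naturality and uniqueness determine both components of the action on the pair, and the
codiagonal adds them. -/
theorem IsAction.add (hX : a • 𝟙 X = 0) (hZ : a • 𝟙 Z = 0) {e e' : Ext.{w} Z X 1} {v v' : Z ⟶ X}
    (hv : IsAction a e v) (hv' : IsAction a e' v') : IsAction a (e + e') (v + v') := by
  have hXX : a • 𝟙 (X ⊞ X) = 0 := by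
    apply biprod.hom_ext
    · rw [Linear.smul_comp, Category.id_comp, zero_comp, ← Category.comp_id biprod.fst,
        ← Linear.comp_smul, hX, comp_zero]
    · rw [Linear.smul_comp, Category.id_comp, zero_comp, ← Category.comp_id biprod.snd,
        ← Linear.comp_smul, hX, comp_zero]
  obtain ⟨V, hV⟩ := exists_isAction hXX hZ (e.comp (Ext.mk₀ biprod.inl) (add_zero 1) +
    e'.comp (Ext.mk₀ biprod.inr) (add_zero 1))
  have h1 := hV.postcomp hZ hX biprod.fst
  have h2 := hV.postcomp hZ hX biprod.snd
  have h3 := hV.postcomp hZ hX (biprod.desc (𝟙 X) (𝟙 X))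
  simp only [Ext.add_comp, Ext.comp_assoc_of_third_deg_zero, Ext.mk₀_comp_mk₀, biprod.inl_fst,
    biprod.inr_fst, biprod.inl_snd, biprod.inr_snd, biprod.inl_desc, biprod.inr_desc,
    Ext.comp_mk₀_id, Ext.mk₀_zero, Ext.comp_zero, add_zero, zero_add] at h1 h2 h3
  rw [hv.unique h1, hv'.unique h2, ← Preadditive.comp_add]
  have : biprod.fst + biprod.snd = biprod.desc (𝟙 X) (𝟙 X) := by
    apply biprod.hom_ext' <;> simp
  rwa [this]

theorem IsAction.sub (hX : a • 𝟙 X = 0) (hZ : a • 𝟙 Z = 0) {e e' : Ext.{w} Z X 1} {v v' : Z ⟶ X}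
    (hv : IsAction a e v) (hv' : IsAction a e' v') : IsAction a (e - e') (v - v') := by
  obtain ⟨V, hV⟩ := exists_isAction hX hZ (e - e')
  have h := hV.add hX hZ hv'
  rw [sub_add_cancel] at h
  rwa [hv.unique h, add_sub_cancel_right]

end Action

/-! ### Killing extension classes by epimorphisms from `C₀` -/

namespace IsDeformation

variable {R S : Type u} [CommRing R] [CommRing S] {θ : R →+* S}
  {C₀ : Type u₁} [Category.{v₁} C₀] [Abelian C₀] [Linear S C₀]
  {C : Type u₂} [Category.{v₂} C] [Abelian C] [Linear R C] {G : C₀ ⥤ C}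

theorem exists_lifts {E Q : C} (p : E ⟶ Q) [Epi p] : ∀ (n : ℕ) {V : C} (y : Fin n → (V ⟶ Q)),
    ∃ (V' : C) (e : V' ⟶ V) (_ : Epi e) (x : Fin n → (V' ⟶ E)), ∀ j, x j ≫ p = e ≫ y j := by
  intro n
  induction n with
  | zero => exact fun y => ⟨_, 𝟙 _, inferInstance, fun j => j.elim0, fun j => j.elim0⟩
  | succ n ih =>
    intro V y
    obtain ⟨V', e, _, x, hx⟩ := ih fun j => y j.succ
    obtain ⟨V'', e', _, x₀, hx₀⟩ := surjective_up_to_refinements_of_epi p (e ≫ y 0)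
    refine ⟨V'', e' ≫ e, inferInstance, Fin.cons x₀ fun j => e' ≫ x j, fun j => ?_⟩
    refine Fin.cases ?_ (fun j => ?_) j
    · simp [hx₀]
    · simp [hx]

/-- Families that are linear in a finitely generated module can be lifted locally along the
projection to the quotient by a coflat object. -/
theorem exists_linear_lift [IsCoherentRing R] {X E Q : C} (hX : IsCoflat R X) {k : X ⟶ E}
    {p : E ⟶ Q} {z : k ≫ p = 0} (h : (ShortComplex.mk k p z).ShortExact) {M : Type u}
    [AddCommGroup M] [Module R M] [Module.FinitePresentation R M] {V : C} (f : M →ₗ[R] (V ⟶ Q)) :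
    ∃ (V' : C) (e : V' ⟶ V) (_ : Epi e) (g : M →ₗ[R] (V' ⟶ E)), ∀ m, g m ≫ p = e ≫ f m := by
  have := h.mono_f
  have := h.epi_g
  dsimp at *
  obtain ⟨n, l, π, -, hπ, -⟩ := Module.FinitePresentation.exists_fin' R M
  have hK : Module.FinitePresentation R (LinearMap.ker π) :=
    finitePresentation_of_fg _ (Module.FinitePresentation.fg_ker π hπ)
  obtain ⟨V₁, e₁, _, x, hx⟩ := exists_lifts p n fun j => f (π (Pi.single j 1))
  let g₁ : (Fin n → R) →ₗ[R] (V₁ ⟶ E) := Fintype.linearCombination R x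
  have hg₁ (v) : g₁ v ≫ p = e₁ ≫ f (π v) := by
    have : Linear.rightComp R V₁ p ∘ₗ g₁ = Linear.leftComp R Q e₁ ∘ₗ f ∘ₗ π := by
      apply (Pi.basisFun R (Fin n)).ext
      intro j
      simp [g₁, Fintype.linearCombination_apply_single, hx]
    exact LinearMap.congr_fun this v
  have hc0 (v : LinearMap.ker π) : g₁ v ≫ p = 0 := by rw [hg₁, v.2, map_zero, comp_zero]
  let lift (v : LinearMap.ker π) : V₁ ⟶ X := h.exact.lift (g₁ v) (hc0 v)
  have hlift (v) : lift v ≫ k = g₁ v := h.exact.lift_f _ _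
  let c : LinearMap.ker π →ₗ[R] (V₁ ⟶ X) :=
    { toFun := lift
      map_add' a b := by rw [← cancel_mono k]; simp [hlift]
      map_smul' r a := by rw [← cancel_mono k]; simp [hlift] }
  -- Lifting the generators of `M` independently sends the relations `ker π` into `X` rather than to
  -- zero. Coflatness extends this error to the free module, where it is subtracted from the lift.
  obtain ⟨V₂, e₂, _, c', hc'⟩ :=
    hX.exists_extension (LinearMap.ker π).subtype (Submodule.subtype_injective _) c
  let g₂ : (Fin n → R) →ₗ[R] (V₂ ⟶ E) :=
    Linear.leftComp R E e₂ ∘ₗ g₁ - Linear.rightComp R V₂ k ∘ₗ c'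
  have hker : LinearMap.ker π ≤ LinearMap.ker g₂ := fun v hv => by
    have := hc' ⟨v, hv⟩
    simp only [Submodule.subtype_apply] at this
    have h2 : c ⟨v, hv⟩ ≫ k = g₁ v := hlift ⟨v, hv⟩
    simp [g₂, this, h2]
  let g : M →ₗ[R] (V₂ ⟶ E) :=
    (LinearMap.ker π).liftQ _ hker ∘ₗ (π.quotKerEquivOfSurjective hπ).symm.toLinearMap
  have hg (v) : g (π v) = g₂ v := by
    have : (π.quotKerEquivOfSurjective hπ).symm (π v) = Submodule.Quotient.mk v := by
      rw [LinearEquiv.symm_apply_eq]; rfl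
    simp [g, this]
  refine ⟨V₂, e₂ ≫ e₁, inferInstance, g, fun m => ?_⟩
  obtain ⟨v, rfl⟩ := hπ m
  rw [hg]
  simp [g₂, hg₁, z]

/-- An extension class of an object in the image of `G` is killed locally, after a change of the
target that trivializes the action of the kernel of `θ` on the extension. -/
theorem exists_efface_family [HasExt.{w} C] (h : IsDeformation θ G) (hθ : Function.Surjective θ)
    (hfg : (RingHom.ker θ).FG) {Z : C₀} {Q : C} (α : Ext (G.obj Z) Q 1) :
    ∃ (V : C) (f : RingHom.ker θ →ₗ[R] (V ⟶ Q)), ∀ {Q₂ : C} (κ : Q ⟶ Q₂) {V' : C} (e : V' ⟶ V)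
      (_ : Epi e) (q : V' ⟶ Q₂) (_ : ∀ r : RingHom.ker θ, (r : R) • q = e ≫ f r ≫ κ),
      ∃ (Z' : C₀) (z : Z' ⟶ Z) (_ : Epi z),
        (Ext.mk₀ (G.map z)).comp (α.comp (Ext.mk₀ κ) (add_zero 1)) (zero_add 1) = 0 := by
  have := h.linear.additive
  have := h.full hθ
  have := h.faithful
  obtain ⟨V, i, p, zip, hV, rfl⟩ := exists_extClass_eq α
  have := hV.mono_f
  have := hV.epi_g
  dsimp at *
  have hp (r : RingHom.ker θ) : ((r : R) • 𝟙 V) ≫ p = 0 := by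
    rw [Linear.smul_comp, Category.id_comp, ← Category.comp_id p, ← Linear.comp_smul,
      h.smul_eq_zero r.2, comp_zero]
  let lift (r : RingHom.ker θ) : V ⟶ Q := hV.exact.lift ((r : R) • 𝟙 V) (hp r)
  have hlift (r) : lift r ≫ i = (r : R) • 𝟙 V := hV.exact.lift_f _ _
  let f : RingHom.ker θ →ₗ[R] (V ⟶ Q) :=
    { toFun := lift
      map_add' a b := by rw [← cancel_mono i]; simp [hlift, add_smul]
      map_smul' r a := by rw [← cancel_mono i]; simp [hlift, mul_smul] }
  have hf (r) : f r ≫ i = (r : R) • 𝟙 V := hlift r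
  refine ⟨V, f, fun {Q₂} κ {V'} e _ q hq => ?_⟩
  obtain ⟨V₂, i₂, p₂, t, z₂, hV₂, h1, h2⟩ := exists_pushout_shortExact hV κ
  obtain ⟨Z', q', _, hq'⟩ := h.exists_quotient hθ hfg V'
  -- On `V'` the scalar `r` acts on both terms by `e ≫ f r ≫ κ`, followed by `i₂`, so the difference
  -- is killed by `ker θ` and descends to `G.obj Z'`. It lifts the epimorphism `t' ≫ p₂` to the
  -- pushed-out extension, which therefore splits over `Z'`.
  obtain ⟨t', ht'⟩ := hq' (e ≫ t - q ≫ i₂) fun r hr => by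
    have h3 := hq ⟨r, hr⟩
    rw [smul_sub, ← Linear.smul_comp _ _ _ r q, h3, Category.assoc, Category.assoc, h1,
      reassoc_of% (hf ⟨r, hr⟩)]
    simp
  have hz : q' ≫ t' ≫ p₂ = e ≫ p := by
    rw [reassoc_of% ht', Preadditive.sub_comp, Category.assoc, Category.assoc, h2, z₂, comp_zero,
      sub_zero]
  have : Epi (t' ≫ p₂) := by
    have : Epi (q' ≫ t' ≫ p₂) := by
      rw [hz]
      infer_instance
    exact epi_of_epi q' _
  refine ⟨Z', G.preimage (t' ≫ p₂), G.epi_of_epi_map (by rwa [G.map_preimage]), ?_⟩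
  rw [G.map_preimage, ← extClass_pushout hV hV₂ κ t h1 h2, ← Ext.mk₀_comp_mk₀,
    Ext.comp_assoc_of_second_deg_zero]
  have h0 : (Ext.mk₀ p₂).comp hV₂.extClass (zero_add 1) = 0 := hV₂.comp_extClass
  rw [h0, Ext.comp_zero]

/-- Coflatness extends the action family from `ker θ` to `R` locally. Its value at `1` is the
correction term required by `exists_efface_family`, with no change of the target. -/
theorem exists_efface_one [HasExt.{w} C] [IsCoherentRing R] (h : IsDeformation θ G)
    (hθ : Function.Surjective θ) (hfg : (RingHom.ker θ).FG) {X : C} (hX : IsCoflat R X) {Z : C₀}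
    (e : Ext (G.obj Z) X 1) :
    ∃ (Z' : C₀) (z : Z' ⟶ Z) (_ : Epi z), (Ext.mk₀ (G.map z)).comp e (zero_add 1) = 0 := by
  have : Module.FinitePresentation R (RingHom.ker θ) :=
    IsCoherentRing.finitePresentation_of_fg _ hfg
  obtain ⟨V, f, hf⟩ := h.exists_efface_family hθ hfg e
  obtain ⟨V', e', he', g, hg⟩ := hX.exists_extension (N := R) (RingHom.ker θ).subtype
    (Submodule.subtype_injective _) f
  obtain ⟨Z', z, hz, h0⟩ := hf (𝟙 X) e' he' (g 1) fun r => by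
    rw [Category.comp_id, ← hg, ← map_smul]
    simp
  exact ⟨Z', z, hz, by simpa using h0⟩

/-- Dimension shifting writes the class as the product of `α` in `Ext¹` with values in `E/X` and the
class of `E`. The action family of `α` lifts to `E` because `X` is coflat, and extends from `ker θ`
to `R` after `E` is enlarged to `E₂`. This kills the image of `α` in `E₂/X`, which is enough since
the class of `E` is pulled back from that of `E₂`. -/
theorem exists_efface_two [HasExt.{w} C] [IsCoherentRing R] (h : IsDeformation θ G)
    (hθ : Function.Surjective θ) (hfg : (RingHom.ker θ).FG) (hC : HasExtensions R C) {X : C}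
    (hX : IsCoflat R X) {Z : C₀} (e : Ext (G.obj Z) X 2) :
    ∃ (Z' : C₀) (z : Z' ⟶ Z) (_ : Epi z), (Ext.mk₀ (G.map z)).comp e (zero_add 2) = 0 := by
  have : Module.FinitePresentation R (RingHom.ker θ) :=
    IsCoherentRing.finitePresentation_of_fg _ hfg
  obtain ⟨E, k, hk, hek⟩ := exists_mono_comp_eq_zero e
  obtain ⟨α, rfl⟩ := Ext.covariant_sequence_exact₁ _ (shortExact_of_mono k) e hek rfl
  obtain ⟨V, f, hf⟩ := h.exists_efface_family hθ hfg α
  obtain ⟨V₁, e₁, _, g, hg⟩ := exists_linear_lift hX (shortExact_of_mono k) f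
  obtain ⟨E₂, k₂, _, V₂, e₂, _, g₂, hg₂⟩ := hC (N := R) (RingHom.ker θ).subtype
    (Submodule.subtype_injective _) g
  let κ : cokernel k ⟶ cokernel (k ≫ k₂) := cokernel.map _ _ (𝟙 X) k₂ (by simp)
  have hκ : cokernel.π k ≫ κ = k₂ ≫ cokernel.π (k ≫ k₂) := by simp [κ]
  obtain ⟨Z', z, hz, h0⟩ := hf κ (e₂ ≫ e₁) inferInstance (g₂ 1 ≫ cokernel.π (k ≫ k₂)) fun r => by
    rw [← Linear.smul_comp, ← map_smul]
    have h1 : g₂ ((r : R) • (1 : R)) = e₂ ≫ g r ≫ k₂ := by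
      rw [← hg₂]
      simp
    rw [h1, Category.assoc, Category.assoc, ← hκ, reassoc_of% (hg r), Category.assoc]
  refine ⟨Z', z, hz, ?_⟩
  have h2 := extClass_pullback (shortExact_of_mono k) (shortExact_of_mono (k ≫ k₂)) k₂ κ rfl hκ.symm
  have h3 : α.comp (shortExact_of_mono k).extClass rfl =
      (α.comp (Ext.mk₀ κ) (add_zero 1)).comp (shortExact_of_mono (k ≫ k₂)).extClass rfl := by
    rw [h2, Ext.comp_assoc_of_second_deg_zero]
  rw [h3, ← Ext.comp_assoc (a₁₂ := 1) _ _ _ (by lia) (by lia) (by lia), h0, Ext.zero_comp]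

end IsDeformation

/-! ### Extension groups along an exact left adjoint -/

section Adjunction

variable {C₀ : Type u₁} [Category.{v₁} C₀] [Abelian C₀] {C : Type u₂} [Category.{v₂} C] [Abelian C]
  {G : C₀ ⥤ C} {F : C ⥤ C₀} [G.Additive] [PreservesFiniteLimits G] [PreservesFiniteColimits G]
  [HasExt.{w} C₀] [HasExt.{w₁} C] (adj : G ⊣ F)

/-- The map `Extⁿ(Z, F X) → Extⁿ(G Z, X)` induced by an adjunction `G ⊣ F` with `G` exact. -/
noncomputable def extTranspose (Z : C₀) (X : C) (n : ℕ) :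
    Ext.{w} Z (F.obj X) n →+ Ext.{w₁} (G.obj Z) X n where
  toFun e := (e.mapExactFunctor G).comp (Ext.mk₀ (adj.counit.app X)) (add_zero n)
  map_zero' := by simp
  map_add' := by simp

theorem extTranspose_apply {Z : C₀} {X : C} {n : ℕ} (e : Ext.{w} Z (F.obj X) n) :
    extTranspose.{w, w₁} adj Z X n e =
      (e.mapExactFunctor G).comp (Ext.mk₀ (adj.counit.app X)) (add_zero n) := rfl

theorem extTranspose_comp {Z Z' : C₀} {X : C} {m n l : ℕ} (a : Ext.{w} Z' Z m)
    (e : Ext.{w} Z (F.obj X) n) (hl : m + n = l) :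
    extTranspose.{w, w₁} adj Z' X l (a.comp e hl) =
      (a.mapExactFunctor G).comp (extTranspose.{w, w₁} adj Z X n e) hl := by
  rw [extTranspose_apply, extTranspose_apply, Ext.mapExactFunctor_comp,
    Ext.comp_assoc_of_third_deg_zero]

theorem extTranspose_bijective_zero (Z : C₀) (X : C) :
    Function.Bijective (extTranspose.{w, w₁} adj Z X 0) := by
  have h (f : Z ⟶ F.obj X) : extTranspose.{w, w₁} adj Z X 0 (Ext.mk₀ f) =
      Ext.mk₀ ((adj.homEquiv _ _).symm f) := by
    rw [extTranspose_apply, Ext.mapExactFunctor_mk₀, Ext.mk₀_comp_mk₀, Adjunction.homEquiv_counit]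
  refine ⟨fun a b hab => ?_, fun e => ?_⟩
  · obtain ⟨f, rfl⟩ := (Ext.mk₀_bijective _ _).2 a
    obtain ⟨g, rfl⟩ := (Ext.mk₀_bijective _ _).2 b
    rw [h, h] at hab
    rw [(adj.homEquiv _ _).symm.injective ((Ext.mk₀_bijective _ _).1 hab)]
  · obtain ⟨f, rfl⟩ := (Ext.mk₀_bijective _ _).2 e
    obtain ⟨g, rfl⟩ := (adj.homEquiv _ _).symm.surjective f
    exact ⟨Ext.mk₀ g, h g⟩

/-- Both sides are connected sequences of functors in `Z`. A class killed by an epimorphism `z`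
comes from degree `n` on the kernel of `z`, where the transpose is bijective. Injectivity uses the
epimorphisms of `C₀` that kill classes of `C₀`; surjectivity needs `heff`. -/
theorem extTranspose_bijective_succ {X : C} {n : ℕ}
    (hn : ∀ Z, Function.Bijective (extTranspose.{w, w₁} adj Z X n))
    (heff : ∀ {Z : C₀} (e : Ext.{w₁} (G.obj Z) X (n + 1)),
      ∃ (Z' : C₀) (z : Z' ⟶ Z) (_ : Epi z), (Ext.mk₀ (G.map z)).comp e (zero_add _) = 0) (Z : C₀) :
    Function.Bijective (extTranspose.{w, w₁} adj Z X (n + 1)) := by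
  constructor
  · rw [injective_iff_map_eq_zero]
    intro e he
    obtain ⟨Z', z, hz, h0⟩ := exists_epi_comp_eq_zero e
    have hS := shortExact_of_epi z
    obtain ⟨y, rfl⟩ := Ext.contravariant_sequence_exact₃ hS _ e h0 (add_comm 1 n)
    rw [extTranspose_comp, Ext.mapExactFunctor_extClass] at he
    obtain ⟨x, hx⟩ := Ext.contravariant_sequence_exact₁ (hS.map_of_exact G) X _ _ he
    obtain ⟨x, rfl⟩ := (hn _).2 x
    have h1 : (Ext.mk₀ (kernel.ι z)).comp x (zero_add n) = y := by
      apply (hn _).1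
      rw [extTranspose_comp, Ext.mapExactFunctor_mk₀]
      exact hx
    rw [← h1]
    exact hS.extClass_comp_assoc x
  · intro e
    obtain ⟨Z', z, hz, h0⟩ := heff e
    have hS := shortExact_of_epi z
    obtain ⟨y, rfl⟩ := Ext.contravariant_sequence_exact₃ (hS.map_of_exact G) X e h0 (add_comm 1 n)
    obtain ⟨x, rfl⟩ := (hn _).2 y
    refine ⟨hS.extClass.comp x (add_comm 1 n), ?_⟩
    rw [extTranspose_comp, Ext.mapExactFunctor_extClass]
    rfl

end Adjunction

/-! ### `RHom_S(M, X)` for coflat `X` -/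

section Comparison

variable {S : Type u} [CommRing S] {C : Type u₁} [Category.{v₁} C] [Abelian C] [Linear S C]

theorem IsCoflat.exact_homMap [IsCoherentRing S] {X : C} (hX : IsCoflat S X) {M N L : Type u}
    [AddCommGroup M] [AddCommGroup N] [AddCommGroup L] [Module S M] [Module S N] [Module S L]
    [Module.FinitePresentation S M] [Module.FinitePresentation S N]
    [Module.FinitePresentation S L] (f : M →ₗ[S] N) (g : N →ₗ[S] L) (hfg : Function.Exact f g) :
    (ShortComplex.mk (homMap S X g) (homMap S X f)
      (by rw [homMap_comp, hfg.linearMap_comp_eq_zero, homMap_zero])).Exact := by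
  rw [ShortComplex.exact_iff_exact_up_to_refinements]
  intro T x hx
  dsimp at x hx
  obtain ⟨T', e, he, y, hy⟩ := hX.exists_factor f g hfg (Linear.leftComp S X x ∘ₗ homEv S N X)
    fun m => by
      have h1 : (x ≫ homMap S X f) ≫ homEv S M X m = 0 := by rw [hx, zero_comp]
      rw [Category.assoc, homMap_ev] at h1
      exact h1
  refine ⟨T', e, he, homLift S y, homObj_ext S fun n => ?_⟩
  simp [hy]

theorem mono_homMap {X : C} {M N : Type u} [AddCommGroup M] [AddCommGroup N] [Module S M]
    [Module S N] [Module.FinitePresentation S M] [Module.FinitePresentation S N] (f : M →ₗ[S] N)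
    (hf : Function.Surjective f) : Mono (homMap S X f) where
  right_cancellation a b h := homObj_ext S fun n => by
    obtain ⟨m, rfl⟩ := hf n
    rw [← homMap_ev, reassoc_of% h]

theorem exact_of_isos {A B D A' B' D' : C} {f : A ⟶ B} {g : B ⟶ D} {z : f ≫ g = 0} {f' : A' ⟶ B'}
    {g' : B' ⟶ D'} {z' : f' ≫ g' = 0} (h : (ShortComplex.mk f g z).Exact) (e₁ : A ≅ A')
    (e₂ : B ≅ B') (e₃ : D ≅ D') (h₁ : e₁.hom ≫ f' = f ≫ e₂.hom) (h₂ : e₂.hom ≫ g' = g ≫ e₃.hom) :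
    (ShortComplex.mk f' g' z').Exact :=
  (ShortComplex.exact_iff_of_iso (S₁ := ShortComplex.mk f g z) (S₂ := ShortComplex.mk f' g' z')
    (ShortComplex.isoMk e₁ e₂ e₃ h₁ h₂)).1 h

theorem quasiIso_mkHomFromSingle {K : CochainComplex C ℤ} {A : C} (f : A ⟶ K.X 0)
    (hf : ∀ k, (ComplexShape.up ℤ).Rel 0 k → f ≫ K.d 0 k = 0)
    (hK : ∀ i, i ≠ 0 → K.ExactAt i) (hd : K.d (-1) 0 = 0) [Mono f]
    (hex : (ShortComplex.mk f (K.d 0 1) (hf 1 rfl)).Exact) :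
    QuasiIso (HomologicalComplex.mkHomFromSingle f hf) := by
  refine ⟨fun i => ?_⟩
  by_cases hi : i = 0
  · subst hi
    rw [quasiIsoAt_iff' _ (-1) 0 1 (by simp) (by simp), ShortComplex.quasiIso_iff_of_zeros]
    · have h1 : (HomologicalComplex.mkHomFromSingle f hf).f 0 =
          (HomologicalComplex.singleObjXSelf (ComplexShape.up ℤ) 0 A).hom ≫ f :=
        HomologicalComplex.mkHomFromSingle_f f hf
      constructor
      · have h2 : (HomologicalComplex.mkHomFromSingle f hf).f 0 ≫ K.d 0 1 = 0 :=
          (congrArg (· ≫ K.d 0 1) h1).trans (by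
            rw [Category.assoc, hf 1 rfl, comp_zero])
        have h3 : (ShortComplex.mk _ (K.d 0 1) h2).Exact :=
          exact_of_isos hex (HomologicalComplex.singleObjXSelf (ComplexShape.up ℤ) 0 A).symm
            (Iso.refl _) (Iso.refl _)
            (by rw [h1, Iso.symm_hom, Iso.inv_hom_id_assoc]; exact (Category.comp_id _).symm)
            ((Category.id_comp _).trans (Category.comp_id _).symm)
        exact h3
      · have : Mono ((HomologicalComplex.singleObjXSelf (ComplexShape.up ℤ) 0 A).hom ≫ f) :=
          mono_comp _ _
        rw [← h1] at this
        exact this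
    · exact HomologicalComplex.single_obj_d (ComplexShape.up ℤ) _ _ _ _
    · exact HomologicalComplex.single_obj_d (ComplexShape.up ℤ) _ _ _ _
    · exact hd
  · rw [quasiIsoAt_iff_exactAt _ _ (HomologicalComplex.exactAt_single_obj _ _ _ _ hi)]
    exact hK i hi

variable {M : Type u} [AddCommGroup M] [Module S M] [Module.FinitePresentation S M]
  (P : ProjectiveResolution (ModuleCat.of S M)) [∀ n, Module.FinitePresentation S (P.complex.X n)]

theorem augmentation_surjective : Function.Surjective (augmentation P) :=
  (ModuleCat.epi_iff_surjective (P.π.f 0)).1 inferInstance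

theorem exact_augmentation : Function.Exact (P.complex.d 1 0).hom (augmentation P) :=
  (ShortComplex.ShortExact.moduleCat_exact_iff_function_exact _).1 P.exact₀

theorem exact_resolution (n : ℕ) :
    Function.Exact (P.complex.d (n + 2) (n + 1)).hom (P.complex.d (n + 1) n).hom :=
  (ShortComplex.ShortExact.moduleCat_exact_iff_function_exact _).1 (P.exact_succ n)

theorem homComplex_d (X : C) (n : ℕ) : (homComplex P.complex X).d n (n + 1) =
    homMap S X (P.complex.d (n + 1) n).hom :=
  CochainComplex.of_d (fun n => homObj S (P.complex.X n) X)
    (fun n => homMap S X (P.complex.d (n + 1) n).hom) n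

theorem homComplex_exactAt [IsCoherentRing S] {X : C} (hX : IsCoflat S X) (n : ℕ) :
    (homComplex P.complex X).ExactAt (n + 1) := by
  rw [HomologicalComplex.exactAt_iff' _ n (n + 1) (n + 2) (by simp) (by simp)]
  have h : (ShortComplex.mk _ _ ((homComplex P.complex X).d_comp_d n (n + 1) (n + 2))).Exact :=
    exact_of_isos (hX.exact_homMap _ _ (exact_resolution P n)) (Iso.refl _) (Iso.refl _)
      (Iso.refl _) ((Category.id_comp _).trans
        ((homComplex_d P X n).trans (Category.comp_id _).symm))
      ((Category.id_comp _).trans ((homComplex_d P X (n + 1)).trans (Category.comp_id _).symm))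
  exact h

theorem exact_coaugmentation [HasDerivedCategory.{w} C] [IsCoherentRing S] {X : C}
    (hX : IsCoflat S X) :
    (ShortComplex.mk (coaugmentation P X) ((homComplex P.complex X).d 0 1)
      (coaugmentation_comp_d P X)).Exact :=
  exact_of_isos (hX.exact_homMap _ _ (exact_augmentation P)) (Iso.refl _) (Iso.refl _)
    (Iso.refl _) ((Category.id_comp _).trans (Category.comp_id _).symm)
    ((Category.id_comp _).trans ((homComplex_d P X 0).trans (Category.comp_id _).symm))

instance mono_coaugmentation (X : C) : Mono (coaugmentation P X) :=
  mono_homMap _ (augmentation_surjective P)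

/-- `Hom_S(-, X)` is exact for coflat `X`, so it turns the augmented resolution of `M` into an exact
sequence: the complex `Hom_S(P_•, X)` has cohomology `Hom_S(M, X)` in degree 0 and none elsewhere.
-/
theorem isIso_toRHom [HasDerivedCategory.{w, v₁, u₁} C] [IsCoherentRing S] {X : C}
    (hX : IsCoflat S X) :
    IsIso (toRHom.{u, w} P X) := by
  refine @IsIso.comp_isIso _ _ _ _ _ _ _ inferInstance ?_
  refine (DerivedCategory.isIso_Q_map_iff_quasiIso C _).2 ?_
  let e₀ := (homComplex P.complex X).extendXIso ComplexShape.embeddingUpNat (i := 0) (i' := 0) rfl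
  let e₁ := (homComplex P.complex X).extendXIso ComplexShape.embeddingUpNat (i := 1) (i' := 1) rfl
  refine quasiIso_mkHomFromSingle _ _ (fun i hi => ?_) ?_ ?_
  · obtain hi | hi := lt_or_gt_of_ne hi
    · refine (homComplex P.complex X).extend_exactAt _ _ fun j => ?_
      simp
      lia
    · obtain ⟨n, rfl⟩ : ∃ n : ℕ, i = (n + 1 : ℕ) := ⟨(i - 1).toNat, by lia⟩
      exact ((homComplex P.complex X).extend_exactAt_iff ComplexShape.embeddingUpNat
        (j := n + 1) rfl).2 (homComplex_exactAt P hX n)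
  · exact (homComplex P.complex X).extend_d_to_eq_zero _ _ _ 0 rfl (by simp)
  · refine exact_of_isos (exact_coaugmentation P hX) (Iso.refl _) e₀.symm e₁.symm ?_ ?_
    · simp [e₀]
    · simp [(homComplex P.complex X).extend_d_eq ComplexShape.embeddingUpNat
        (i := 0) (j := 1) (i' := 0) (j' := 1) rfl rfl, e₀, e₁]

theorem toExt_bijective [HasDerivedCategory.{w} C] [HasExt.{w₁} C] [IsCoherentRing S] {X : C}
    (hX : IsCoflat S X) (n : ℕ) :
    Function.Bijective (HRHom.toExt.{u, w, w₁} P X : HRHom P X n → _) := by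
  have := isIso_toRHom P hX
  refine Ext.homEquiv.symm.bijective.comp ⟨fun a b h => ?_, fun b => ⟨inv (toRHom P X) ≫ b, ?_⟩⟩
  · exact (cancel_epi (toRHom P X)).1 h
  · exact IsIso.hom_inv_id_assoc _ _

/-- The comparison map `Hⁿ RHom_C(RHom_S(M, X), X) → Extⁿ_C(Hom_S(M, X), X)` is additive. -/
noncomputable def HRHom.toExtHom [HasDerivedCategory.{w} C] [HasExt.{w₁} C] (X : C) (n : ℕ) :
    HRHom P X n →+ Ext.{w₁} (homObj S M X) X n where
  toFun := HRHom.toExt P X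
  map_zero' := (congrArg _ comp_zero).trans (map_zero Ext.homAddEquiv.symm)
  map_add' _ _ := (congrArg _ (Preadditive.comp_add _ _ _ _ _ _)).trans
    (map_add Ext.homAddEquiv.symm _ _)

end Comparison

/-! ### Bijectivity of `Ψ¹` and `Ψ²` -/

namespace DeformationTower

variable {Rbar R S : Type u} [CommRing Rbar] [CommRing R] [CommRing S]
  [IsCoherentRing Rbar] [IsCoherentRing R] [IsCoherentRing S] {T : RingTower Rbar R S}
  {C₀ : Type u₁} [Category.{v₁} C₀] [Abelian C₀] [Linear S C₀]
  {C : Type u₂} [Category.{v₂} C] [Abelian C] [Linear R C]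
  {Cbar : Type u₃} [Category.{v₃} Cbar] [Abelian Cbar] [Linear Rbar Cbar]
  [HasDerivedCategory.{w} C₀] [HasExt.{w₁} C₀] [HasExt.{w₂} C]
  (𝒟 : DeformationTower T C₀ C Cbar) (P : ProjectiveResolution (ModuleCat.of S T.J))
  [∀ n, Module.FinitePresentation S (P.complex.X n)] {X : C}

variable (X) in
/-- The map from `Hⁿ RHom_{C₀}(RHom_S(J, Y), Y)` to `Extⁿ_C(Hom_R(J, X), X)` as a homomorphism. -/
noncomputable def toExtHom (n : ℕ) :
    𝒟.H X P n →+ Ext.{w₂} (𝒟.G₀.obj (𝒟.homJ X)) X n :=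
  (extTranspose 𝒟.adj₀ (𝒟.homJ X) X n).comp
    (HRHom.toExtHom P (𝒟.F₀.obj X) n : _ →+ Ext.{w₁} (𝒟.homJ X) (𝒟.F₀.obj X) n)

theorem extTranspose_bijective_one (hX : IsCoflat R X) (Z : C₀) :
    Function.Bijective (extTranspose.{w₁, w₂} 𝒟.adj₀ Z X 1) :=
  extTranspose_bijective_succ _ (fun Z => extTranspose_bijective_zero _ Z X)
    (fun e => 𝒟.isFlatDeformation₀.exists_efface_one T.ψ_surjective T.ψ_fg hX e) Z

theorem extTranspose_bijective_two (hX : IsCoflat R X) (Z : C₀) :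
    Function.Bijective (extTranspose.{w₁, w₂} 𝒟.adj₀ Z X 2) :=
  extTranspose_bijective_succ _ (𝒟.extTranspose_bijective_one hX)
    (fun e => 𝒟.isFlatDeformation₀.exists_efface_two T.ψ_surjective T.ψ_fg
      𝒟.isFlatDeformation₀.flat.hasExtensions hX e) Z

theorem toExtHom_bijective_one (hX : IsCoflat R X) :
    Function.Bijective (𝒟.toExtHom P X 1) :=
  (𝒟.extTranspose_bijective_one hX _).comp (toExt_bijective P
    (𝒟.isFlatDeformation₀.isCoflat_rightAdjoint T.ψ_surjective T.ψ_fg 𝒟.adj₀ hX) 1)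

theorem toExtHom_bijective_two (hX : IsCoflat R X) :
    Function.Bijective (𝒟.toExtHom P X 2) :=
  (𝒟.extTranspose_bijective_two hX _).comp (toExt_bijective P
    (𝒟.isFlatDeformation₀.isCoflat_rightAdjoint T.ψ_surjective T.ψ_fg 𝒟.adj₀ hX) 2)

end DeformationTower

theorem exists_linearMap_comp_eq {A : Type u} [Ring A] {M : Type w} {N : Type w₁} {B : Type w₂}
    [AddCommGroup M] [AddCommGroup N] [AddCommGroup B] [Module A M] [Module A N] [Module A B]
    (p : M →ₗ[A] N) (hp : Function.Surjective p) (f : M →ₗ[A] B) (hf : ∀ m, p m = 0 → f m = 0) :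
    ∃ g : N →ₗ[A] B, ∀ m, g (p m) = f m := by
  refine ⟨(LinearMap.ker p).liftQ f (fun m hm => hf m hm) ∘ₗ
    (p.quotKerEquivOfSurjective hp).symm.toLinearMap, fun m => ?_⟩
  have : (p.quotKerEquivOfSurjective hp).symm (p m) = Submodule.Quotient.mk m := by
    rw [LinearEquiv.symm_apply_eq]; rfl
  rw [LinearMap.comp_apply, LinearEquiv.coe_coe, this]
  rfl

/-! ### A local criterion for coflatness over a square-zero extension -/

namespace IsDeformation

variable {R S : Type u} [CommRing R] [CommRing S] {θ : R →+* S} [IsCoherentRing R]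
  {C₀ : Type u₁} [Category.{v₁} C₀] [Abelian C₀] [Linear S C₀]
  {C : Type u₂} [Category.{v₂} C] [Abelian C] [Linear R C] {G : C₀ ⥤ C} {F : C ⥤ C₀}

/-- The case of a submodule `K` containing `(ker θ)ⁿ`. Hypothesis `H` gives a family on the free
module that agrees with `f` on `(ker θ)ⁿ`. The difference is a family on the image of `K` in `Sⁿ`,
which coflatness of `F.obj L` over `S` extends to `Sⁿ`. -/
theorem exists_extension_of_pi [IsCoherentRing S] (h : IsDeformation θ G)
    (hθ : Function.Surjective θ) (hfg : (RingHom.ker θ).FG)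
    (hsq : ∀ a b, θ a = 0 → θ b = 0 → a * b = 0) (adj : G ⊣ F) {L : C}
    (hL : IsCoflat S (F.obj L))
    (H : ∀ {n : ℕ} {V : C} (x : Fin n → (RingHom.ker θ →ₗ[R] (V ⟶ L))),
      (∀ j (a b : RingHom.ker θ), (a : R) • x j b = 0) → ∃ (V' : C) (e : V' ⟶ V) (_ : Epi e)
        (l : Fin n → (V' ⟶ L)), ∀ j (a : RingHom.ker θ), (a : R) • l j = e ≫ x j a)
    {n : ℕ} (K : Submodule R (Fin n → R)) (hK : K.FG) (hKθ : ∀ v, (∀ j, θ (v j) = 0) → v ∈ K)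
    {V : C} (f : K →ₗ[R] (V ⟶ L)) :
    ∃ (V' : C) (e : V' ⟶ V) (_ : Epi e) (g : (Fin n → R) →ₗ[R] (V' ⟶ L)),
      ∀ v : K, g v = e ≫ f v := by
  have := h.linear.additive
  have := h.preservesFiniteColimits hθ hfg
  have hs (j : Fin n) (a : RingHom.ker θ) : (Pi.single j (a : R) : Fin n → R) ∈ K :=
    hKθ _ fun k => by
      rcases eq_or_ne k j with rfl | hk
      · rw [Pi.single_eq_same]
        exact a.2
      · simp [hk]
  obtain ⟨V₁, e₁, _, l, hl⟩ := H (fun j => f ∘ₗ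
    ((LinearMap.single R (fun _ : Fin n => R) j ∘ₗ (RingHom.ker θ).subtype).codRestrict K
      (hs j))) fun j a b => by
    rw [← map_smul]
    refine (congrArg _ ?_).trans (map_zero _)
    exact Subtype.ext (hsq a b a.2 b.2)
  have hl' (j) (a : RingHom.ker θ) : (a : R) • l j = e₁ ≫ f ⟨Pi.single j (a : R), hs j a⟩ := hl j a
  let g₁ : (Fin n → R) →ₗ[R] (V₁ ⟶ L) := Fintype.linearCombination R l
  let f₁ : K →ₗ[R] (V₁ ⟶ L) := Linear.leftComp R L e₁ ∘ₗ f - g₁ ∘ₗ K.subtype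
  have hf₁ (v : K) : e₁ ≫ f v = g₁ v + f₁ v := by simp [f₁]
  have h0 (v : K) (hv : ∀ j, θ ((v : Fin n → R) j) = 0) : f₁ v = 0 := by
    have hv' : v = ∑ j, ⟨Pi.single j ((v : Fin n → R) j), hs j ⟨_, hv j⟩⟩ := by
      apply Subtype.ext
      rw [Submodule.coe_sum]
      exact (Finset.univ_sum_single _).symm
    have h1 : e₁ ≫ f v = g₁ v := by
      conv_lhs => rw [hv', map_sum, Preadditive.comp_sum]
      rw [Fintype.linearCombination_apply]
      exact Finset.sum_congr rfl fun j _ => (hl' j ⟨_, hv j⟩).symm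
    rwa [hf₁, add_eq_left] at h1
  have : RingHomSurjective θ := ⟨hθ⟩
  let Θ : (Fin n → R) →ₛₗ[θ] (Fin n → S) :=
    { toFun v j := θ (v j)
      map_add' a b := by ext; simp
      map_smul' r a := by ext; simp }
  have hM : Module.FinitePresentation S (K.map Θ) := finitePresentation_of_fg _ (hK.map Θ)
  have hch (m : K.map Θ) : ∃ v : K, Θ v = m := by
    obtain ⟨v, hv, hm⟩ := m.2
    exact ⟨⟨v, hv⟩, hm⟩
  choose c hc using hch
  have hcf (m : K.map Θ) (v : K) (hv : Θ v = m) : f₁ (c m) = f₁ v := by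
    rw [← sub_eq_zero, ← map_sub]
    refine h0 _ fun j => ?_
    have h1 := congrFun ((hc m).trans hv.symm) j
    change θ ((c m : Fin n → R) j - (v : Fin n → R) j) = 0
    rw [map_sub, sub_eq_zero]
    exact h1
  obtain ⟨Z, q, _, hq⟩ := h.exists_quotient hθ hfg V₁
  obtain ⟨y, hy⟩ := h.exists_linear_family hθ adj (N := K.map Θ) q (fun m => f₁ (c m))
    (fun a b => by
      rw [← map_add]
      exact hcf _ _ (by rw [Submodule.coe_add, map_add, hc, hc, Submodule.coe_add]))
    (fun r a => by
      rw [← map_smul]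
      exact hcf _ _ (by rw [Submodule.coe_smul, map_smulₛₗ, hc, Submodule.coe_smul]))
    (fun m => hq _ fun r hr => by
      rw [← map_smul]
      refine h0 _ fun j => ?_
      rw [Submodule.coe_smul, Pi.smul_apply, smul_eq_mul, map_mul, hr, zero_mul])
  obtain ⟨Z', e', _, g', hg'⟩ :=
    hL.exists_extension (K.map Θ).subtype (Submodule.subtype_injective _) y
  let g₂ : (Fin n → R) →ₗ[R] (pullback q (G.map e') ⟶ L) :=
    { toFun v := pullback.snd _ _ ≫ G.map (g' (Θ v)) ≫ adj.counit.app L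
      map_add' a b := by simp
      map_smul' r a := by
        rw [map_smulₛₗ, map_smul, h.linear.map_smul]
        simp }
  refine ⟨_, pullback.fst q (G.map e') ≫ e₁, epi_comp _ _,
    Linear.leftComp R L (pullback.fst q (G.map e')) ∘ₗ g₁ + g₂, fun v => ?_⟩
  have h2 : Θ v ∈ K.map Θ := ⟨v, v.2, rfl⟩
  have h1 : g' (Θ v) = e' ≫ y ⟨Θ v, h2⟩ := hg' ⟨Θ v, h2⟩
  have h3 : g₂ v = pullback.fst q (G.map e') ≫ f₁ v := by
    rw [← hcf ⟨Θ v, h2⟩ v rfl, ← hy]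
    simp only [g₂, LinearMap.coe_mk, AddHom.coe_mk]
    rw [h1, G.map_comp, Category.assoc, pullback.condition_assoc]
  rw [LinearMap.add_apply, h3, Category.assoc, hf₁, Preadditive.comp_add]
  rfl

/-- A local criterion for coflatness over a square-zero extension. -/
theorem isCoflat_of_isCoflat_rightAdjoint [IsCoherentRing S] (h : IsDeformation θ G)
    (hθ : Function.Surjective θ) (hfg : (RingHom.ker θ).FG)
    (hsq : ∀ a b, θ a = 0 → θ b = 0 → a * b = 0) (adj : G ⊣ F) {L : C}
    (hL : IsCoflat S (F.obj L))
    (H : ∀ {n : ℕ} {V : C} (x : Fin n → (RingHom.ker θ →ₗ[R] (V ⟶ L))),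
      (∀ j (a b : RingHom.ker θ), (a : R) • x j b = 0) → ∃ (V' : C) (e : V' ⟶ V) (_ : Epi e)
        (l : Fin n → (V' ⟶ L)), ∀ j (a : RingHom.ker θ), (a : R) • l j = e ≫ x j a) :
    IsCoflat R L := by
  have key {M N : Type u} [AddCommGroup M] [AddCommGroup N] [Module R M] [Module R N]
      [Module.FinitePresentation R M] [Module.FinitePresentation R N]
      (i : M →ₗ[R] N) (hi : Function.Injective i)
      (hN : ∀ a, θ a = 0 → ∀ x : N, ∃ m, i m = a • x) {V : C} (f : M →ₗ[R] (V ⟶ L)) :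
      ∃ (V' : C) (e : V' ⟶ V) (_ : Epi e) (g : N →ₗ[R] (V' ⟶ L)), ∀ m, g (i m) = e ≫ f m := by
    have : Module.FinitePresentation R (N ⧸ LinearMap.range i) :=
      Module.finitePresentation_of_surjective (LinearMap.range i).mkQ (Submodule.mkQ_surjective _)
        (by
          rw [Submodule.ker_mkQ, LinearMap.range_eq_map]
          exact Submodule.FG.map i Module.Finite.fg_top)
    obtain ⟨n, π, hπ⟩ := Module.Finite.exists_fin' R (N ⧸ LinearMap.range i)
    obtain ⟨s, hs⟩ := Module.projective_lifting_property (LinearMap.range i).mkQ π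
      (Submodule.mkQ_surjective _)
    have hπs (v) : π v = (LinearMap.range i).mkQ (s v) := (LinearMap.congr_fun hs v).symm
    have hsi (v : LinearMap.ker π) : s v ∈ LinearMap.range i := by
      have h1 : π v = 0 := v.2
      rw [hπs, Submodule.mkQ_apply, Submodule.Quotient.mk_eq_zero] at h1
      exact h1
    let t : LinearMap.ker π →ₗ[R] M := (LinearEquiv.ofInjective i hi).symm.toLinearMap ∘ₗ
      (s ∘ₗ (LinearMap.ker π).subtype).codRestrict (LinearMap.range i) hsi
    have ht (v : LinearMap.ker π) : i (t v) = s v := by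
      have h1 := (LinearEquiv.ofInjective i hi).apply_symm_apply ⟨s v, hsi v⟩
      exact congrArg Subtype.val h1
    -- Here `ker π` is the preimage of `M` under the lift `s : Rⁿ → N`, and it contains `(ker θ)ⁿ`
    -- because `ker θ` maps `N` into `M`. The family extended to `Rⁿ` is then glued with `f` along
    -- the surjection from `M × Rⁿ` to `N`.
    obtain ⟨V', e, he, g, hg⟩ := h.exists_extension_of_pi hθ hfg hsq adj hL H (LinearMap.ker π)
      (Module.FinitePresentation.fg_ker π hπ) (fun v hv => by
        rw [LinearMap.mem_ker, hπs, Submodule.mkQ_apply,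
          Submodule.Quotient.mk_eq_zero, ← Finset.univ_sum_single v, map_sum]
        refine Submodule.sum_mem _ fun j _ => ?_
        obtain ⟨m, hm⟩ := hN (v j) (hv j) (s (Pi.single j 1))
        refine ⟨m, ?_⟩
        rw [hm, ← map_smul, ← Pi.single_smul, smul_eq_mul, mul_one]) (f ∘ₗ t)
    obtain ⟨g', hg'⟩ := exists_linearMap_comp_eq (i.coprod s) (fun x => by
        obtain ⟨v, hv⟩ := hπ (Submodule.Quotient.mk x)
        rw [hπs, Submodule.mkQ_apply, Submodule.Quotient.eq] at hv
        obtain ⟨m, hm⟩ := hv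
        refine ⟨(-m, v), ?_⟩
        simp [hm]) ((Linear.leftComp R L e ∘ₗ f).coprod g) (fun ⟨m, v⟩ hmv => by
        rw [LinearMap.coprod_apply] at hmv ⊢
        have hv : v ∈ LinearMap.ker π := by
          rw [LinearMap.mem_ker, hπs, Submodule.mkQ_apply,
            Submodule.Quotient.mk_eq_zero]
          exact ⟨-m, by rw [map_neg, neg_eq_iff_add_eq_zero]; exact hmv⟩
        have h1 : m = - t ⟨v, hv⟩ := by
          apply hi
          rw [map_neg, ht]
          exact eq_neg_of_add_eq_zero_left hmv
        have h2 := hg ⟨v, hv⟩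
        dsimp only at h2
        rw [h2, h1]
        simp)
    refine ⟨V', e, he, g', fun m => ?_⟩
    have h1 := hg' (m, 0)
    simpa using h1
  refine isCoflat_of_exists_extension fun M N _ _ _ _ _ _ i hi V f => ?_
  -- An arbitrary inclusion is split into two steps in which `ker θ` carries the larger module into
  -- the smaller one: on `M + (ker θ) N` this holds because `ker θ` has square zero, and from there
  -- to `N` by construction.
  let N' : Submodule R N := LinearMap.range i ⊔ RingHom.ker θ • ⊤
  have : Module.FinitePresentation R N' := finitePresentation_of_fg _ (Submodule.FG.sup
    (by
      rw [LinearMap.range_eq_map]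
      exact Submodule.FG.map i Module.Finite.fg_top)
    (Submodule.FG.smul hfg Module.Finite.fg_top))
  obtain ⟨V₁, e₁, _, g₁, hg₁⟩ := key (i.codRestrict N' fun m => le_sup_left (a := LinearMap.range i)
    ⟨m, rfl⟩) (fun a b hab => hi (congrArg Subtype.val hab)) (fun a ha ⟨x, hx⟩ => by
      obtain ⟨_, ⟨m, rfl⟩, y, hy, rfl⟩ := Submodule.mem_sup.1 hx
      refine ⟨a • m, Subtype.ext ?_⟩
      have h0 : a • y = 0 := by
        refine Submodule.smul_induction_on hy (fun r hr n _ => ?_) fun b c hb hc => ?_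
        · rw [smul_smul, hsq a r ha hr, zero_smul]
        · rw [smul_add, hb, hc, add_zero]
      change i (a • m) = a • (i m + y)
      rw [smul_add, h0, add_zero, map_smul]) f
  obtain ⟨V₂, e₂, _, g₂, hg₂⟩ := key N'.subtype (Submodule.subtype_injective _) (fun a ha x =>
    ⟨⟨a • x, le_sup_right (a := LinearMap.range i) (Submodule.smul_mem_smul ha trivial)⟩, rfl⟩) g₁
  refine ⟨V₂, e₂ ≫ e₁, inferInstance, g₂, fun m => ?_⟩
  rw [Category.assoc, ← hg₁, ← hg₂]
  rfl

end IsDeformation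

/-! ### Lifts as extensions with prescribed action of `J` -/

namespace DeformationTower

variable {Rbar R S : Type u} [CommRing Rbar] [CommRing R] [CommRing S] {T : RingTower Rbar R S}
  {C₀ : Type u₁} [Category.{v₁} C₀] [Abelian C₀] [Linear S C₀]
  {C : Type u₂} [Category.{v₂} C] [Abelian C] [Linear R C]
  {Cbar : Type u₃} [Category.{v₃} Cbar] [Abelian Cbar] [Linear Rbar Cbar]
  (𝒟 : DeformationTower T C₀ C Cbar)

theorem _root_.CoflatLift.RingTower.mul_eq_zero (T : RingTower Rbar R S) (a b : Rbar)
    (ha : T.φ a = 0) (hb : T.φ b = 0) : a * b = 0 := by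
  have h : a * b ∈ RingHom.ker (T.ψ.comp T.φ) * RingHom.ker T.φ :=
    Ideal.mul_mem_mul (by simp [RingHom.mem_ker, ha]) hb
  rwa [T.mul_eq_bot] at h

instance [IsCoherentRing Rbar] : Module.FinitePresentation Rbar T.J :=
  IsCoherentRing.finitePresentation_of_fg _ T.φ_fg

variable (T) in
/-- The inclusion of `J` as a linear map. -/
def _root_.CoflatLift.RingTower.valHom : T.J →ₗ[Rbar] Rbar := (RingHom.ker T.φ).subtype

theorem _root_.CoflatLift.RingTower.valHom_injective : Function.Injective T.valHom :=
  Submodule.subtype_injective _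

theorem J_smul_smul (a b : T.J) {W L : Cbar} (f : W ⟶ L) : a.val • b.val • f = 0 := by
  rw [smul_smul, T.mul_eq_zero a.val b.val a.2 b.2, zero_smul]

variable [IsCoherentRing Rbar] {X : C}

/-- The evaluation maps as a linear family of morphisms in `Cbar`. -/
noncomputable def evFamily {L : Cbar} (i : 𝒟.G.obj X ⟶ L) :
    T.J →ₗ[Rbar] (𝒟.G.obj (𝒟.G₀.obj (𝒟.homJ X)) ⟶ L) where
  toFun a := 𝒟.G.map (𝒟.evJ X a) ≫ i
  map_add' a b := by rw [evJ_add, 𝒟.G.map_add, Preadditive.add_comp]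
  map_smul' r a := by rw [evJ_smul, map_smul_eq, Linear.smul_comp, RingHom.id_apply]

/-- The exact sequence `0 ⟶ X ⟶ L ⟶ Hom_R(J, X) ⟶ 0` given by a coflat lift. -/
theorem exists_shortExact {L : Cbar} (hL : IsCoflat Rbar L) (c : X ≅ 𝒟.F.obj L) :
    ∃ (i : 𝒟.G.obj X ⟶ L) (p : L ⟶ 𝒟.G.obj (𝒟.G₀.obj (𝒟.homJ X))) (w : i ≫ p = 0)
      (_ : (ShortComplex.mk i p w).ShortExact), 𝒟.adj.homEquiv _ _ i = c.hom ∧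
      ∀ a : T.J, p ≫ 𝒟.G.map (𝒟.evJ X a) ≫ i = a.val • 𝟙 L := by
  let i : 𝒟.G.obj X ⟶ L := 𝒟.G.map c.hom ≫ 𝒟.adj.counit.app L
  have : Mono i := mono_comp _ _
  have hi : 𝒟.adj.homEquiv _ _ i = c.hom := by simp [i, Adjunction.homEquiv_unit]
  have fac {W : Cbar} (f : W ⟶ L) (hf : ∀ a : T.J, a.val • f = 0) : ∃ g, g ≫ i = f := by
    obtain ⟨g, rfl⟩ := 𝒟.exists_factor_counit f hf
    exact ⟨g ≫ 𝒟.G.map c.inv, by simp [i, ← 𝒟.G.map_comp_assoc]⟩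
  -- As `J² = 0`, multiplication by `b` on `L` has image killed by `J`, hence factors through `X`.
  -- These factorizations assemble to the projection `p`.
  choose x hx using fun b : T.J => fac (b.val • 𝟙 L) fun a => J_smul_smul a b _
  obtain ⟨p, hp⟩ := 𝒟.exists_lift_evJ x
    (fun a b => by
      rw [← cancel_mono i, Preadditive.add_comp, hx, hx, hx, ← add_smul]
      rfl)
    (fun r a => by
      rw [← cancel_mono i, Linear.smul_comp, hx, hx, smul_smul]
      rfl)
  have hp' (a) : p ≫ 𝒟.G.map (𝒟.evJ X a) ≫ i = a.val • 𝟙 L := by rw [reassoc_of% (hp a), hx]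
  have w : i ≫ p = 0 := 𝒟.evJ_ext fun a => by
    rw [← cancel_mono i, Category.assoc, Category.assoc, hp', Linear.comp_smul, 𝒟.J_smul]
    simp
  have : Epi p := by
    -- Extending the evaluation family from `J` to `Rbar`, the value at `1` is a local section of
    -- `p`. This is where coflatness of `L` enters.
    obtain ⟨W, e, he, g, hg⟩ := hL.exists_extension T.valHom T.valHom_injective (𝒟.evFamily i)
    have h1 : g 1 ≫ p = e := 𝒟.evJ_ext fun a => by
      have h2 : g (a.val • 1) = e ≫ 𝒟.G.map (𝒟.evJ X a) ≫ i := by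
        rw [smul_eq_mul, mul_one]
        exact hg a
      rw [← cancel_mono i, Category.assoc, Category.assoc, Category.assoc, hp', ← h2, map_smul,
        Linear.comp_smul, Category.comp_id]
    rw [← h1] at he
    exact epi_of_epi (g 1) p
  refine ⟨i, p, w, { exact := ?_ }, hi, hp'⟩
  rw [ShortComplex.exact_iff_exact_up_to_refinements]
  intro W y hy
  dsimp at y hy
  obtain ⟨g, hg⟩ := fac y fun a => by
    have h1 := y ≫= hp' a
    rw [reassoc_of% hy, zero_comp, Linear.comp_smul, Category.comp_id] at h1
    exact h1.symm
  exact ⟨W, 𝟙 W, inferInstance, g, by simp [hg]⟩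

/-- The object in the middle of an extension on which `J` acts by evaluation lifts `X`. -/
theorem isIso_homEquiv {L : Cbar} {i : 𝒟.G.obj X ⟶ L} {p : L ⟶ 𝒟.G.obj (𝒟.G₀.obj (𝒟.homJ X))}
    {w : i ≫ p = 0} (h : (ShortComplex.mk i p w).ShortExact)
    (hp : ∀ a : T.J, p ≫ 𝒟.G.map (𝒟.evJ X a) ≫ i = a.val • 𝟙 L) :
    IsIso (𝒟.adj.homEquiv _ _ i) := by
  have := h.mono_f
  dsimp only at this
  have h0 : 𝒟.adj.counit.app L ≫ p = 0 := 𝒟.evJ_ext fun a => by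
    rw [← cancel_mono i, Category.assoc, Category.assoc, hp, Linear.comp_smul, 𝒟.J_smul]
    simp
  let r := h.exact.lift _ h0
  have hr : r ≫ i = 𝒟.adj.counit.app L := h.exact.lift_f _ _
  have hj : 𝒟.G.map (𝒟.adj.homEquiv _ _ i) ≫ 𝒟.adj.counit.app L = i := by
    simp [Adjunction.homEquiv_unit]
  have : IsIso (𝒟.G.map (𝒟.adj.homEquiv _ _ i)) := by
    refine ⟨r, ?_, ?_⟩
    · rw [← cancel_mono i, Category.assoc, hr, hj, Category.id_comp]
    · rw [← cancel_mono (𝒟.adj.counit.app L), Category.assoc, hj, hr, Category.id_comp]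
  exact isIso_of_fully_faithful 𝒟.G _

/-- For the local criterion, a family on `J` with values killed by `J` takes its values in `X`, so
it is a morphism to `Hom_R(J, X)`. Lifting that morphism locally along `p` gives an element of `L`
whose multiples are the given family. -/
theorem isCoflat_of_shortExact [IsCoherentRing R] (hX : IsCoflat R X) {L : Cbar}
    {i : 𝒟.G.obj X ⟶ L} {p : L ⟶ 𝒟.G.obj (𝒟.G₀.obj (𝒟.homJ X))}
    {w : i ≫ p = 0} (h : (ShortComplex.mk i p w).ShortExact)
    (hp : ∀ a : T.J, p ≫ 𝒟.G.map (𝒟.evJ X a) ≫ i = a.val • 𝟙 L) : IsCoflat Rbar L := by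
  have := h.mono_f
  have := h.epi_g
  have := 𝒟.isIso_homEquiv h hp
  dsimp at *
  have hi : 𝒟.G.map (𝒟.adj.homEquiv _ _ i) ≫ 𝒟.adj.counit.app L = i := by
    simp [Adjunction.homEquiv_unit]
  refine 𝒟.isFlatDeformation.isCoflat_of_isCoflat_rightAdjoint T.φ_surjective T.φ_fg
    T.mul_eq_zero 𝒟.adj (exists_iso_isCoflat (asIso (𝒟.adj.homEquiv _ _ i)) hX) ?_
  intro n V x hx
  have h1 (j) (b : T.J) : ∃ g, g ≫ i = x j b := by
    obtain ⟨g, hg⟩ := 𝒟.exists_factor_counit (x j b) fun a => hx j a b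
    refine ⟨g ≫ 𝒟.G.map (inv (𝒟.adj.homEquiv _ _ i)), ?_⟩
    rw [← hg, Category.assoc]
    conv_lhs => enter [2, 2]; rw [← hi]
    rw [← 𝒟.G.map_comp_assoc, IsIso.inv_hom_id, 𝒟.G.map_id, Category.id_comp]
  choose g hg using h1
  choose q hq using fun j => 𝒟.exists_lift_evJ (g j)
    (fun a b => by
      rw [← cancel_mono i, Preadditive.add_comp, hg, hg, hg]
      exact map_add (x j) a b)
    (fun r a => by
      rw [← cancel_mono i, Linear.smul_comp, hg, hg]
      exact map_smul (x j) r a)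
  obtain ⟨V', e, he, l, hl⟩ := IsDeformation.exists_lifts p n q
  suffices hs : ∀ j (a : T.J), a.val • l j = e ≫ x j a from ⟨V', e, he, l, hs⟩
  intro j a
  have h2 := l j ≫= hp a
  rw [reassoc_of% (hl j), reassoc_of% (hq j), hg, Linear.comp_smul, Category.comp_id] at h2
  exact h2.symm

variable [HasExt.{w₁} Cbar]

theorem exists_isLiftClass (L : 𝒟.CoflatLifts X) : ∃ e, 𝒟.IsLiftClass.{u, w₁} L e := by
  obtain ⟨i, p, w, h, hi, hp⟩ := 𝒟.exists_shortExact L.obj.2 L.iso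
  exact ⟨_, i, p, w, h, hi, hp, rfl⟩

/-- A class in `Ext¹(Hom_R(J, X), X)` that defines an extension on which `J` acts by evaluation. -/
def IsEvClass (e : Ext.{w₁} (𝒟.G.obj (𝒟.G₀.obj (𝒟.homJ X))) (𝒟.G.obj X) 1) : Prop :=
  ∀ a : T.J, IsAction a.val e (𝒟.G.map (𝒟.evJ X a))

variable {𝒟} in
theorem IsLiftClass.isEvClass {L : 𝒟.CoflatLifts X} {e} (he : 𝒟.IsLiftClass.{u, w₁} L e) :
    𝒟.IsEvClass e := by
  obtain ⟨i, p, w, h, -, hp, rfl⟩ := he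
  exact fun a => ⟨_, i, p, w, h, rfl, hp a⟩

variable {𝒟} in
theorem IsEvClass.exists_isLiftClass [IsCoherentRing R] (hX : IsCoflat R X) {e}
    (he : 𝒟.IsEvClass (X := X) e) : ∃ L, 𝒟.IsLiftClass.{u, w₁} L e := by
  obtain ⟨L, i, p, w, h, rfl⟩ := exists_extClass_eq e
  have hp (a : T.J) := (he a).of_extClass_eq h rfl
  have := 𝒟.isIso_homEquiv h hp
  exact ⟨⟨⟨L, 𝒟.isCoflat_of_shortExact hX h hp⟩, asIso (𝒟.adj.homEquiv X L i)⟩,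
    i, p, w, h, rfl, hp, rfl⟩

variable {𝒟} in
theorem IsLiftClass.eq_of_hom {L L' : 𝒟.CoflatLifts X} (f : L ⟶ L') {e e'}
    (he : 𝒟.IsLiftClass.{u, w₁} L e) (he' : 𝒟.IsLiftClass L' e') : e = e' := by
  obtain ⟨i, p, w, h, hi, hp, rfl⟩ := he
  obtain ⟨i', p', w', h', hi', hp', rfl⟩ := he'
  have := h'.mono_f
  dsimp at this
  let g : L.obj.obj ⟶ L'.obj.obj := f.1.hom.hom
  have hf : L.iso.hom ≫ 𝒟.F.map g = L'.iso.hom := f.2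
  have h1 : i ≫ g = i' := by
    apply (𝒟.adj.homEquiv _ _).injective
    rw [Adjunction.homEquiv_naturality_right, hi, hi', hf]
  have h2 : g ≫ p' = p := 𝒟.evJ_ext fun a => by
    rw [← cancel_mono i', Category.assoc, Category.assoc, hp', Linear.comp_smul, Category.comp_id,
      ← h1, Category.assoc, reassoc_of% (hp a), Linear.smul_comp, Category.id_comp]
  rw [extClass_pullback h h' g (𝟙 _) h1 (by simp [h2]), Ext.mk₀_id_comp]

variable {𝒟} in
theorem IsLiftClass.nonempty_hom {L L' : 𝒟.CoflatLifts X} {e}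
    (he : 𝒟.IsLiftClass.{u, w₁} L e) (he' : 𝒟.IsLiftClass L' e) : Nonempty (L ⟶ L') := by
  obtain ⟨i, p, w, h, hi, hp, rfl⟩ := he
  obtain ⟨i', p', w', h', hi', hp', he⟩ := he'
  obtain ⟨b, hb, -⟩ := exists_iso_of_extClass_eq h h' he.symm
  refine ⟨⟨(coflat Rbar : ObjectProperty Cbar).isoMk b, ?_⟩⟩
  change L.iso.hom ≫ 𝒟.F.map b.hom = L'.iso.hom
  rw [← hi, ← hi', ← Adjunction.homEquiv_naturality_right, hb]

variable {𝒟} in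
theorem IsLiftClass.unique {L : 𝒟.CoflatLifts X} {e e'} (he : 𝒟.IsLiftClass.{u, w₁} L e)
    (he' : 𝒟.IsLiftClass L e') : e = e' :=
  IsLiftClass.eq_of_hom (𝟙 L) he he'

/-- The class of an isomorphism class of lifts. -/
theorem exists_skClass :
    ∃ cl : Sk (𝒟.CoflatLifts X) → Ext.{w₁} (𝒟.G.obj (𝒟.G₀.obj (𝒟.homJ X))) (𝒟.G.obj X) 1,
      Function.Injective cl ∧ ∀ L, 𝒟.IsLiftClass L (cl (Sk.mk L)) := by
  choose c hc using 𝒟.exists_isLiftClass (X := X)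
  refine ⟨Quotient.lift c fun L L' ⟨f⟩ => IsLiftClass.eq_of_hom f.hom (hc L) (hc L'), ?_, hc⟩
  rintro ⟨L⟩ ⟨L'⟩ h
  obtain ⟨f⟩ := IsLiftClass.nonempty_hom (hc L) (by
    have h1 : c L = c L' := h
    rw [h1]
    exact hc L')
  exact Quotient.sound ⟨asIso f⟩

variable [HasExt.{w} C]

variable (X) in
/-- The functor `C ⥤ Cbar` on extension groups. -/
noncomputable def extMap (Z : C) (n : ℕ) : Ext.{w} Z X n →+ Ext.{w₁} (𝒟.G.obj Z) (𝒟.G.obj X) n where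
  toFun e := e.mapExactFunctor 𝒟.G
  map_zero' := by simp
  map_add' := by simp

/-- `G` is full and faithful, so a retraction in `Cbar` of an extension in `C` is already one in
`C`. -/
theorem extMap_injective (Z : C) : Function.Injective
    (𝒟.extMap X Z 1 : Ext.{w} Z X 1 → Ext.{w₁} (𝒟.G.obj Z) (𝒟.G.obj X) 1) := by
  refine (injective_iff_map_eq_zero _).2 fun e he => ?_
  obtain ⟨E, i, p, z, h, rfl⟩ := exists_extClass_eq e
  have h1 : (h.map_of_exact 𝒟.G).extClass = (0 : Ext.{w₁} _ _ 1) := by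
    rw [← Ext.mapExactFunctor_extClass]
    exact he
  obtain ⟨r, hr⟩ := exists_retraction_of_extClass_eq_zero (h.map_of_exact 𝒟.G) h1
  refine extClass_eq_zero_of_retraction h (𝒟.G.preimage r) (𝒟.G.map_injective ?_)
  rw [𝒟.G.map_comp, 𝒟.G.map_preimage, 𝒟.G.map_id]
  exact hr

theorem isAction_extMap {Z : C} (a : T.J) (e : Ext.{w} Z X 1) :
    IsAction a.val (𝒟.extMap X Z 1 e : Ext.{w₁} _ _ 1) 0 := by
  obtain ⟨E, i, p, z, h, rfl⟩ := exists_extClass_eq e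
  refine ⟨_, _, _, _, h.map_of_exact 𝒟.G, (Ext.mapExactFunctor_extClass 𝒟.G h).symm, ?_⟩
  rw [zero_comp, comp_zero]
  exact (𝒟.J_smul a _).symm

/-- Zero action means that the middle term is annihilated by `J`, hence lies in the image of `C`;
the whole sequence then comes from `C`. -/
theorem exists_extMap_eq {Z : C} {e : Ext.{w₁} (𝒟.G.obj Z) (𝒟.G.obj X) 1}
    (he : ∀ a : T.J, IsAction a.val e 0) : ∃ e' : Ext.{w} Z X 1, 𝒟.extMap X Z 1 e' = e := by
  obtain ⟨E, i, p, z, h, rfl⟩ := exists_extClass_eq e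
  have h0 (a : T.J) : a.val • 𝟙 E = 0 := by
    rw [← (he a).of_extClass_eq h rfl, zero_comp, comp_zero]
  obtain ⟨V, ⟨b⟩⟩ := 𝒟.isFlatDeformation.exists_iso T.φ_surjective E fun r hr => h0 ⟨r, hr⟩
  have hb : 𝒟.G.preimage (i ≫ b.inv) ≫ 𝒟.G.preimage (b.hom ≫ p) = 0 :=
    𝒟.G.map_injective (by simp [z])
  have h1 : ((ShortComplex.mk _ _ hb).map 𝒟.G).ShortExact :=
    ShortComplex.shortExact_of_iso (S₁ := ShortComplex.mk i p z)
      (S₂ := (ShortComplex.mk _ _ hb).map 𝒟.G) (ShortComplex.isoMk (Iso.refl _) b.symm (Iso.refl _)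
      ((Category.id_comp _).trans (𝒟.G.map_preimage _))
      ((congrArg (b.inv ≫ ·) (𝒟.G.map_preimage _)).trans
        ((b.inv_hom_id_assoc p).trans (Category.comp_id p).symm))) h
  have h2 : (ShortComplex.mk _ _ hb).ShortExact := 
    ShortExact.reflects_shortExact_of_faithful 𝒟.G h1
  refine ⟨h2.extClass, (Ext.mapExactFunctor_extClass 𝒟.G h2).trans ?_⟩
  exact ((extClass_pullback h (h2.map_of_exact 𝒟.G) b.inv (𝟙 _) (by simp) (by simp)).trans
    (Ext.mk₀_id_comp _)).symm

end DeformationTower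

/-! ### Resolving sequences and independence of the obstruction class -/

namespace DeformationTower

variable {Rbar R S : Type u} [CommRing Rbar] [CommRing R] [CommRing S] {T : RingTower Rbar R S}
  {C₀ : Type u₁} [Category.{v₁} C₀] [Abelian C₀] [Linear S C₀]
  {C : Type u₂} [Category.{v₂} C] [Abelian C] [Linear R C]
  {Cbar : Type u₃} [Category.{v₃} Cbar] [Abelian Cbar] [Linear Rbar Cbar]
  (𝒟 : DeformationTower T C₀ C Cbar) [IsCoherentRing Rbar] {X : C}

instance : 𝒟.F.Additive := 𝒟.adj.right_adjoint_additive

/-- `δ` describes the multiplication by `J` on the part of `E` lying over `Hom_Rbar(R, Q)`. -/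
def IsConnecting {E Q : Cbar} (k : 𝒟.G.obj X ⟶ E) (π : E ⟶ Q)
    (δ : 𝒟.F.obj Q ⟶ 𝒟.G₀.obj (𝒟.homJ X)) : Prop :=
  ∀ {Z : Cbar} (t : Z ⟶ E) (y : Z ⟶ 𝒟.G.obj (𝒟.F.obj Q)), t ≫ π = y ≫ 𝒟.adj.counit.app Q →
    ∀ a : T.J, y ≫ 𝒟.G.map (δ ≫ 𝒟.evJ X a) ≫ k = a.val • t

variable {E Q : Cbar} {k : 𝒟.G.obj X ⟶ E} {π : E ⟶ Q} {z : k ≫ π = 0}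

/-- The pullback of `E` to `F Q` is an extension of objects of `C`, on which the action of `J` is
given by a morphism to `Hom_R(J, X)`. -/
theorem exists_isConnecting (h : (ShortComplex.mk k π z).ShortExact) :
    ∃ δ, 𝒟.IsConnecting k π δ := by
  obtain ⟨E', i', p', t', z', h', h1, h2, h3⟩ :=
    exists_pullback_shortExact h (𝒟.adj.counit.app Q)
  obtain ⟨δ, hδ⟩ := 𝒟.exists_action h'
  refine ⟨δ, fun t y hty a => ?_⟩
  obtain ⟨c, rfl, rfl⟩ := h3 y t hty.symm
  have h4 := c ≫= hδ a =≫ t'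
  simpa [h1] using h4

theorem exists_lift_of_shortExact (h : (ShortComplex.mk k π z).ShortExact) {W : C}
    {f : 𝒟.G.obj W ⟶ E} (hf : f ≫ π = 0) : ∃ g : W ⟶ X, 𝒟.G.map g ≫ k = f := by
  have := h.mono_f
  exact ⟨𝒟.G.preimage (h.exact.lift f hf), by rw [𝒟.G.map_preimage]; exact h.exact.lift_f f hf⟩

namespace IsConnecting

variable {𝒟} {δ : 𝒟.F.obj Q ⟶ 𝒟.G₀.obj (𝒟.homJ X)}

theorem map_comp (h : (ShortComplex.mk k π z).ShortExact) (hδ : 𝒟.IsConnecting k π δ) :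
    𝒟.F.map π ≫ δ = 0 := by
  have := h.mono_f
  dsimp at this
  apply 𝒟.G.map_injective
  rw [𝒟.G.map_zero]
  refine 𝒟.evJ_ext fun a => ?_
  have h1 := hδ (𝒟.adj.counit.app E) (𝒟.G.map (𝒟.F.map π)) (by simp) a
  rw [𝒟.J_smul] at h1
  rw [← cancel_mono k, ← 𝒟.G.map_comp, Category.assoc, 𝒟.G.map_comp, Category.assoc, h1]
  simp

/-- The connecting map is an epimorphism if, locally, the evaluation maps are given by the
multiplication by `J` on `E`. -/
theorem epi (h : (ShortComplex.mk k π z).ShortExact) (hδ : 𝒟.IsConnecting k π δ) {W : Cbar}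
    (e : W ⟶ 𝒟.G.obj (𝒟.G₀.obj (𝒟.homJ X))) [Epi e] (t : W ⟶ E)
    (ht : ∀ a : T.J, a.val • t = e ≫ 𝒟.G.map (𝒟.evJ X a) ≫ k) : Epi δ := by
  have := h.mono_f
  dsimp at this
  obtain ⟨y, hy⟩ := 𝒟.exists_factor_counit (t ≫ π) fun a => by
    rw [← Linear.smul_comp, ht, Category.assoc, Category.assoc, z, comp_zero, comp_zero]
  have h1 : y ≫ 𝒟.G.map δ = e := 𝒟.evJ_ext fun a => by
    have h2 := hδ t y hy.symm a
    rw [ht, 𝒟.G.map_comp, Category.assoc] at h2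
    rw [← cancel_mono k, Category.assoc, Category.assoc, Category.assoc, h2]
  have h2 : Epi (y ≫ 𝒟.G.map δ) := by rwa [h1]
  have := epi_of_epi y (𝒟.G.map δ)
  exact 𝒟.G.epi_of_epi_map this

/-- Connecting maps are compatible with morphisms of extensions of `X`. -/
theorem comp_eq (h : (ShortComplex.mk k π z).ShortExact) (hδ : 𝒟.IsConnecting k π δ)
    {E' Q' : Cbar} {k' : 𝒟.G.obj X ⟶ E'} {π' : E' ⟶ Q'} [Mono k']
    {δ' : 𝒟.F.obj Q' ⟶ 𝒟.G₀.obj (𝒟.homJ X)} (hδ' : 𝒟.IsConnecting k' π' δ') (f : E ⟶ E')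
    (g : Q ⟶ Q') (hf : k ≫ f = k') (hg : f ≫ π' = π ≫ g) : 𝒟.F.map g ≫ δ' = δ := by
  have := h.epi_g
  dsimp at this
  obtain ⟨W, e, _, t, ht⟩ := surjective_up_to_refinements_of_epi π (𝒟.adj.counit.app Q)
  apply 𝒟.G.map_injective
  refine 𝒟.evJ_ext fun a => ?_
  rw [← cancel_mono k', ← cancel_epi e]
  have h1 := hδ t e ht.symm a =≫ f
  have h2 := hδ' (t ≫ f) (e ≫ 𝒟.G.map (𝒟.F.map g)) (by
    rw [Category.assoc, hg, ← Category.assoc, ← ht]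
    simp) a
  simp only [Category.assoc, hf, 𝒟.G.map_comp, Linear.smul_comp] at h1 h2 ⊢
  rw [h1, h2]

theorem shortExact_lift (h : (ShortComplex.mk k π z).ShortExact) (hδ : 𝒟.IsConnecting k π δ)
    (z₁ : 𝒟.adj.homEquiv _ _ k ≫ kernel.lift δ (𝒟.F.map π) (hδ.map_comp h) = 0) :
    (ShortComplex.mk (𝒟.adj.homEquiv _ _ k) (kernel.lift δ (𝒟.F.map π) (hδ.map_comp h))
      z₁).ShortExact := by
  have := h.mono_f
  have := h.epi_g
  dsimp at *
  have hk : 𝒟.G.map (𝒟.adj.homEquiv _ _ k) ≫ 𝒟.adj.counit.app E = k := by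
    simp [Adjunction.homEquiv_unit]
  have mono : Mono (𝒟.adj.homEquiv _ _ k) := by
    have h1 : Mono (𝒟.G.map (𝒟.adj.homEquiv _ _ k) ≫ 𝒟.adj.counit.app E) := by rwa [hk]
    have := mono_of_mono (𝒟.G.map (𝒟.adj.homEquiv _ _ k)) (𝒟.adj.counit.app E)
    exact 𝒟.G.mono_of_mono_map this
  have epi : Epi (kernel.lift δ (𝒟.F.map π) (hδ.map_comp h)) := by
    rw [epi_iff_surjective_up_to_refinements]
    intro W x
    obtain ⟨V, e, _, t, ht⟩ := surjective_up_to_refinements_of_epi π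
      (𝒟.G.map (x ≫ kernel.ι δ) ≫ 𝒟.adj.counit.app Q)
    obtain ⟨V', q, _, hq⟩ :=
      𝒟.isFlatDeformation.exists_quotient T.φ_surjective T.φ_fg V
    -- An element of `F Q` killed by `δ` lifts locally to an element of `E` that `J` annihilates,
    -- and such an element belongs to `F E`.
    have ht0 (r : Rbar) (hr : T.φ r = 0) : r • t = 0 := by
      have h1 := hδ t (e ≫ 𝒟.G.map (x ≫ kernel.ι δ)) (by rw [← ht, Category.assoc]) ⟨r, hr⟩
      rw [Category.assoc, ← 𝒟.G.map_comp_assoc, Category.assoc, kernel.condition_assoc] at h1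
      exact h1.symm.trans (by simp)
    obtain ⟨t', rfl⟩ := hq t ht0
    obtain ⟨e', rfl⟩ := hq e fun r hr => 𝒟.J_smul' ⟨r, hr⟩ e
    have := epi_of_epi q e'
    refine ⟨V', 𝒟.G.preimage e', 𝒟.G.epi_of_epi_map (by rwa [𝒟.G.map_preimage]),
      𝒟.adj.homEquiv _ _ t', ?_⟩
    rw [← cancel_mono (kernel.ι δ), Category.assoc, Category.assoc, kernel.lift_ι]
    apply (𝒟.adj.homEquiv _ _).symm.injective
    rw [← cancel_epi q, Adjunction.homEquiv_counit, Adjunction.homEquiv_counit, 𝒟.G.map_comp,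
      𝒟.G.map_preimage]
    simpa [Adjunction.homEquiv_unit] using ht
  refine { exact := ?_ }
  rw [ShortComplex.exact_iff_exact_up_to_refinements]
  intro W x hx
  dsimp at x hx
  obtain ⟨g, hg⟩ := 𝒟.exists_lift_of_shortExact h (f := 𝒟.G.map x ≫ 𝒟.adj.counit.app E) (by
    have h1 := congrArg 𝒟.G.map (hx =≫ kernel.ι δ)
    rw [Category.assoc, kernel.lift_ι, zero_comp, 𝒟.G.map_zero, 𝒟.G.map_comp] at h1
    have h2 := 𝒟.adj.counit.naturality π
    dsimp at h2
    rw [Category.assoc, ← h2, reassoc_of% h1, zero_comp])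
  refine ⟨W, 𝟙 W, inferInstance, g, ?_⟩
  apply 𝒟.G.map_injective
  rw [← cancel_mono (𝒟.adj.counit.app E)]
  dsimp
  rw [Category.id_comp, 𝒟.G.map_comp, Category.assoc, hk, hg]

end IsConnecting

/-- A short exact sequence with an epimorphic connecting map resolves `X`. -/
noncomputable def resolvingOfEpi (h : (ShortComplex.mk k π z).ShortExact)
    (δ : 𝒟.F.obj Q ⟶ 𝒟.G₀.obj (𝒟.homJ X)) (hδ : 𝒟.IsConnecting k π δ) [Epi δ] : 𝒟.Resolving X :=
  have z₁ : 𝒟.adj.homEquiv _ _ k ≫ kernel.lift δ (𝒟.F.map π) (hδ.map_comp h) = 0 := by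
    rw [← cancel_mono (kernel.ι δ), Category.assoc, kernel.lift_ι, zero_comp,
      ← Adjunction.homEquiv_naturality_right, z, Adjunction.homEquiv_unit, 𝒟.F.map_zero, comp_zero]
  { E := E
    Q := Q
    k := k
    π := π
    zero := z
    shortExact := h
    δ := δ
    δ_spec := hδ
    I := kernel δ
    q := kernel.lift δ (𝒟.F.map π) (hδ.map_comp h)
    m := kernel.ι δ
    fac := kernel.lift_ι _ _ _
    zero₁ := z₁
    shortExact₁ := hδ.shortExact_lift h z₁
    zero₂ := kernel.condition δ
    shortExact₂ := shortExact_of_epi δ }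

variable [HasExt.{w} C]

/-- The obstruction class of a resolving sequence. -/
noncomputable def Resolving.extClass {𝒟 : DeformationTower T C₀ C Cbar} (D : 𝒟.Resolving X) :
    Ext.{w} (𝒟.G₀.obj (𝒟.homJ X)) X 2 :=
  D.shortExact₂.extClass.comp D.shortExact₁.extClass rfl

theorem Resolving.extClass_eq_of_hom {𝒟 : DeformationTower T C₀ C Cbar} (D D' : 𝒟.Resolving X)
    (f : D.E ⟶ D'.E) (g : D.Q ⟶ D'.Q) (hf : D.k ≫ f = D'.k) (hg : f ≫ D'.π = D.π ≫ g) :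
    D.extClass = D'.extClass := by
  have := D'.shortExact.mono_f
  have := D'.shortExact₂.mono_f
  have := D.shortExact₁.epi_g
  dsimp at *
  have hδ : 𝒟.F.map g ≫ D'.δ = D.δ :=
    IsConnecting.comp_eq D.shortExact D.δ_spec D'.δ_spec f g hf hg
  obtain ⟨α, hα⟩ : ∃ α : D.I ⟶ D'.I, α ≫ D'.m = D.m ≫ 𝒟.F.map g := by
    have h0 : (D.m ≫ 𝒟.F.map g) ≫ D'.δ = 0 := by rw [Category.assoc, hδ, D.zero₂]
    exact ⟨D'.shortExact₂.exact.lift _ h0, D'.shortExact₂.exact.lift_f _ h0⟩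
  have h1 : D.shortExact₁.extClass = (Ext.mk₀ α).comp D'.shortExact₁.extClass (zero_add 1) :=
    extClass_pullback D.shortExact₁ D'.shortExact₁ (𝒟.F.map f) α
      (by rw [← Adjunction.homEquiv_naturality_right, hf]) (by
        rw [← cancel_mono D'.m, Category.assoc, Category.assoc, D'.fac, hα, ← 𝒟.F.map_comp, hg,
          𝒟.F.map_comp, reassoc_of% D.fac])
  have h2 : D'.shortExact₂.extClass.comp (Ext.mk₀ (𝟙 _)) (add_zero 1) =
      D.shortExact₂.extClass.comp (Ext.mk₀ α) (add_zero 1) := by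
    rw [Ext.comp_mk₀_id, extClass_naturality D.shortExact₂ D'.shortExact₂ α (𝒟.F.map g) (𝟙 _) hα
      (by rw [hδ, Category.comp_id]), Ext.mk₀_id_comp]
  rw [Ext.comp_mk₀_id] at h2
  rw [Resolving.extClass, Resolving.extClass, h1, h2, Ext.comp_assoc_of_second_deg_zero]

/-- The evaluation family on `J` extends to `Rbar` once `X` is embedded into a suitable `E`. Its
value at `1` shows that evaluation is locally multiplication on `E`, as required for `δ` to be epi.
-/
theorem exists_resolving : Nonempty (𝒟.Resolving X) := by
  obtain ⟨E, k, _, W, e, _, g, hg⟩ := 𝒟.isFlatDeformation.flat.hasExtensions T.valHom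
    T.valHom_injective (𝒟.evFamily (𝟙 (𝒟.G.obj X)))
  have h := shortExact_of_mono k
  obtain ⟨δ, hδ⟩ := 𝒟.exists_isConnecting h
  have : Epi δ := hδ.epi h e (g 1) fun a => by
    rw [← map_smul, smul_eq_mul, mul_one]
    refine (hg a).trans ?_
    simp [evFamily]
  exact ⟨𝒟.resolvingOfEpi h δ hδ⟩

/-- Both sequences map to the one whose middle term is the pushout of `E` and `E'` under `X`. Its
connecting map is epi, since the epi connecting map of `D` factors through it. -/
theorem Resolving.extClass_eq {𝒟 : DeformationTower T C₀ C Cbar} (D D' : 𝒟.Resolving X) :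
    (D.extClass : Ext.{w} _ _ 2) = D'.extClass := by
  obtain ⟨E, i, p, t, z, h, h1, h2⟩ := exists_pushout_shortExact D.shortExact D'.k
  have := D'.shortExact.mono_f
  have := h.mono_f
  dsimp at *
  have hk : Mono (D'.k ≫ i) := mono_comp _ _
  have h' := shortExact_of_mono (D'.k ≫ i)
  obtain ⟨δ, hδ⟩ := 𝒟.exists_isConnecting h'
  have hom (B : 𝒟.Resolving X) (f : B.E ⟶ E) (hf : B.k ≫ f = D'.k ≫ i) :
      ∃ g : B.Q ⟶ _, f ≫ cokernel.π (D'.k ≫ i) = B.π ≫ g := by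
    have := B.shortExact.epi_g
    have h0 : B.k ≫ f ≫ cokernel.π (D'.k ≫ i) = 0 := by
      rw [reassoc_of% hf, ← Category.assoc, cokernel.condition]
    exact ⟨B.shortExact.exact.desc _ h0, (B.shortExact.exact.g_desc _ h0).symm⟩
  obtain ⟨g, hg⟩ := hom D t h1.symm
  obtain ⟨g', hg'⟩ := hom D' i rfl
  have : Epi δ := by
    have h3 := IsConnecting.comp_eq D.shortExact D.δ_spec hδ t g h1.symm hg
    have h4 := D.shortExact₂.epi_g
    dsimp at h4
    rw [← h3] at h4
    exact epi_of_epi (𝒟.F.map g) δ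
  exact (D.extClass_eq_of_hom (𝒟.resolvingOfEpi h' δ hδ) t g h1.symm hg).trans
    (D'.extClass_eq_of_hom (𝒟.resolvingOfEpi h' δ hδ) i g' rfl hg').symm

end DeformationTower

/-- The affine structure on a set that is identified with a coset of the image of an injective
homomorphism. -/
theorem exists_addTorsor {H : Type w} {A : Type w₁} {P : Type w₂} [AddCommGroup H]
    [AddCommGroup A] [Nonempty P] (ψ : H →+ A) (hψ : Function.Injective ψ) (cl : P → A)
    (hcl : Function.Injective cl) (h₁ : ∀ p ξ, ∃ q, cl q = cl p + ψ ξ)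
    (h₂ : ∀ p q, ∃ ξ, cl p - cl q = ψ ξ) :
    ∃ _ : AddTorsor H P, ∀ (ξ : H) (p q : P), q = ξ +ᵥ p ↔ cl q = cl p + ψ ξ := by
  choose v hv using h₁
  choose s hs using h₂
  refine ⟨
    { vadd ξ p := v p ξ
      zero_vadd p := hcl (by
        change cl (v p 0) = _
        rw [hv, map_zero, add_zero])
      add_vadd ξ ξ' p := hcl (by
        change cl (v p (ξ + ξ')) = cl (v (v p ξ') ξ)
        rw [hv, hv, hv, map_add, add_comm (ψ ξ), add_assoc])
      vsub p q := s p q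
      vsub_vadd' p q := hcl (by
        change cl (v q (s p q)) = _
        rw [hv, ← hs, add_sub_cancel])
      vadd_vsub' ξ p := hψ (by
        change ψ (s (v p ξ) p) = _
        rw [← hs, hv, add_sub_cancel_left]) }, fun ξ p q => ?_⟩
  change q = v p ξ ↔ _
  rw [← hv, hcl.eq_iff]

/-! ### From the vanishing of the obstruction to a lift -/

namespace DeformationTower

variable {Rbar R S : Type u} [CommRing Rbar] [CommRing R] [CommRing S] {T : RingTower Rbar R S}
  {C₀ : Type u₁} [Category.{v₁} C₀] [Abelian C₀] [Linear S C₀]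
  {C : Type u₂} [Category.{v₂} C] [Abelian C] [Linear R C]
  {Cbar : Type u₃} [Category.{v₃} Cbar] [Abelian Cbar] [Linear Rbar Cbar]
  (𝒟 : DeformationTower T C₀ C Cbar)

theorem J_smul_id (a : T.J) (Z : C) : a.val • 𝟙 (𝒟.G.obj Z) = 0 := 𝒟.J_smul a _

variable [IsCoherentRing Rbar] {X : C} [HasExt.{w} C]

/-- The lift itself is the middle term: `X ⟶ F L` is then an isomorphism, so the first half of the
four-term sequence splits. -/
theorem exists_resolving_of_lift (L : 𝒟.CoflatLifts X) :
    ∃ D : 𝒟.Resolving X, (D.extClass : Ext.{w} _ _ 2) = 0 := by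
  obtain ⟨i, p, w, h, hi, hp⟩ := 𝒟.exists_shortExact L.obj.2 L.iso
  have := h.epi_g
  dsimp at this
  obtain ⟨δ, hδ⟩ := 𝒟.exists_isConnecting h
  have : Epi δ := hδ.epi h p (𝟙 _) fun a => (hp a).symm
  refine ⟨𝒟.resolvingOfEpi h δ hδ, ?_⟩
  have h0 : (𝒟.resolvingOfEpi h δ hδ).shortExact₁.extClass = (0 : Ext.{w} _ _ 1) := by
    refine extClass_eq_zero_of_retraction _ L.iso.inv ?_
    change 𝒟.adj.homEquiv _ _ i ≫ _ = _
    rw [hi]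
    exact L.iso.hom_inv_id
  rw [Resolving.extClass, h0, Ext.comp_zero]

variable [HasExt.{w₁} Cbar]

theorem Resolving.exists_isEvClass {𝒟 : DeformationTower T C₀ C Cbar} (D : 𝒟.Resolving X)
    (hD : (D.extClass : Ext.{w} _ _ 2) = 0) :
    ∃ e : Ext.{w₁} (𝒟.G.obj (𝒟.G₀.obj (𝒟.homJ X))) (𝒟.G.obj X) 1, 𝒟.IsEvClass e := by
  have := D.shortExact₂.epi_g
  dsimp at this
  -- Vanishing of the Yoneda product means that the class of `0 → X → F E → I → 0` is the
  -- restriction of some `α` over `F Q`.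
  obtain ⟨α, hα⟩ := Ext.contravariant_sequence_exact₁ D.shortExact₂ X D.shortExact₁.extClass
    (n₁ := 2) rfl hD
  dsimp at α hα
  let c : 𝒟.G.obj (𝒟.F.obj D.Q) ⟶ D.Q := 𝒟.adj.counit.app D.Q
  let ε : Ext.{w₁} (𝒟.G.obj (𝒟.F.obj D.Q)) (𝒟.G.obj X) 1 :=
    (Ext.mk₀ c).comp D.shortExact.extClass (zero_add 1)
  obtain ⟨E', i', p', t', z', h', h1, h2, -⟩ := exists_pullback_shortExact D.shortExact c
  have hE' : h'.extClass = ε := extClass_pullback h' D.shortExact t' _ h1 h2.symm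
  have hβ (a : T.J) : IsAction a.val (ε - 𝒟.extMap X _ 1 α)
      (𝒟.G.map (D.δ ≫ 𝒟.evJ X a)) := by
    have h3 : IsAction a.val ε (𝒟.G.map (D.δ ≫ 𝒟.evJ X a)) := by
      obtain ⟨v, hv⟩ := exists_isAction (𝒟.J_smul_id a X) (𝒟.J_smul_id a _) ε
      have h4 := hv.of_extClass_eq h' hE'
      have := D.shortExact.mono_f
      have := h'.epi_g
      dsimp at *
      have h5 := D.δ_spec t' p' h2.symm a
      have h6 := h4 =≫ t'
      rw [Category.assoc, Category.assoc, h1, Linear.smul_comp, Category.id_comp, ← h5, cancel_epi,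
        cancel_mono] at h6
      rwa [← h6]
    simpa using h3.sub (𝒟.J_smul_id a _) (𝒟.J_smul_id a _) (𝒟.isAction_extMap a α)
  -- Over `I`, both `ε` and the image of `α` restrict to the class of `F E`, so their difference
  -- descends along `δ`.
  obtain ⟨e, he⟩ := Ext.contravariant_sequence_exact₂ (D.shortExact₂.map_of_exact 𝒟.G) (𝒟.G.obj X)
    (ε - 𝒟.extMap X _ 1 α) (by
      have h3 : (D.shortExact₁.map_of_exact 𝒟.G).extClass =
          (Ext.mk₀ (𝒟.G.map D.m ≫ c)).comp (D.shortExact.extClass : Ext.{w₁} _ _ 1)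
            (zero_add 1) := by
        refine extClass_pullback (D.shortExact₁.map_of_exact 𝒟.G) D.shortExact
          (𝒟.adj.counit.app D.E) _ ?_ ?_
        · simp [Adjunction.homEquiv_unit]
        · change _ = 𝒟.G.map D.q ≫ 𝒟.G.map D.m ≫ c
          rw [← 𝒟.G.map_comp_assoc, D.fac]
          simp [c]
      have h4 := congrArg (𝒟.extMap X _ 1 : _ → Ext.{w₁} _ _ 1) hα
      change Ext.mapExactFunctor 𝒟.G _ = Ext.mapExactFunctor 𝒟.G _ at h4
      rw [Ext.mapExactFunctor_comp, Ext.mapExactFunctor_mk₀, Ext.mapExactFunctor_extClass, h3] at h4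
      change (Ext.mk₀ (𝒟.G.map D.m)).comp _ _ = 0
      rw [sub_eq_add_neg, Ext.comp_add, Ext.comp_neg, ← sub_eq_add_neg, sub_eq_zero,
        Ext.mk₀_comp_mk₀_assoc]
      exact h4.symm)
  refine ⟨e, fun a => ?_⟩
  -- The image of `α` has zero action, so the action of `e`, pulled back along `δ`, is `δ ≫ ev`. As
  -- `δ` is epi, `e` itself has action `ev`.
  obtain ⟨v, hv⟩ := exists_isAction (𝒟.J_smul_id a X) (𝒟.J_smul_id a _) e
  have h3 := hv.precomp (𝒟.J_smul_id a X) (𝒟.J_smul_id a _) (𝒟.G.map D.δ)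
  have h4 := hβ a
  rw [← he] at h4
  have h5 := h3.unique h4
  rw [𝒟.G.map_comp, cancel_epi] at h5
  rwa [← h5]

variable {𝒟} in
theorem IsLiftClass.exists_extMap_eq {L L' : 𝒟.CoflatLifts X} {e e'}
    (he : 𝒟.IsLiftClass.{u, w₁} L e) (he' : 𝒟.IsLiftClass L' e') :
    ∃ α : Ext.{w} (𝒟.G₀.obj (𝒟.homJ X)) X 1, 𝒟.extMap X _ 1 α = e - e' :=
  𝒟.exists_extMap_eq fun a => by
    have h := (he.isEvClass a).sub (𝒟.J_smul_id a _) (𝒟.J_smul_id a _) (he'.isEvClass a)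
    rwa [sub_self] at h

variable {𝒟} in
theorem IsEvClass.add_extMap {e} (he : 𝒟.IsEvClass (X := X) e)
    (α : Ext.{w} (𝒟.G₀.obj (𝒟.homJ X)) X 1) : 𝒟.IsEvClass.{u, w₁} (e + 𝒟.extMap X _ 1 α) :=
  fun a => by
    have h := (he a).add (𝒟.J_smul_id a _) (𝒟.J_smul_id a _) (𝒟.isAction_extMap a α)
    rwa [add_zero] at h

end DeformationTower

end CoflatLift

/-! ### The main theorem -/

open CoflatLift
theorem theoremA {Rbar R S : Type u} [CommRing Rbar] [CommRing R] [CommRing S]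
    [IsCoherentRing Rbar] [IsCoherentRing R] [IsCoherentRing S] (T : RingTower Rbar R S)
    {C₀ : Type u₁} [Category.{v₁} C₀] [Abelian C₀] [Linear S C₀]
    {C : Type u₂} [Category.{v₂} C] [Abelian C] [Linear R C]
    {Cbar : Type u₃} [Category.{v₃} Cbar] [Abelian Cbar] [Linear Rbar Cbar]
    [HasDerivedCategory.{w} C₀] [HasExt.{w₁} C₀] [HasExt.{w₂} C] [HasExt.{w₃} Cbar]
    (𝒟 : DeformationTower T C₀ C Cbar)
    (P : ProjectiveResolution (ModuleCat.of S T.J))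
    [∀ n, Module.FinitePresentation S (P.complex.X n)]
    (X : C) (hX : IsCoflat R X) :
    ∃ o : 𝒟.H X P 2,
      (∀ e : Abelian.Ext.{w₂} (𝒟.G₀.obj (𝒟.homJ X)) X 2,
        𝒟.IsObstructionClass X e ↔ e = 𝒟.toExt o) ∧
      (o = 0 ↔ Nonempty (𝒟.CoflatLifts X)) ∧
      (o = 0 → ∃ _ : AddTorsor (𝒟.H X P 1) (Sk (𝒟.CoflatLifts X)),
        ∀ (ξ : 𝒟.H X P 1) (L L' : 𝒟.CoflatLifts X),
          Sk.mk L' = ξ +ᵥ Sk.mk L ↔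
            ∃ e e', 𝒟.IsLiftClass L e ∧ 𝒟.IsLiftClass L' e' ∧
              e' = e + (𝒟.toExt ξ).mapExactFunctor 𝒟.G) := by
  obtain ⟨D⟩ := 𝒟.exists_resolving (X := X)
  -- Bijectivity of `Ψ²` allows the obstruction to be defined as the preimage of the Yoneda class.
  obtain ⟨o, ho⟩ := (𝒟.toExtHom_bijective_two P hX).2 D.extClass
  have ho0 : o = 0 ↔ (D.extClass : Abelian.Ext.{w₂} _ _ 2) = 0 := by
    rw [← ho, map_eq_zero_iff _ (𝒟.toExtHom_bijective_two P hX).1]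
  have hlift : o = 0 ↔ Nonempty (𝒟.CoflatLifts X) := by
    rw [ho0]
    refine ⟨fun h => ?_, fun ⟨L⟩ => ?_⟩
    · obtain ⟨e, he⟩ : ∃ e : Abelian.Ext.{w₃} _ _ 1, 𝒟.IsEvClass e := D.exists_isEvClass h
      exact ⟨(he.exists_isLiftClass hX).choose⟩
    · obtain ⟨D', hD'⟩ := 𝒟.exists_resolving_of_lift L
      rw [D.extClass_eq D', hD']
  refine ⟨o, fun e => ⟨?_, ?_⟩, hlift, fun h => ?_⟩
  · rintro ⟨D', rfl⟩
    exact (D'.extClass_eq D).trans ho.symm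
  · rintro rfl
    exact ⟨D, ho.symm⟩
  · have : Nonempty (Sk (𝒟.CoflatLifts X)) := (hlift.1 h).map Sk.mk
    obtain ⟨cl, hcl, hL⟩ := 𝒟.exists_skClass (X := X)
    -- Through their extension classes, the lifts form a coset of the image of the injective map
    -- `Ψ¹` followed by `extMap`.
    obtain ⟨t, ht⟩ := exists_addTorsor ((𝒟.extMap X _ 1).comp (𝒟.toExtHom P X 1))
      ((𝒟.extMap_injective _).comp (𝒟.toExtHom_bijective_one P hX).1) cl hcl
      (by
        rintro ⟨L⟩ ξ
        obtain ⟨L', hL'⟩ := ((hL L).isEvClass.add_extMap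
          (𝒟.toExtHom P X 1 ξ)).exists_isLiftClass hX
        exact ⟨Sk.mk L', (hL L').unique hL'⟩)
      (by
        rintro ⟨L⟩ ⟨L'⟩
        obtain ⟨α, hα⟩ := (hL L).exists_extMap_eq (hL L')
        obtain ⟨ξ, rfl⟩ := (𝒟.toExtHom_bijective_one P hX).2 α
        exact ⟨ξ, hα.symm⟩)
    refine ⟨t, fun ξ L L' => (ht ξ _ _).trans ⟨fun h' => ⟨_, _, hL L, hL L', h'⟩, ?_⟩⟩
    rintro ⟨e, e', he, he', h'⟩
    rw [(hL L).unique he, (hL L').unique he']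
    exact h'
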